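/- Let $V$ be a vertex operator algebra over $\mathbb C$, and let $\mathcal D$ be one of the following two categories of weak $V$-modules: $\mathcal C(V)$, the $V$-modules ($L(0)$ acts semisimply, $W=\bigoplus_{h\in\mathbb C}W_h$ with $\dim W_h<\infty$, and for each $h$, $W_{h+n}=0$ for all sufficiently small $n\in\mathbb Z$); or $\mathcal C^1(V)$, the weak $V$-modules on which $L(0)$ acts locally finitely and all of whose generalized weights lie in a finite union $\bigcup_i(h_i+\mathbb Z_{\ge0})$, $h_i\in\mathbb C$. For $W$ in $\mathcal D$, $W'$ denotes the restricted dual, the direct sum of the duals of the generalized weight spaces of $W$. An intertwining operator of type $\binom{W_3}{W_1W_2}$ is a linear map $I(\cdot,z):W_1\to \mathrm{Hom}(W_2,W_3)\{z\}$, $I(w,z)=\sum_{n\in\mathbb C}w_nz^{-n-1}$, such that for all $\alpha\in\mathbb C$ one has $w_{\alpha+n}u=0$ for all sufficiently large $n\in\mathbb Z$, $I(L(-1)w,z)=\frac{d}{dz}I(w,z)$, and the Jacobi identity holds. A tensor product of $(W_1,W_2)$ in $\mathcal D$ is an object $T$ of $\mathcal D$ with an intertwining operator $F$ of type $\binom{T}{W_1W_2}$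 such that every intertwining operator $I$ of type $\binom{W}{W_1W_2}$ with $W$ in $\mathcal D$ is $I=\psi\circ F$ for a unique $V$-homomorphism $\psi:T\to W$. Let $W_1,W_2,W_3$ be in $\mathcal D$, and let $(W_{12},F_{12})$, $(W_{12,3},F_{12,3})$, $(W_{23},F_{23})$, $(W_{1,23},F_{1,23})$ be tensor products in $\mathcal D$ of $(W_1,W_2)$, $(W_{12},W_3)$, $(W_2,W_3)$, $(W_1,W_{23})$, respectively. Assume the convergence and extension property for the iterates of $F_{12}$ and $F_{12,3}$: there is an integer $\tilde N$ such that for all homogeneous $w_i\in W_i$ $(i=1,2,3)$ and $w_4'\in W_{12,3}'$ there are $k\in\mathbb N$, $r_i,s_i\in\mathbb C$ and functions $f_i$ analytic on $|z|<1$ $(1\le i\le k)$, with $\mathrm{Re}(\mathrm{gwt}\,w_2+\mathrm{gwt}\,w_3+s_i)>\tilde N$, such that $$\langle w_4',F_{12,3}(F_{12}(w_1,z_1-z_2)w_2,z_2)w_3\rangle$$ converges absolutely for $|z_2|>|z_1-z_2|>0$ and extends analytically to the multi-valued function $\sum_{i=1}^kz_1^{r_i}z_2^{s_i}f_i(z_2/z_1)$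 on $|z_1|>|z_2|>0$. Here the branches are matched on $|z_1|>|z_2|>|z_1-z_2|>0$ so that all three logarithms may be taken real for real $z_1>z_2>z_1-z_2>0$. For arbitrary $w_i\in W_i$ and $w_4'\in W_{12,3}'$, whose matrix coefficient extends to a function of the same form, denote by $$E^{12}\langle w_4',F_{12,3}(F_{12}(w_1,z_1-z_2)w_2,z_2)w_3\rangle$$ the formal series in complex powers of $z_1,z_2$ obtained from this function by Taylor expanding the $f_i$ at $0$. For $w_2\in W_2$, $w_3\in W_3$ let $\phi(w_2,w_3;z_1,z_2)=\sum_{n\in\mathbb C}\phi_n(w_2,w_3,z_1)z_2^{-n-1}$ with $\phi_n(w_2,w_3,z_1)\in\mathrm{Hom}(W_1,W_{12,3})\{z_1\}$ be defined by $$\langle w_4',\phi(w_2,w_3;z_1,z_2)w_1\rangle=E^{12}\langle w_4',F_{12,3}(F_{12}(w_1,z_1-z_2)w_2,z_2)w_3\rangle ,$$ and let $M\subseteq\mathrm{Hom}(W_1,W_{12,3})\{z_1\}$ be the linear span of all $\phi_n(w_2,w_3,z_1)$, with the action $a_m\circ_r\Phi(z)=a_m\Phi(z)-\mathrm{Res}_{z_0}(z+z_0)^m\Phi(z)Y_{W_1}(a,z_0)$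 of $V$. Assume that $M$ is in $\mathcal D$, that is, $L(0)=\omega_1\circ_r$ acting on $M$ satisfies the condition that defines $\mathcal D$. Then there is a $V$-homomorphism $g:W_{1,23}\to W_{12,3}$ such that, as formal series in complex powers of $z_1,z_2$, $$E^{12}\langle w_4',F_{12,3}(F_{12}(w_1,z_1-z_2)w_2,z_2)w_3\rangle=\langle w_4',g\,F_{1,23}(w_1,z_1)F_{23}(w_2,z_2)w_3\rangle$$ for all $w_i\in W_i$ $(i=1,2,3)$ and $w_4'\in W_{12,3}'$. -/

import Mathlib

open Module

universe u v

namespace DLM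

noncomputable section

/-! ### Vertex operator algebras -/

/-- A vertex operator algebra over `ℂ` with underlying vector space `V`.
The vertex operator of `a` is `Y(a,z) = ∑_{n ∈ ℤ} a_n z^{-n-1}` and `mode n a b = a_n b`. -/
structure VOA (V : Type v) [AddCommGroup V] [Module ℂ V] where
  /-- the modes `a_n b` -/
  mode : ℤ → V →ₗ[ℂ] V →ₗ[ℂ] V
  /-- the vacuum vector -/
  vac : V
  /-- the conformal vector -/
  conf : V
  /-- the central charge -/
  charge : ℂ
  /-- the homogeneous subspaces `V_(n)` -/
  grade : ℤ → Submodule ℂ V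
  decomposition : DirectSum.IsInternal grade
  finite_grade : ∀ n, FiniteDimensional ℂ (grade n)
  grade_bddBelow : ∃ N : ℤ, ∀ n : ℤ, n ≤ N → grade n = ⊥
  vac_mem : vac ∈ grade 0
  conf_mem : conf ∈ grade 2
  /-- `Y(a,z)b` has only finitely many negative powers of `z` -/
  truncation : ∀ a b, ∃ N : ℤ, ∀ n : ℤ, N ≤ n → mode n a b = 0
  /-- `Y(1,z) = id` -/
  vac_mode : ∀ (n : ℤ) (b : V), mode n vac b = if n = -1 then b else 0
  /-- `Y(a,z)1 ∈ V[[z]]` with constant term `a` -/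
  creation : ∀ a, (∀ n : ℤ, 0 ≤ n → mode n a vac = 0) ∧ mode (-1) a vac = a
  /-- The Jacobi identity: the coefficients of `z₀^{-l-1} z₁^{-m-1} z₂^{-n-1}`.  All the sums
  have finitely many nonzero terms, by truncation. -/
  jacobi : ∀ (a b u : V) (l m n : ℤ),
    ∑ᶠ i : ℕ, ((Ring.choose m i : ℤ) : ℂ) • mode (m + n - i) (mode (l + i) a b) u =
      (∑ᶠ i : ℕ, ((-1 : ℂ) ^ i * ((Ring.choose l i : ℤ) : ℂ)) •
        mode (m + l - i) a (mode (n + i) b u)) -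
      (∑ᶠ i : ℕ, ((-1 : ℂ) ^ l * (-1 : ℂ) ^ i * ((Ring.choose l i : ℤ) : ℂ)) •
        mode (n + l - i) b (mode (m + i) a u))
  /-- the Virasoro relations for `L(n) = ω_{n+1}` -/
  virasoro : ∀ (m n : ℤ) (b : V),
    mode (m + 1) conf (mode (n + 1) conf b) - mode (n + 1) conf (mode (m + 1) conf b) =
      ((m : ℂ) - n) • mode (m + n + 1) conf b +
        (if m + n = 0 then (((m : ℂ) ^ 3 - m) / 12 * charge) • b else 0)
  /-- `V_(n)` is an eigenspace of `L(0)` with eigenvalue `n` -/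
  grade_eq : ∀ (n : ℤ) (b : V), b ∈ grade n → mode 1 conf b = (n : ℂ) • b
  /-- `Y(L(-1)a,z) = d/dz Y(a,z)` -/
  derivative : ∀ (a : V) (n : ℤ), mode n (mode 0 conf a) = -(n : ℂ) • mode (n - 1) a

/-! ### Weak modules and homomorphisms -/

section Modules

variable {V : Type v} [AddCommGroup V] [Module ℂ V]

/-- A weak `V`-module structure on the vector space `W`; `act n a w = a_n w`, where
`Y_W(a,z) = ∑_{n ∈ ℤ} a_n z^{-n-1}`. -/
structure WeakModule (A : VOA V) (W : Type u) [AddCommGroup W] [Module ℂ W] where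
  /-- the modes `a_n w` -/
  act : ℤ → V →ₗ[ℂ] W →ₗ[ℂ] W
  vac_act : ∀ (n : ℤ) (w : W), act n A.vac w = if n = -1 then w else 0
  truncation : ∀ (a : V) (w : W), ∃ N : ℤ, ∀ n : ℤ, N ≤ n → act n a w = 0
  derivative : ∀ (a : V) (n : ℤ), act n (A.mode 0 A.conf a) = -(n : ℂ) • act (n - 1) a
  /-- the Jacobi identity, coefficientwise -/
  jacobi : ∀ (a b : V) (w : W) (l m n : ℤ),
    ∑ᶠ i : ℕ, ((Ring.choose m i : ℤ) : ℂ) • act (m + n - i) (A.mode (l + i) a b) w =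
      (∑ᶠ i : ℕ, ((-1 : ℂ) ^ i * ((Ring.choose l i : ℤ) : ℂ)) •
        act (m + l - i) a (act (n + i) b w)) -
      (∑ᶠ i : ℕ, ((-1 : ℂ) ^ l * (-1 : ℂ) ^ i * ((Ring.choose l i : ℤ) : ℂ)) •
        act (n + l - i) b (act (m + i) a w))

variable {A : VOA V}
variable {W₁ : Type u} [AddCommGroup W₁] [Module ℂ W₁]
variable {W₂ : Type u} [AddCommGroup W₂] [Module ℂ W₂]
variable {W₃ : Type u} [AddCommGroup W₃] [Module ℂ W₃]
variable {W₄ : Type u} [AddCommGroup W₄] [Module ℂ W₄]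
variable {W₅ : Type u} [AddCommGroup W₅] [Module ℂ W₅]

/-- The operator `L(n) = ω_{n+1}` on a weak module. -/
def WeakModule.L (Y : WeakModule A W₁) (n : ℤ) : End ℂ W₁ := Y.act (n + 1) A.conf

/-- `V`-homomorphisms. -/
def IsHom (Y₁ : WeakModule A W₁) (Y₂ : WeakModule A W₂) (f : W₁ →ₗ[ℂ] W₂) : Prop :=
  ∀ (n : ℤ) (a : V) (w : W₁), f (Y₁.act n a w) = Y₂.act n a (f w)

/-! ### The categories `𝒞(V)` and `𝒞¹(V)` -/

/-- The choice of one of the two categories `𝒞(V)` (modules) and `𝒞¹(V)`. -/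
inductive VCat
  | C
  | C1

/-- The condition that defines the category, for the operator `L = L(0)` acting on the subspace
`M` of a vector space `E` (a weak module `W` is the case `M = E = W`).

* `𝒞(V)`: `M` is the sum of the `L(0)`-eigenspaces `M_h`, every `M_h` is finite-dimensional, and
  for every `h ∈ ℂ`, `M_{h+n} = 0` for all sufficiently small integers `n`.
* `𝒞¹(V)`: `L(0)` acts locally finitely on `M`, and there are finitely many complex numbers
  `h₁, …, h_n` such that each generalized weight lies in some `h_i + ℤ_{≥ 0}`. -/
def VCat.Holds (D : VCat) {E : Type u} [AddCommGroup E] [Module ℂ E]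
    (L : End ℂ E) (M : Submodule ℂ E) : Prop :=
  match D with
  | .C =>
      M = (⨆ h : ℂ, L.eigenspace h ⊓ M) ∧
      (∀ h : ℂ, FiniteDimensional ℂ (L.eigenspace h ⊓ M : Submodule ℂ E)) ∧
      (∀ h : ℂ, ∃ N : ℤ, ∀ n : ℤ, n ≤ N → L.eigenspace (h + n) ⊓ M = ⊥)
  | .C1 =>
      (∀ x ∈ M, ∃ U : Submodule ℂ E, U ≤ M ∧ FiniteDimensional ℂ U ∧ x ∈ U ∧
        ∀ y ∈ U, L y ∈ U) ∧
      (∃ S : Finset ℂ, ∀ h : ℂ,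
        (∃ x ∈ M, x ≠ 0 ∧ ∃ n : ℕ, ((L - algebraMap ℂ (End ℂ E) h) ^ n) x = 0) →
          ∃ s ∈ S, ∃ n : ℕ, h = s + n)

/-- The weak module `Y` is an object of the category `D`. -/
def VCat.Mem (D : VCat) (Y : WeakModule A W₁) : Prop := D.Holds (Y.L 0) ⊤

/-- The space of (generalized) weight `h` of a weak module: all `w` with `(L(0) - h)^n w = 0` for
some `n`. -/
def WeakModule.wt (Y : WeakModule A W₁) (h : ℂ) : Submodule ℂ W₁ := (Y.L 0).maxGenEigenspace h

/-- `w'` is a homogeneous element of weight `h` of the restricted dual: a linear functional which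
vanishes on all the generalized weight spaces but the one of weight `h`. -/
def WeakModule.DualHomogeneous (Y : WeakModule A W₁) (h : ℂ) (w' : Dual ℂ W₁) : Prop :=
  ∀ h' : ℂ, h' ≠ h → ∀ w ∈ Y.wt h', w' w = 0

/-- `w'` is an element of the restricted dual `W'`, the direct sum of the duals of the generalized
weight spaces: a linear functional vanishing on all but finitely many generalized weight spaces. -/
def WeakModule.MemDual (Y : WeakModule A W₁) (w' : Dual ℂ W₁) : Prop :=
  {h : ℂ | ∃ w ∈ Y.wt h, w' w ≠ 0}.Finite

/-! ### Intertwining operators and tensor products -/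

/-- An intertwining operator of type `(W₃ ; W₁ W₂)`: a linear map
`w ↦ I(w,z) = ∑_{n ∈ ℂ} w_n z^{-n-1}` from `W₁` to `Hom(W₂,W₃){z}`; `mode n w u = w_n u`. -/
structure IntertwiningOperator (Y₁ : WeakModule A W₁) (Y₂ : WeakModule A W₂)
    (Y₃ : WeakModule A W₃) where
  /-- the modes `w_n u`, with complex `n` -/
  mode : ℂ → W₁ →ₗ[ℂ] W₂ →ₗ[ℂ] W₃
  truncation : ∀ (α : ℂ) (w : W₁) (u : W₂), ∃ N : ℤ, ∀ n : ℤ, N ≤ n → mode (α + n) w u = 0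
  /-- `I(L(-1)w,z) = d/dz I(w,z)` -/
  derivative : ∀ (w : W₁) (n : ℂ), mode n (Y₁.L (-1) w) = -n • mode (n - 1) w
  /-- the Jacobi identity, coefficientwise -/
  jacobi : ∀ (a : V) (w : W₁) (u : W₂) (l m : ℤ) (n : ℂ),
    ∑ᶠ i : ℕ, ((Ring.choose m i : ℤ) : ℂ) • mode (m + n - i) (Y₁.act (l + i) a w) u =
      (∑ᶠ i : ℕ, ((-1 : ℂ) ^ i * ((Ring.choose l i : ℤ) : ℂ)) •
        Y₃.act (m + l - i) a (mode (n + i) w u)) -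
      (∑ᶠ i : ℕ, ((-1 : ℂ) ^ l * (-1 : ℂ) ^ i * ((Ring.choose l i : ℤ) : ℂ)) •
        mode (n + l - i) w (Y₂.act (m + i) a u))

/-- `(W₃, F)` is a tensor product of the ordered pair `(W₁, W₂)` in the category `D`. -/
def IsVTensorProduct (D : VCat) {Y₁ : WeakModule A W₁} {Y₂ : WeakModule A W₂}
    {Y₃ : WeakModule A W₃} (F : IntertwiningOperator Y₁ Y₂ Y₃) : Prop :=
  D.Mem Y₃ ∧
  ∀ (W : Type u) [AddCommGroup W] [Module ℂ W] (Y : WeakModule A W), D.Mem Y →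
    ∀ I : IntertwiningOperator Y₁ Y₂ Y,
      ∃! ψ : W₃ →ₗ[ℂ] W, IsHom Y₃ Y ψ ∧
        ∀ (n : ℂ) (w : W₁) (u : W₂), I.mode n w u = ψ (F.mode n w u)

/-! ### Matrix coefficients of products and iterates

A formal series `∑_{p,q ∈ ℂ} c(p,q) x^p y^q` is represented by its coefficients `c : ℂ → ℂ → ℂ`. -/

variable {Y₁ : WeakModule A W₁} {Y₂ : WeakModule A W₂} {Y₃ : WeakModule A W₃}
  {Y₄ : WeakModule A W₄} {Y₅ : WeakModule A W₅}

/-- The formal series `⟨w', 𝒴₄(𝒴₃(w₁,z₀)w₂,z₂)w₃⟩` in `z₀` and `z₂`. -/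
def iterateSeries (𝒴₃ : IntertwiningOperator Y₁ Y₂ Y₅) (𝒴₄ : IntertwiningOperator Y₅ Y₃ Y₄)
    (w' : Dual ℂ W₄) (w₁ : W₁) (w₂ : W₂) (w₃ : W₃) (p q : ℂ) : ℂ :=
  w' (𝒴₄.mode (-q - 1) (𝒴₃.mode (-p - 1) w₁ w₂) w₃)

/-- The formal series `⟨w', 𝒴₁(w₁,z₁)𝒴₂(w₂,z₂)w₃⟩` in `z₁` and `z₂`. -/
def productSeries (𝒴₁ : IntertwiningOperator Y₁ Y₅ Y₄) (𝒴₂ : IntertwiningOperator Y₂ Y₃ Y₅)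
    (w' : Dual ℂ W₄) (w₁ : W₁) (w₂ : W₂) (w₃ : W₃) (p q : ℂ) : ℂ :=
  w' (𝒴₁.mode (-p - 1) w₁ (𝒴₂.mode (-q - 1) w₂ w₃))

end Modules

/-! ### Analytic extension of iterates -/

/-- The formal series `∑ a(p,q) z₀^p z₂^q`, with `z₀ = z₁ - z₂`, is absolutely convergent in the
domain `|z₂| > |z₁ - z₂| > 0`, and its sum can be analytically extended to the multi-valued
function `∑_i z₁^{r_i} z₂^{s_i} f_i(z₂/z₁)` in the domain `|z₁| > |z₂| > 0`, where the `f_i` are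
analytic in the open unit disc.

Multi-valued functions of `z₀, z₁, z₂` are written as functions of `ζ_j = log z_j`, so that
`z_j^p` is `exp (p ζ_j)` and `|z_j|` is `exp (Re ζ_j)`.  On the overlap
`|z₁| > |z₂| > |z₁ - z₂| > 0` of the two domains both `z₂/z₁` and `(z₁ - z₂)/z₁` lie in the right
half plane, and the branches correspond to each other by `|arg z₂ - arg z₁| < π/2` and
`|arg (z₁ - z₂) - arg z₁| < π/2` (so all three logarithms can be real when `z₁ > z₂ > z₁ - z₂ > 0`).
-/
def ExtendsTo (a : ℂ → ℂ → ℂ) {k : ℕ} (r s : Fin k → ℂ) (f : Fin k → ℂ → ℂ) : Prop :=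
  (∀ i, AnalyticOnNhd ℂ (f i) (Metric.ball 0 1)) ∧
  (∀ ζ₀ ζ₂ : ℂ, ζ₀.re < ζ₂.re →
    Summable fun e : ℂ × ℂ => a e.1 e.2 * Complex.exp (e.1 * ζ₀ + e.2 * ζ₂)) ∧
  (∀ ζ₀ ζ₁ ζ₂ : ℂ, ζ₀.re < ζ₂.re → ζ₂.re < ζ₁.re →
    Complex.exp ζ₀ = Complex.exp ζ₁ - Complex.exp ζ₂ →
    |ζ₂.im - ζ₁.im| < Real.pi / 2 → |ζ₀.im - ζ₁.im| < Real.pi / 2 →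
    ∑' e : ℂ × ℂ, a e.1 e.2 * Complex.exp (e.1 * ζ₀ + e.2 * ζ₂) =
      ∑ i, Complex.exp (r i * ζ₁ + s i * ζ₂) * f i (Complex.exp (ζ₂ - ζ₁)))

/-- The coefficient of `z₁^p z₂^q` in the formal series `∑_i z₁^{r_i} z₂^{s_i} f_i(z₂/z₁)`, where
`f_i` is replaced by its Taylor series at `0`. -/
def expansion {k : ℕ} (r s : Fin k → ℂ) (f : Fin k → ℂ → ℂ) (p q : ℂ) : ℂ :=
  ∑ i, ∑ᶠ j : ℕ, open Classical in
    if p = r i - j ∧ q = s i + j then iteratedDeriv j (f i) 0 / (j.factorial : ℂ) else 0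

/-- `E¹² a = b`: the formal series `a` in `z₁ - z₂` and `z₂` converges and extends to a function
`∑_i z₁^{r_i} z₂^{s_i} f_i(z₂/z₁)` whose formal series in `z₁` and `z₂` is `b`. -/
def IsE12 (a b : ℂ → ℂ → ℂ) : Prop :=
  ∃ (k : ℕ) (r s : Fin k → ℂ) (f : Fin k → ℂ → ℂ), ExtendsTo a r s f ∧ b = expansion r s f

section Iterates

variable {V : Type v} [AddCommGroup V] [Module ℂ V] {A : VOA V}
variable {W₁ : Type u} [AddCommGroup W₁] [Module ℂ W₁] {Y₁ : WeakModule A W₁}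
variable {W₂ : Type u} [AddCommGroup W₂] [Module ℂ W₂] {Y₂ : WeakModule A W₂}
variable {W₃ : Type u} [AddCommGroup W₃] [Module ℂ W₃] {Y₃ : WeakModule A W₃}
variable {W₄ : Type u} [AddCommGroup W₄] [Module ℂ W₄] {Y₄ : WeakModule A W₄}
variable {W₅ : Type u} [AddCommGroup W₅] [Module ℂ W₅] {Y₅ : WeakModule A W₅}

/-- The convergence and extension property for the iterates of `𝒴₃` and `𝒴₄`. -/
def ConvergenceExtensionIterates (𝒴₃ : IntertwiningOperator Y₁ Y₂ Y₅)
    (𝒴₄ : IntertwiningOperator Y₅ Y₃ Y₄) : Prop :=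
  ∃ N : ℤ, ∀ (h₁ h₂ h₃ h₄ : ℂ), ∀ w₁ ∈ Y₁.wt h₁, ∀ w₂ ∈ Y₂.wt h₂, ∀ w₃ ∈ Y₃.wt h₃,
    ∀ w' : Dual ℂ W₄, Y₄.DualHomogeneous h₄ w' →
      ∃ (k : ℕ) (r s : Fin k → ℂ) (f : Fin k → ℂ → ℂ),
        (∀ i, (N : ℝ) < (h₂ + h₃ + s i).re) ∧
        ExtendsTo (iterateSeries 𝒴₃ 𝒴₄ w' w₁ w₂ w₃) r s f

/-! ### The space `M` of right operators -/

theorem rightAction_finite (Y₁ : WeakModule A W₁) (a : V) (m : ℤ) (Φ : ℂ → W₁ →ₗ[ℂ] W₂) (n : ℂ)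
    (u : W₁) : (Function.support fun i : ℕ =>
      ((Ring.choose m i : ℤ) : ℂ) • Φ (n + m - i) (Y₁.act i a u)).Finite := by
  obtain ⟨N, hN⟩ := Y₁.truncation a u
  refine (Set.finite_Iio N.toNat).subset fun i hi => ?_
  by_contra h
  apply hi
  have h2 : N ≤ (i : ℤ) := by
    simp only [Set.mem_Iio, not_lt] at h
    omega
  simp [hN i h2]

/-- The action `a_m ∘_r Φ(z) = a_m Φ(z) - Res_{z₀} (z + z₀)^m Φ(z) Y(a,z₀)` on
`Hom(W₁,W₂){z}`.  Here `Φ(z) = ∑_{n ∈ ℂ} Φ_n z^{-n-1}` is given by the family `n ↦ Φ_n`, and the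
residue is `∑_{i ≥ 0} (m choose i) z^{m-i} Φ(z) a_i`. -/
def rightAction (Y₁ : WeakModule A W₁) (Y₂ : WeakModule A W₂) (a : V) (m : ℤ) :
    End ℂ (ℂ → W₁ →ₗ[ℂ] W₂) where
  toFun Φ n :=
    { toFun := fun u => Y₂.act m a (Φ n u) -
        ∑ᶠ i : ℕ, ((Ring.choose m i : ℤ) : ℂ) • Φ (n + m - i) (Y₁.act i a u)
      map_add' := fun u u' => by
        simp only [map_add, smul_add]
        rw [finsum_add_distrib (rightAction_finite Y₁ a m Φ n u)
          (rightAction_finite Y₁ a m Φ n u')]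
        abel
      map_smul' := fun c u => by
        simp only [map_smul, RingHom.id_apply, smul_sub]
        rw [smul_finsum' c (rightAction_finite Y₁ a m Φ n u)]
        simp only [smul_comm c] }
  map_add' Φ Ψ := by
    funext n
    ext u
    simp only [Pi.add_apply, LinearMap.add_apply, map_add, smul_add, LinearMap.coe_mk,
      AddHom.coe_mk]
    rw [finsum_add_distrib (rightAction_finite Y₁ a m Φ n u) (rightAction_finite Y₁ a m Ψ n u)]
    abel
  map_smul' c Φ := by
    funext n
    ext u
    simp only [Pi.smul_apply, LinearMap.smul_apply, map_smul, RingHom.id_apply, smul_sub,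
      LinearMap.coe_mk, AddHom.coe_mk]
    rw [smul_finsum' c (rightAction_finite Y₁ a m Φ n u)]
    simp only [smul_comm c]

/-- `Φ(z₁) ∈ Hom(W₁,W₄){z₁}` is the coefficient `φ_n(w₂,w₃,z₁)` of `z₂^{-n-1}` in the series
`φ(w₂,w₃;z₁,z₂)` that is defined by
`⟨w', φ(w₂,w₃;z₁,z₂)w₁⟩ = E¹² ⟨w', 𝒴₄(𝒴₃(w₁,z₁-z₂)w₂,z₂)w₃⟩`
for all `w₁ ∈ W₁` and `w' ∈ W₄'`. -/
def IsPhi (𝒴₃ : IntertwiningOperator Y₁ Y₂ Y₅) (𝒴₄ : IntertwiningOperator Y₅ Y₃ Y₄)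
    (w₂ : W₂) (w₃ : W₃) (n : ℂ) (Φ : ℂ → W₁ →ₗ[ℂ] W₄) : Prop :=
  ∀ (w₁ : W₁) (w' : Dual ℂ W₄), Y₄.MemDual w' →
    ∃ b : ℂ → ℂ → ℂ, IsE12 (iterateSeries 𝒴₃ 𝒴₄ w' w₁ w₂ w₃) b ∧
      ∀ m : ℂ, w' (Φ m w₁) = b (-m - 1) (-n - 1)

/-- The linear span `M` of all `φ_n(w₂,w₃,z₁)` in `Hom(W₁,W₄){z₁}`. -/
def spaceM (𝒴₃ : IntertwiningOperator Y₁ Y₂ Y₅) (𝒴₄ : IntertwiningOperator Y₅ Y₃ Y₄) :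
    Submodule ℂ (ℂ → W₁ →ₗ[ℂ] W₄) :=
  Submodule.span ℂ {Φ | ∃ (w₂ : W₂) (w₃ : W₃) (n : ℂ), IsPhi 𝒴₃ 𝒴₄ w₂ w₃ n Φ}

/-- `M`, with the action `∘_r`, lies in the category `D`; this is a condition on the operator
`L(0) = ω_1 ∘_r` on `M`. -/
def SpaceMInCategory (D : VCat) (𝒴₃ : IntertwiningOperator Y₁ Y₂ Y₅)
    (𝒴₄ : IntertwiningOperator Y₅ Y₃ Y₄) : Prop :=
  D.Holds (rightAction Y₁ Y₄ A.conf 1) (spaceM 𝒴₃ 𝒴₄)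

end Iterates

end

end DLM

open DLM

/-! The extended iterate is read as a function of `z₁` with values in operators. The coefficient of
`z₂^{-n-1}` in `E¹²` of the iterate is a series `φ_n(w₂,w₃,z₁)` of maps `W₁ → W₁₂_₃`, and `M` is
spanned by these. Three facts are needed: `M` is a weak module under `∘_r`; `(w₂,w₃) ↦
φ(w₂,w₃;z₁,z₂)` is an intertwining operator from `W₂`, `W₃` to `M`; and the evaluation `Φ ↦ Φ(z₁)w₁`
is an intertwining operator from `W₁`, `M` to `W₁₂_₃`. Since `M` is in the category, the universal
property of `W₂₃` gives `ψ : W₂₃ → M` with `φ = ψ ∘ F₂₃`. That of `W₁_₂₃`, applied to the evaluation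
composed with `ψ`, gives `g`. Then `g F₁_₂₃(w₁,z₁) F₂₃(w₂,z₂) w₃` is the evaluation of
`φ(w₂,w₃;z₁,z₂)` at `w₁`, which is the claim.

The analytic input is that `E¹²` is a well-defined linear operation on series (`IsE12.unique`) which
commutes with multiplication by `z₁ = z₀ + z₂` and by powers of `z₂`, with `∂/∂z₁`, and with the
grading by total degree (`IsE12.mul_z₁`, `IsE12.mul_z₂`, `IsE12.deriv_z₁`, `IsE12.support`). The
operators `φ_n` exist even if the weight spaces of `W₁₂_₃` are infinite-dimensional, because
absolute convergence against all functionals forces the vectors involved to span a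
finite-dimensional space (`finiteDimensional_span_of_summable`).

The Jacobi identities are then algebra. Each sum in a Jacobi identity obeys the Pascal rule
`S(l+1,m,n) = S(l,m+1,n) - S(l,m,n+1)`, which is multiplication by a difference of two variables.
The part of an identity that comes from one vector is killed by a high power of such a difference,
since only finitely many nonnegative modes of `a` act nontrivially on that vector. A series that is
killed by such a power and is also truncated in a suitable direction vanishes. This scheme gives the
identity for `φ` (`phiDefect_eq_zero`), for `∘_r` (`rightAction_jacobi_phi`) and for the evaluation
(`PhiData.evalDefect_phi`). -/

namespace DLM

/-! ### Operations on series that commute with `E¹²` -/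

/-- The expansion of a single function `z₁^r z₂^s f(z₂/z₁)`. -/
noncomputable def expTerm (r s : ℂ) (f : ℂ → ℂ) (p q : ℂ) : ℂ :=
  ∑ᶠ j : ℕ, open Classical in
    if p = r - j ∧ q = s + j then iteratedDeriv j f 0 / (j.factorial : ℂ) else 0

theorem expansion_eq_sum {k : ℕ} (r s : Fin k → ℂ) (f : Fin k → ℂ → ℂ) (p q : ℂ) :
    expansion r s f p q = ∑ i, expTerm (r i) (s i) (f i) p q := rfl

theorem expTerm_eq {r s : ℂ} {f : ℂ → ℂ} {p q : ℂ} (j : ℕ) (hp : p = r - j) (hq : q = s + j) :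
    expTerm r s f p q = iteratedDeriv j f 0 / (j.factorial : ℂ) := by
  unfold expTerm
  rw [finsum_eq_single _ j]
  · simp [hp, hq]
  · intro i hi
    rw [if_neg]
    rintro ⟨-, h⟩
    rw [hq] at h
    exact hi (by exact_mod_cast (add_left_cancel h).symm)

theorem expTerm_eq_zero {r s : ℂ} {f : ℂ → ℂ} {p q : ℂ}
    (h : ∀ j : ℕ, p = r - j → q = s + j → False) : expTerm r s f p q = 0 := by
  unfold expTerm
  rw [finsum_eq_zero_of_forall_eq_zero]
  intro j
  rw [if_neg]
  rintro ⟨h1, h2⟩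
  exact h j h1 h2

theorem expTerm_cases (r s p q : ℂ) :
    (∃ j : ℕ, p = r - j ∧ q = s + j) ∨ (∀ j : ℕ, p = r - j → q = s + j → False) := by
  by_cases h : ∃ j : ℕ, p = r - j ∧ q = s + j
  · exact Or.inl h
  · exact Or.inr fun j h1 h2 => h ⟨j, h1, h2⟩

theorem IsE12.add {a b a' b' : ℂ → ℂ → ℂ} (h : IsE12 a b) (h' : IsE12 a' b') :
    IsE12 (fun p q => a p q + a' p q) (fun p q => b p q + b' p q) := by
  obtain ⟨k, r, s, f, ⟨h1, h2, h3⟩, rfl⟩ := h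
  obtain ⟨k', r', s', f', ⟨h1', h2', h3'⟩, rfl⟩ := h'
  refine ⟨k + k', Fin.append r r', Fin.append s s', Fin.append f f', ⟨?_, ?_, ?_⟩, ?_⟩
  · intro i
    refine Fin.addCases (fun i => ?_) (fun i => ?_) i
    · rw [Fin.append_left]; exact h1 i
    · rw [Fin.append_right]; exact h1' i
  · intro ζ₀ ζ₂ h
    simpa only [add_mul] using (h2 ζ₀ ζ₂ h).add (h2' ζ₀ ζ₂ h)
  · intro ζ₀ ζ₁ ζ₂ e1 e2 e3 e4 e5
    simp only [add_mul]
    rw [(h2 ζ₀ ζ₂ e1).tsum_add (h2' ζ₀ ζ₂ e1), h3 ζ₀ ζ₁ ζ₂ e1 e2 e3 e4 e5,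
      h3' ζ₀ ζ₁ ζ₂ e1 e2 e3 e4 e5, Fin.sum_univ_add]
    simp
  · funext p q
    simp only [expansion_eq_sum, Fin.sum_univ_add, Fin.append_left, Fin.append_right]

theorem IsE12.zero : IsE12 (fun _ _ => 0) (fun _ _ => 0) := by
  refine ⟨0, Fin.elim0, Fin.elim0, Fin.elim0, ⟨fun i => i.elim0, ?_, ?_⟩, ?_⟩
  · intro ζ₀ ζ₂ _
    simp
  · intros
    simp
  · funext p q
    simp [expansion_eq_sum]

theorem expTerm_const_mul (c r s : ℂ) (f : ℂ → ℂ) (p q : ℂ) :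
    expTerm r s (fun x => c * f x) p q = c * expTerm r s f p q := by
  rcases expTerm_cases r s p q with ⟨j, hp, hq⟩ | h
  · rw [expTerm_eq j hp hq, expTerm_eq j hp hq, iteratedDeriv_const_mul_field]
    ring
  · rw [expTerm_eq_zero h, expTerm_eq_zero h, mul_zero]

theorem IsE12.const_mul {a b : ℂ → ℂ → ℂ} (c : ℂ) (h : IsE12 a b) :
    IsE12 (fun p q => c * a p q) (fun p q => c * b p q) := by
  obtain ⟨k, r, s, f, ⟨h1, h2, h3⟩, rfl⟩ := h
  refine ⟨k, r, s, fun i x => c * f i x, ⟨?_, ?_, ?_⟩, ?_⟩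
  · intro i
    exact analyticOnNhd_const.mul (h1 i)
  · intro ζ₀ ζ₂ h
    simpa only [mul_assoc] using (h2 ζ₀ ζ₂ h).mul_left c
  · intro ζ₀ ζ₁ ζ₂ e1 e2 e3 e4 e5
    simp only [mul_assoc]
    rw [tsum_mul_left, h3 ζ₀ ζ₁ ζ₂ e1 e2 e3 e4 e5, Finset.mul_sum]
    refine Finset.sum_congr rfl fun i _ => ?_
    ring
  · funext p q
    simp only [expansion_eq_sum, Finset.mul_sum]
    exact Finset.sum_congr rfl fun i _ => (expTerm_const_mul c _ _ _ p q).symm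

/-- Multiplication by `z₁ = z₀ + z₂`. -/
theorem IsE12.mul_z₁ {a b : ℂ → ℂ → ℂ} (h : IsE12 a b) :
    IsE12 (fun p q => a (p - 1) q + a p (q - 1)) (fun p q => b (p - 1) q) := by
  obtain ⟨k, r, s, f, ⟨h1, h2, h3⟩, rfl⟩ := h
  have key0 : ∀ ζ₀ ζ₂ : ℂ, (fun e : ℂ × ℂ =>
      a (e.1 - 1) e.2 * Complex.exp (e.1 * ζ₀ + e.2 * ζ₂)) =
      (fun e : ℂ × ℂ => Complex.exp ζ₀ * (a e.1 e.2 * Complex.exp (e.1 * ζ₀ + e.2 * ζ₂))) ∘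
        (Equiv.subRight ((1, 0) : ℂ × ℂ)) := by
    intro ζ₀ ζ₂
    funext e
    simp only [Function.comp_apply, Equiv.subRight_apply, Prod.fst_sub, Prod.snd_sub, sub_zero]
    rw [mul_left_comm, ← Complex.exp_add]
    ring_nf
  have key2 : ∀ ζ₀ ζ₂ : ℂ, (fun e : ℂ × ℂ =>
      a e.1 (e.2 - 1) * Complex.exp (e.1 * ζ₀ + e.2 * ζ₂)) =
      (fun e : ℂ × ℂ => Complex.exp ζ₂ * (a e.1 e.2 * Complex.exp (e.1 * ζ₀ + e.2 * ζ₂))) ∘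
        (Equiv.subRight ((0, 1) : ℂ × ℂ)) := by
    intro ζ₀ ζ₂
    funext e
    simp only [Function.comp_apply, Equiv.subRight_apply, Prod.fst_sub, Prod.snd_sub, sub_zero]
    rw [mul_left_comm, ← Complex.exp_add]
    ring_nf
  have sum0 : ∀ ζ₀ ζ₂ : ℂ, ζ₀.re < ζ₂.re → Summable (fun e : ℂ × ℂ =>
      a (e.1 - 1) e.2 * Complex.exp (e.1 * ζ₀ + e.2 * ζ₂)) := by
    intro ζ₀ ζ₂ h
    rw [key0, Equiv.summable_iff]
    exact (h2 ζ₀ ζ₂ h).mul_left _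
  have sum2 : ∀ ζ₀ ζ₂ : ℂ, ζ₀.re < ζ₂.re → Summable (fun e : ℂ × ℂ =>
      a e.1 (e.2 - 1) * Complex.exp (e.1 * ζ₀ + e.2 * ζ₂)) := by
    intro ζ₀ ζ₂ h
    rw [key2, Equiv.summable_iff]
    exact (h2 ζ₀ ζ₂ h).mul_left _
  refine ⟨k, fun i => r i + 1, s, f, ⟨h1, ?_, ?_⟩, ?_⟩
  · intro ζ₀ ζ₂ h
    simpa only [add_mul] using (sum0 ζ₀ ζ₂ h).add (sum2 ζ₀ ζ₂ h)
  · intro ζ₀ ζ₁ ζ₂ e1 e2 e3 e4 e5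
    simp only [add_mul]
    rw [(sum0 ζ₀ ζ₂ e1).tsum_add (sum2 ζ₀ ζ₂ e1), key0, key2]
    simp only [Function.comp_def]
    rw [Equiv.tsum_eq (Equiv.subRight ((1, 0) : ℂ × ℂ)) (fun e : ℂ × ℂ =>
        Complex.exp ζ₀ * (a e.1 e.2 * Complex.exp (e.1 * ζ₀ + e.2 * ζ₂))),
      Equiv.tsum_eq (Equiv.subRight ((0, 1) : ℂ × ℂ)) (fun e : ℂ × ℂ =>
        Complex.exp ζ₂ * (a e.1 e.2 * Complex.exp (e.1 * ζ₀ + e.2 * ζ₂))),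
      tsum_mul_left, tsum_mul_left, ← add_mul, e3, sub_add_cancel,
      h3 ζ₀ ζ₁ ζ₂ e1 e2 e3 e4 e5, Finset.mul_sum]
    refine Finset.sum_congr rfl fun i _ => ?_
    rw [← mul_assoc, ← Complex.exp_add]
    ring_nf
  · funext p q
    simp only [expansion_eq_sum]
    refine Finset.sum_congr rfl fun i _ => ?_
    rcases expTerm_cases (r i) (s i) (p - 1) q with ⟨j, hp, hq⟩ | h
    · rw [expTerm_eq j hp hq, expTerm_eq j _ hq]
      linear_combination hp
    · rw [expTerm_eq_zero h, expTerm_eq_zero]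
      intro j h1 h2
      exact h j (by linear_combination h1) h2

/-- Multiplication by `z₂^c`. -/
theorem IsE12.mul_z₂ {a b : ℂ → ℂ → ℂ} (c : ℂ) (h : IsE12 a b) :
    IsE12 (fun p q => a p (q - c)) (fun p q => b p (q - c)) := by
  obtain ⟨k, r, s, f, ⟨h1, h2, h3⟩, rfl⟩ := h
  have key2 : ∀ ζ₀ ζ₂ : ℂ, (fun e : ℂ × ℂ =>
      a e.1 (e.2 - c) * Complex.exp (e.1 * ζ₀ + e.2 * ζ₂)) =
      (fun e : ℂ × ℂ => Complex.exp (c * ζ₂) *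
        (a e.1 e.2 * Complex.exp (e.1 * ζ₀ + e.2 * ζ₂))) ∘
        (Equiv.subRight ((0, c) : ℂ × ℂ)) := by
    intro ζ₀ ζ₂
    funext e
    simp only [Function.comp_apply, Equiv.subRight_apply, Prod.fst_sub, Prod.snd_sub, sub_zero]
    rw [mul_left_comm, ← Complex.exp_add]
    ring_nf
  refine ⟨k, r, fun i => s i + c, f, ⟨h1, ?_, ?_⟩, ?_⟩
  · intro ζ₀ ζ₂ h
    rw [key2, Equiv.summable_iff]
    exact (h2 ζ₀ ζ₂ h).mul_left _
  · intro ζ₀ ζ₁ ζ₂ e1 e2 e3 e4 e5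
    rw [key2]
    simp only [Function.comp_def]
    rw [Equiv.tsum_eq (Equiv.subRight ((0, c) : ℂ × ℂ)) (fun e : ℂ × ℂ =>
        Complex.exp (c * ζ₂) * (a e.1 e.2 * Complex.exp (e.1 * ζ₀ + e.2 * ζ₂))),
      tsum_mul_left, h3 ζ₀ ζ₁ ζ₂ e1 e2 e3 e4 e5, Finset.mul_sum]
    refine Finset.sum_congr rfl fun i _ => ?_
    rw [← mul_assoc, ← Complex.exp_add]
    ring_nf
  · funext p q
    simp only [expansion_eq_sum]
    refine Finset.sum_congr rfl fun i _ => ?_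
    rcases expTerm_cases (r i) (s i) p (q - c) with ⟨j, hp, hq⟩ | h
    · rw [expTerm_eq j hp hq, expTerm_eq j hp]
      linear_combination hq
    · rw [expTerm_eq_zero h, expTerm_eq_zero]
      intro j h1 h2
      exact h j h1 (by linear_combination h2)

/-- Simultaneous rescaling of all variables. -/
theorem IsE12.scale {a b : ℂ → ℂ → ℂ} (c : ℂ) (h : IsE12 a b) :
    IsE12 (fun p q => Complex.exp (c * (p + q)) * a p q)
      (fun p q => Complex.exp (c * (p + q)) * b p q) := by
  obtain ⟨k, r, s, f, ⟨h1, h2, h3⟩, rfl⟩ := h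
  have key : ∀ ζ₀ ζ₂ : ℂ, (fun e : ℂ × ℂ =>
      Complex.exp (c * (e.1 + e.2)) * a e.1 e.2 * Complex.exp (e.1 * ζ₀ + e.2 * ζ₂)) =
      (fun e : ℂ × ℂ => a e.1 e.2 * Complex.exp (e.1 * (ζ₀ + c) + e.2 * (ζ₂ + c))) := by
    intro ζ₀ ζ₂
    funext e
    rw [mul_comm (Complex.exp _), mul_assoc, ← Complex.exp_add]
    ring_nf
  refine ⟨k, r, s, fun i x => Complex.exp (c * (r i + s i)) * f i x, ⟨?_, ?_, ?_⟩, ?_⟩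
  · intro i
    exact analyticOnNhd_const.mul (h1 i)
  · intro ζ₀ ζ₂ h
    rw [key]
    exact h2 _ _ (by simpa using h)
  · intro ζ₀ ζ₁ ζ₂ e1 e2 e3 e4 e5
    rw [key, h3 (ζ₀ + c) (ζ₁ + c) (ζ₂ + c) (by simpa using e1) (by simpa using e2)
      (by rw [Complex.exp_add, Complex.exp_add, Complex.exp_add, e3]; ring) (by simpa using e4)
      (by simpa using e5)]
    refine Finset.sum_congr rfl fun i _ => ?_
    rw [← mul_assoc, ← Complex.exp_add]
    ring_nf
  · funext p q
    simp only [expansion_eq_sum, Finset.mul_sum]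
    refine Finset.sum_congr rfl fun i _ => ?_
    rw [expTerm_const_mul]
    rcases expTerm_cases (r i) (s i) p q with ⟨j, hp, hq⟩ | h
    · rw [hp, hq]
      ring_nf
    · rw [expTerm_eq_zero h, mul_zero, mul_zero]

end DLM

/-! ### Uniqueness of the expansion -/

namespace DLM

/-- The multi-valued function `z₁^r z₂^s f(z₂/z₁)` in logarithmic coordinates. -/
noncomputable def logTerm (r s : ℂ) (f : ℂ → ℂ) (ζ : ℂ × ℂ) : ℂ :=
  Complex.exp (r * ζ.1 + s * ζ.2) * f (Complex.exp (ζ.2 - ζ.1))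

/-- The domain `|z₁| > |z₂| > 0` in logarithmic coordinates. -/
def logDomain : Set (ℂ × ℂ) := {ζ | ζ.2.re < ζ.1.re}

theorem exp_mem_ball {ζ : ℂ × ℂ} (h : ζ ∈ logDomain) :
    Complex.exp (ζ.2 - ζ.1) ∈ Metric.ball (0 : ℂ) 1 := by
  have h' : ζ.2.re < ζ.1.re := h
  rw [mem_ball_zero_iff, Complex.norm_exp, Complex.sub_re, Real.exp_lt_one_iff]
  linarith

theorem analyticOnNhd_logTerm {r s : ℂ} {f : ℂ → ℂ} (hf : AnalyticOnNhd ℂ f (Metric.ball 0 1)) :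
    AnalyticOnNhd ℂ (logTerm r s f) logDomain := by
  intro ζ hζ
  have h1 : AnalyticAt ℂ (fun ζ : ℂ × ℂ => Complex.exp (r * ζ.1 + s * ζ.2)) ζ :=
    ((analyticAt_const.mul analyticAt_fst).add (analyticAt_const.mul analyticAt_snd)).cexp
  have h2 : AnalyticAt ℂ (fun ζ : ℂ × ℂ => Complex.exp (ζ.2 - ζ.1)) ζ :=
    (analyticAt_snd.sub analyticAt_fst).cexp
  exact h1.mul (AnalyticAt.comp (g := f) (hf _ (exp_mem_ball hζ)) h2)

/-- In logarithmic coordinates the domain is a half-space, hence convex, so the identity theorem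
applies to multi-valued functions with no discussion of branches. -/
theorem isPreconnected_logDomain : IsPreconnected logDomain := by
  apply Convex.isPreconnected
  intro x hx y hy a b ha hb hab
  simp only [logDomain, Set.mem_ofPred_eq, Prod.snd_add, Prod.smul_snd, Complex.add_re,
    Complex.real_smul, Complex.mul_re, Complex.ofReal_re, Complex.ofReal_im, zero_mul, sub_zero,
    Prod.fst_add, Prod.smul_fst] at hx hy ⊢
  rcases ha.eq_or_lt with rfl | ha
  · have : b = 1 := by linarith
    subst this
    simpa using hy
  · have := mul_lt_mul_of_pos_left hx ha
    have := mul_le_mul_of_nonneg_left hy.le hb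
    linarith

/-- The extension of the zero series vanishes near one point of the overlap of the two domains,
hence everywhere by the identity theorem. -/
theorem sum_logTerm_eq_zero {k : ℕ} {r s : Fin k → ℂ} {f : Fin k → ℂ → ℂ}
    (h : ExtendsTo (fun _ _ => 0) r s f) :
    ∀ ζ ∈ logDomain, ∑ i, logTerm (r i) (s i) (f i) ζ = 0 := by
  obtain ⟨h1, -, h3⟩ := h
  have hA : AnalyticOnNhd ℂ (fun ζ => ∑ i, logTerm (r i) (s i) (f i) ζ) logDomain :=
    Finset.analyticOnNhd_fun_sum _ fun i _ => analyticOnNhd_logTerm (h1 i)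
  -- The base point is `z₁ = 3`, `z₂ = 2`, so that `z₁ - z₂ = 1`. All three logarithms are real
  -- there, and every inequality that defines the overlap is strict.
  have h0 : ((Real.log 3 : ℂ), (Real.log 2 : ℂ)) ∈ logDomain := by
    simp only [logDomain, Set.mem_ofPred_eq, Complex.ofReal_re]
    exact Real.log_lt_log (by norm_num) (by norm_num)
  refine hA.eqOn_zero_of_preconnected_of_eventuallyEq_zero isPreconnected_logDomain h0 ?_
  set ζ' : ℂ × ℂ := ((Real.log 3 : ℂ), (Real.log 2 : ℂ)) with hζ'
  let g : ℂ × ℂ → ℂ := fun ζ => Complex.exp ζ.1 - Complex.exp ζ.2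
  have hg0 : g ζ' = 1 := by
    simp only [g, hζ', ← Complex.ofReal_exp]
    rw [Real.exp_log (by norm_num), Real.exp_log (by norm_num)]
    norm_num
  have hgc : ContinuousAt g ζ' := by fun_prop
  have hlog : ContinuousAt (fun ζ => Complex.log (g ζ)) ζ' :=
    hgc.clog (by rw [hg0]; exact Complex.one_mem_slitPlane)
  have hl0 : Complex.log (g ζ') = 0 := by rw [hg0, Complex.log_one]
  have e1 : ∀ᶠ ζ in nhds ζ', (Complex.log (g ζ)).re < ζ.2.re := by
    refine ContinuousAt.eventually_lt (Complex.continuous_re.continuousAt.comp hlog)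
      (by fun_prop) ?_
    simp only [hl0, Complex.zero_re]
    exact Real.log_pos one_lt_two
  have e2 : ∀ᶠ ζ in nhds ζ', ζ.2.re < ζ.1.re :=
    ContinuousAt.eventually_lt (by fun_prop) (by fun_prop) h0
  have e3 : ∀ᶠ ζ in nhds ζ', g ζ ≠ 0 := by
    refine hgc.eventually_ne ?_
    rw [hg0]; exact one_ne_zero
  have e4 : ∀ᶠ ζ in nhds ζ', |ζ.2.im - ζ.1.im| < Real.pi / 2 := by
    refine ContinuousAt.eventually_lt (by fun_prop) (by fun_prop) ?_
    simp only [hζ', Complex.ofReal_im, sub_zero, abs_zero]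
    exact Real.pi_div_two_pos
  have e5 : ∀ᶠ ζ in nhds ζ', |(Complex.log (g ζ)).im - ζ.1.im| < Real.pi / 2 := by
    refine ContinuousAt.eventually_lt ?_ (by fun_prop) ?_
    · have := Complex.continuous_im.continuousAt.comp hlog
      exact (this.sub (by fun_prop : ContinuousAt (fun ζ : ℂ × ℂ => ζ.1.im) ζ')).abs
    · rw [hl0]
      simp only [hζ', Complex.ofReal_im, Complex.zero_im, sub_zero, abs_zero]
      exact Real.pi_div_two_pos
  filter_upwards [e1, e2, e3, e4, e5] with ζ e1 e2 e3 e4 e5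
  have := h3 (Complex.log (g ζ)) ζ.1 ζ.2 e1 e2 (Complex.exp_log e3) e4 e5
  simp only [zero_mul, tsum_zero] at this
  exact this.symm

theorem exp_ne_exp_of_eq_one_add {x y : ℂ} (h : x = 1 + y) : Complex.exp x ≠ Complex.exp y := by
  rw [h, Complex.exp_add, Ne, mul_eq_right₀ (Complex.exp_ne_zero _)]
  intro h4
  have h6 := congrArg (‖·‖) h4
  simp only [Complex.norm_exp, Complex.one_re, norm_one, Real.exp_eq_one_iff] at h6
  exact one_ne_zero h6

/-- The character of `ℂ × ℤ` by which the translations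
`(log z₁, log z₂) ↦ (log z₁ + c, log z₂ + c + 2πik)` act on `z₁^r z₂^s f(z₂/z₁)`. -/
noncomputable def monodromy (r s : ℂ) : Multiplicative (ℂ × ℤ) →* ℂ where
  toFun g := Complex.exp ((r + s) * g.toAdd.1 + s * (g.toAdd.2 * (2 * Real.pi * Complex.I)))
  map_one' := by simp
  map_mul' x y := by
    rw [← Complex.exp_add]
    simp only [toAdd_mul, Prod.fst_add, Prod.snd_add, Int.cast_add]
    ring_nf

theorem monodromy_apply (r s c : ℂ) (k : ℤ) : monodromy r s (Multiplicative.ofAdd (c, k)) =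
    Complex.exp ((r + s) * c + s * (k * (2 * Real.pi * Complex.I))) := rfl

/-- Simultaneous translation detects `r + s`: if the sums differed, `c` could be chosen so that the
two exponents differ by `1`, but `exp 1 ≠ 1`. The loop of `z₂` around `0` detects `s` modulo `ℤ`. -/
theorem eq_of_monodromy_eq {r s r' s' : ℂ} (h : monodromy r s = monodromy r' s') :
    r + s = r' + s' ∧ ∃ m : ℤ, s = s' + m := by
  constructor
  · by_contra hne
    have hne' : (r + s) - (r' + s') ≠ 0 := sub_ne_zero.mpr hne
    have := DFunLike.congr_fun h (Multiplicative.ofAdd (((r + s) - (r' + s'))⁻¹, (0 : ℤ)))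
    rw [monodromy_apply, monodromy_apply] at this
    simp only [Int.cast_zero, zero_mul, mul_zero, add_zero] at this
    refine exp_ne_exp_of_eq_one_add ?_ this
    rw [← sub_eq_iff_eq_add, ← sub_mul, mul_inv_cancel₀ hne']
  · have := DFunLike.congr_fun h (Multiplicative.ofAdd ((0 : ℂ), (1 : ℤ)))
    rw [monodromy_apply, monodromy_apply] at this
    simp only [mul_zero, Int.cast_one, one_mul, zero_add] at this
    obtain ⟨n, hn⟩ := Complex.exp_eq_exp_iff_exists_int.mp this
    refine ⟨n, ?_⟩
    have hpi : (2 * Real.pi * Complex.I : ℂ) ≠ 0 := by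
      simp [Real.pi_ne_zero]
    exact mul_right_cancel₀ hpi (by rw [hn]; ring)

/-- The translations fix `z₂/z₁` and multiply each term by its own character. Distinct characters
are linearly independent, so the terms that share a character already sum to zero. -/
theorem sum_logTerm_monodromy_eq_zero {k : ℕ} {r s : Fin k → ℂ} {f : Fin k → ℂ → ℂ}
    (h : ∀ ζ ∈ logDomain, ∑ i, logTerm (r i) (s i) (f i) ζ = 0)
    (χ : Multiplicative (ℂ × ℤ) →* ℂ) {ζ : ℂ × ℂ} (hζ : ζ ∈ logDomain) :
    ∑ i, (open Classical in if monodromy (r i) (s i) = χ then logTerm (r i) (s i) (f i) ζ else 0)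
      = 0 := by
  classical
  have hli := linearIndependent_monoidHom (Multiplicative (ℂ × ℤ)) ℂ
  rw [linearIndependent_iff] at hli
  have h0 := hli (∑ i, Finsupp.single (monodromy (r i) (s i)) (logTerm (r i) (s i) (f i) ζ)) (by
    rw [map_sum]
    funext g
    simp only [Finsupp.linearCombination_single, Finset.sum_apply, Pi.smul_apply, smul_eq_mul,
      Pi.zero_apply]
    obtain ⟨c, m, rfl⟩ : ∃ c m, g = Multiplicative.ofAdd ((c : ℂ), (m : ℤ)) :=
      ⟨g.toAdd.1, g.toAdd.2, rfl⟩
    rw [← h (ζ.1 + c, ζ.2 + c + m * (2 * Real.pi * Complex.I)) ?_]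
    · refine Finset.sum_congr rfl fun i _ => ?_
      rw [monodromy_apply]
      unfold logTerm
      simp only
      have : Complex.exp (ζ.2 + c + m * (2 * Real.pi * Complex.I) - (ζ.1 + c)) =
          Complex.exp (ζ.2 - ζ.1) := by
        rw [Complex.exp_eq_exp_iff_exists_int]
        exact ⟨m, by ring⟩
      rw [this, mul_right_comm, ← Complex.exp_add]
      ring_nf
    · have h' : ζ.2.re < ζ.1.re := hζ
      simp [logDomain, h'])
  have h1 := DFunLike.congr_fun h0 χ
  simpa [Finsupp.finsetSum_apply, Finsupp.single_apply] using h1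

theorem circleIntegral_zpow_mul {f : ℂ → ℂ} (hf : AnalyticOnNhd ℂ f (Metric.ball 0 1)) (m : ℤ) :
    (∮ z in C(0, 1 / 2), z ^ (-m - 1) * f z) =
      if 0 ≤ m then (2 * Real.pi * Complex.I) *
        (iteratedDeriv m.toNat f 0 / (m.toNat.factorial : ℂ)) else 0 := by
  have hd : DifferentiableOn ℂ f (Metric.closedBall 0 (1 / 2)) :=
    hf.differentiableOn.mono (Metric.closedBall_subset_ball (by norm_num))
  split_ifs with hm
  · obtain ⟨n, rfl⟩ := Int.eq_ofNat_of_zero_le hm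
    have := hd.circleIntegral_one_div_sub_center_pow_smul (by norm_num) n
    simp only [sub_zero, smul_eq_mul] at this
    rw [Int.toNat_natCast, ← mul_div_assoc, mul_div_right_comm, ← this]
    congr 1
    funext z
    congr 1
    rw [show (-(n : ℤ) - 1) = -((n + 1 : ℕ) : ℤ) by push_cast; ring, zpow_neg, zpow_natCast,
      one_div]
  · obtain ⟨n, hn⟩ := Int.eq_ofNat_of_zero_le (show 0 ≤ -m - 1 by omega)
    rw [hn]
    have hd' : DifferentiableOn ℂ (fun z => z ^ (n : ℤ) * f z) (Metric.closedBall 0 (1 / 2)) := by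
      simp only [zpow_natCast]
      exact (differentiableOn_pow n).mul hd
    apply Complex.circleIntegral_eq_zero_of_differentiable_on_off_countable (by norm_num)
      Set.countable_empty hd'.continuousOn
    intro z hz
    exact hd'.differentiableAt (Filter.mem_of_superset
      (Metric.isOpen_ball.mem_nhds hz.1) Metric.ball_subset_closedBall)

/-- Only the terms with the character of `(p,q)` can contribute to the coefficient at `(p,q)`, and
their exponents differ from `(p,q)` by integers. On the slice `z₁ = 1` their sum is single-valued up
to a common power of `z₂`, and Cauchy's formula on a circle reads off the coefficient. -/
theorem expansion_eq_zero {k : ℕ} {r s : Fin k → ℂ} {f : Fin k → ℂ → ℂ}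
    (hf : ∀ i, AnalyticOnNhd ℂ (f i) (Metric.ball 0 1))
    (h : ∀ ζ ∈ logDomain, ∑ i, logTerm (r i) (s i) (f i) ζ = 0) (p q : ℂ) :
    expansion r s f p q = 0 := by
  classical
  let I : Finset (Fin k) := Finset.univ.filter fun i => monodromy (r i) (s i) = monodromy p q
  -- The integer `m` may be negative. Then `f_i` has no Taylor coefficient to contribute, and the
  -- corresponding integrand is holomorphic on the disc.
  have hI : ∀ i ∈ I, ∃ m : ℤ, q = s i + m ∧ p = r i - m := by
    intro i hi
    obtain ⟨h1, m, hm⟩ := eq_of_monodromy_eq (Finset.mem_filter.mp hi).2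
    exact ⟨-m, by rw [hm]; push_cast; ring, by push_cast; linear_combination hm - h1⟩
  choose! m hmq hmp using hI
  have hsum : expansion r s f p q = ∑ i ∈ I, expTerm (r i) (s i) (f i) p q := by
    rw [expansion_eq_sum]
    refine (Finset.sum_subset (Finset.subset_univ _) fun i _ hi => ?_).symm
    apply expTerm_eq_zero
    intro j h1 h2
    apply hi
    simp only [I, Finset.mem_filter, Finset.mem_univ, true_and]
    ext g
    change Complex.exp _ = Complex.exp _
    rw [Complex.exp_eq_exp_iff_exists_int, h1, h2]
    exact ⟨-(j * (Multiplicative.ofAdd g).toAdd.2), by push_cast; ring⟩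
  have hterm : ∀ i ∈ I, (∮ z in C(0, 1 / 2), z ^ (-(m i) - 1) * f i z) =
      (2 * Real.pi * Complex.I) * expTerm (r i) (s i) (f i) p q := by
    intro i hi
    rw [circleIntegral_zpow_mul (hf i)]
    split_ifs with h0
    · rw [expTerm_eq (m i).toNat]
      · rw [hmp i hi]
        congr 1
        exact_mod_cast congrArg (Int.cast (R := ℂ)) (Int.toNat_of_nonneg h0).symm
      · rw [hmq i hi]
        congr 1
        exact_mod_cast congrArg (Int.cast (R := ℂ)) (Int.toNat_of_nonneg h0).symm
    · rw [expTerm_eq_zero, mul_zero]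
      intro j h1 h2
      rw [hmq i hi] at h2
      have h3 : m i = (j : ℤ) := by exact_mod_cast add_left_cancel h2
      omega
  have hzero : ∀ z ∈ Metric.sphere (0 : ℂ) (1 / 2),
      ∑ i ∈ I, z ^ (-(m i) - 1) * f i z = 0 := by
    intro z hz
    have hz' : ‖z‖ = 1 / 2 := by simpa using hz
    have hz0 : z ≠ 0 := by
      rintro rfl
      norm_num at hz'
    have hd : ((0 : ℂ), Complex.log z) ∈ logDomain := by
      simp only [logDomain, Set.mem_ofPred_eq, Complex.log_re, Complex.zero_re, hz']
      exact Real.log_neg (by norm_num) (by norm_num)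
    have h1 := sum_logTerm_monodromy_eq_zero h (monodromy p q) hd
    rw [← Finset.sum_filter] at h1
    have h2 : ∀ i ∈ I, z ^ (-(m i) - 1) * f i z =
        (Complex.exp (-(q + 1) * Complex.log z)) *
          logTerm (r i) (s i) (f i) (0, Complex.log z) := by
      intro i hi
      simp only [logTerm, mul_zero, zero_add, sub_zero, Complex.exp_log hz0]
      rw [← mul_assoc, ← Complex.exp_add, hmq i hi]
      congr 1
      conv_lhs => rw [← Complex.exp_log hz0, ← Complex.exp_int_mul]
      congr 1
      push_cast
      ring
    rw [Finset.sum_congr rfl h2, ← Finset.mul_sum, h1, mul_zero]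
  have hint : (∮ z in C(0, 1 / 2), ∑ i ∈ I, z ^ (-(m i) - 1) * f i z) =
      ∑ i ∈ I, ∮ z in C(0, 1 / 2), z ^ (-(m i) - 1) * f i z := by
    rw [circleIntegral.integral_fun_sum]
    intro i _
    apply ContinuousOn.circleIntegrable (by norm_num)
    refine ContinuousOn.mul (fun z hz => ?_) ((hf i).continuousOn.mono ?_)
    · refine (continuousAt_zpow₀ z _ (Or.inl ?_)).continuousWithinAt
      rintro rfl
      norm_num at hz
    · exact Metric.sphere_subset_closedBall.trans (Metric.closedBall_subset_ball (by norm_num))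
  rw [Finset.sum_congr rfl hterm, ← Finset.mul_sum, ← hsum,
    circleIntegral.integral_congr (by norm_num) hzero] at hint
  simp only [circleIntegral, smul_zero, intervalIntegral.integral_zero] at hint
  have hpi : (2 * Real.pi * Complex.I : ℂ) ≠ 0 := by simp [Real.pi_ne_zero]
  exact (mul_eq_zero.mp hint.symm).resolve_left hpi

theorem IsE12.eq_zero {b : ℂ → ℂ → ℂ} (h : IsE12 (fun _ _ => 0) b) (p q : ℂ) : b p q = 0 := by
  obtain ⟨k, r, s, f, h, rfl⟩ := h
  exact expansion_eq_zero h.1 (sum_logTerm_eq_zero h) p q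

/-- The series `E¹² a` is determined by `a`. -/
theorem IsE12.unique {a b b' : ℂ → ℂ → ℂ} (h : IsE12 a b) (h' : IsE12 a b') (p q : ℂ) :
    b p q = b' p q := by
  have h0 := h.add (h'.const_mul (-1))
  simp only [neg_one_mul, add_neg_cancel] at h0
  exact sub_eq_zero.mp (by simpa [sub_eq_add_neg] using h0.eq_zero p q)

/-- Rescaling all variables by `exp c` multiplies `a` by `exp (c d)` and the coefficient of `b` at
`(p,q)` by `exp (c (p + q))`. By uniqueness the two factors agree where `b` is nonzero; the choice
`c = (p + q - d)⁻¹` makes their exponents differ by `1`, a contradiction. -/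
theorem IsE12.support {a b : ℂ → ℂ → ℂ} {d : ℂ} (h : IsE12 a b)
    (ha : ∀ p q, a p q ≠ 0 → p + q = d) {p q : ℂ} (hb : b p q ≠ 0) : p + q = d := by
  by_contra hne
  have hne' : p + q - d ≠ 0 := sub_ne_zero.mpr hne
  have h1 := h.scale (p + q - d)⁻¹
  have h2 := h.const_mul (Complex.exp ((p + q - d)⁻¹ * d))
  have h3 : (fun p' q' => Complex.exp ((p + q - d)⁻¹ * (p' + q')) * a p' q') =
      fun p' q' => Complex.exp ((p + q - d)⁻¹ * d) * a p' q' := by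
    funext p' q'
    by_cases h0 : a p' q' = 0
    · simp [h0]
    · rw [ha p' q' h0]
  rw [h3] at h1
  have h4 := mul_right_cancel₀ hb (h1.unique h2 p q)
  have h5 : (p + q - d)⁻¹ * (p + q) = 1 + (p + q - d)⁻¹ * d := by
    field_simp
    ring
  exact exp_ne_exp_of_eq_one_add h5 h4

end DLM

/-! ### Differentiation in `z₁` -/

namespace DLM

/-- Four directions in `ℂ` by which `exp (|Re p| + |Im p|)` is dominated. -/
noncomputable def corner (x y : Bool) : ℂ :=
  ⟨if x then 1 else -1, if y then -1 else 1⟩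

/-- The exponents are arbitrary complex numbers, so no single shift of the argument dominates `exp
(t‖p‖)`. One of the four corners realizes `|Re p| + |Im p|` as `Re (p c)`; the sign of the imaginary
part is reversed because `Re (p c) = Re p Re c - Im p Im c`. -/
theorem exp_norm_le_sum_corner (t : ℝ) (ht : 0 ≤ t) (p : ℂ) :
    Real.exp (t * ‖p‖) ≤ ∑ c : Bool × Bool, ‖Complex.exp (p * (t * corner c.1 c.2))‖ := by
  have h1 : t * ‖p‖ ≤ t * (|p.re| + |p.im|) :=
    mul_le_mul_of_nonneg_left (Complex.norm_le_abs_re_add_abs_im p) ht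
  refine (Real.exp_le_exp.mpr h1).trans ?_
  have h2 : ∀ c : Bool × Bool, ‖Complex.exp (p * (t * corner c.1 c.2))‖ ≤
      ∑ c : Bool × Bool, ‖Complex.exp (p * (t * corner c.1 c.2))‖ := fun c =>
    Finset.single_le_sum (f := fun c : Bool × Bool =>
      ‖Complex.exp (p * (t * corner c.1 c.2))‖) (fun _ _ => norm_nonneg _) (Finset.mem_univ c)
  obtain ⟨c, hc⟩ : ∃ c : Bool × Bool,
      Real.exp (t * (|p.re| + |p.im|)) = ‖Complex.exp (p * (t * corner c.1 c.2))‖ := by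
    simp only [Complex.norm_exp, Complex.mul_re, Complex.mul_im, Complex.ofReal_re,
      Complex.ofReal_im, zero_mul, sub_zero, add_zero, Real.exp_eq_exp]
    rcases abs_cases p.re with ⟨hx, -⟩ | ⟨hx, -⟩ <;> rcases abs_cases p.im with ⟨hy, -⟩ | ⟨hy, -⟩ <;>
      rw [hx, hy]
    · exact ⟨(true, true), by simp [corner]; ring⟩
    · exact ⟨(true, false), by simp [corner]; ring⟩
    · exact ⟨(false, true), by simp [corner]; ring⟩
    · exact ⟨(false, false), by simp [corner]; ring⟩
  rw [hc]
  exact h2 c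

/-- Summability at the four shifted points `ζ₀ + 2t c` dominates the differentiated series on a ball
of radius `t`: one factor `exp (t‖p‖)` absorbs the displacement in the ball, the other absorbs the
factor `p` produced by differentiation. -/
theorem hasDerivAt_tsum_exp {a : ℂ → ℂ → ℂ} (h : ∀ ζ₀ ζ₂ : ℂ, ζ₀.re < ζ₂.re →
    Summable fun e : ℂ × ℂ => a e.1 e.2 * Complex.exp (e.1 * ζ₀ + e.2 * ζ₂))
    {ζ₀ ζ₂ : ℂ} (hζ : ζ₀.re < ζ₂.re) :
    Summable (fun e : ℂ × ℂ => e.1 * a e.1 e.2 * Complex.exp (e.1 * ζ₀ + e.2 * ζ₂)) ∧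
    HasDerivAt (fun ζ => ∑' e : ℂ × ℂ, a e.1 e.2 * Complex.exp (e.1 * ζ + e.2 * ζ₂))
      (∑' e : ℂ × ℂ, e.1 * a e.1 e.2 * Complex.exp (e.1 * ζ₀ + e.2 * ζ₂)) ζ₀ := by
  -- With a quarter of the gap, the shifts by `2t` reach at most the midpoint between the real parts
  -- and remain in the domain of convergence.
  set t : ℝ := (ζ₂.re - ζ₀.re) / 4 with ht
  have htpos : 0 < t := by
    rw [ht]; linarith
  let u : ℂ × ℂ → ℝ := fun e => ∑ c : Bool × Bool, t⁻¹ *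
    ‖a e.1 e.2 * Complex.exp (e.1 * (ζ₀ + (2 * t : ℝ) * corner c.1 c.2) + e.2 * ζ₂)‖
  have hu : Summable u := by
    apply summable_sum
    rintro ⟨x, y⟩ -
    refine ((h _ _ ?_).norm).mul_left _
    simp only [Complex.add_re, Complex.mul_re, Complex.ofReal_re, Complex.ofReal_im, zero_mul,
      sub_zero, corner]
    split_ifs <;> linarith
  have hbound : ∀ (e : ℂ × ℂ) (y : ℂ), y ∈ Metric.ball ζ₀ t →
      ‖e.1 * a e.1 e.2 * Complex.exp (e.1 * y + e.2 * ζ₂)‖ ≤ u e := by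
    intro e y hy
    have hy' : ‖y - ζ₀‖ < t := by simpa [dist_eq_norm] using hy
    have e1 : Complex.exp (e.1 * y + e.2 * ζ₂) =
        Complex.exp (e.1 * ζ₀ + e.2 * ζ₂) * Complex.exp (e.1 * (y - ζ₀)) := by
      rw [← Complex.exp_add]; ring_nf
    have e2 : ‖Complex.exp (e.1 * (y - ζ₀))‖ ≤ Real.exp (t * ‖e.1‖) := by
      rw [Complex.norm_exp, Real.exp_le_exp]
      refine (Complex.re_le_norm _).trans ?_
      rw [norm_mul, mul_comm]
      exact mul_le_mul_of_nonneg_right hy'.le (norm_nonneg _)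
    have e3 : ‖e.1‖ ≤ t⁻¹ * Real.exp (t * ‖e.1‖) := by
      rw [← div_eq_inv_mul, le_div_iff₀ htpos, mul_comm]
      linarith [Real.add_one_le_exp (t * ‖e.1‖)]
    have e4 : u e = t⁻¹ * (‖a e.1 e.2 * Complex.exp (e.1 * ζ₀ + e.2 * ζ₂)‖ *
        ∑ c : Bool × Bool, ‖Complex.exp (e.1 * ((2 * t : ℝ) * corner c.1 c.2))‖) := by
      simp only [u, Finset.mul_sum]
      refine Finset.sum_congr rfl fun c _ => ?_
      rw [← norm_mul, mul_assoc (a e.1 e.2), ← Complex.exp_add]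
      ring_nf
    calc ‖e.1 * a e.1 e.2 * Complex.exp (e.1 * y + e.2 * ζ₂)‖
        = ‖e.1‖ * (‖a e.1 e.2 * Complex.exp (e.1 * ζ₀ + e.2 * ζ₂)‖ *
          ‖Complex.exp (e.1 * (y - ζ₀))‖) := by
          rw [e1, norm_mul, norm_mul, norm_mul, norm_mul]; ring
      _ ≤ (t⁻¹ * Real.exp (t * ‖e.1‖)) * (‖a e.1 e.2 * Complex.exp (e.1 * ζ₀ + e.2 * ζ₂)‖ *
          Real.exp (t * ‖e.1‖)) := by gcongr
      _ = t⁻¹ * (‖a e.1 e.2 * Complex.exp (e.1 * ζ₀ + e.2 * ζ₂)‖ *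
          Real.exp (2 * t * ‖e.1‖)) := by
          rw [show 2 * t * ‖e.1‖ = t * ‖e.1‖ + t * ‖e.1‖ by ring, Real.exp_add]; ring
      _ ≤ u e := by
          rw [e4]
          gcongr
          exact exp_norm_le_sum_corner _ (by positivity) _
  have hmem : ζ₀ ∈ Metric.ball ζ₀ t := Metric.mem_ball_self htpos
  refine ⟨Summable.of_norm_bounded hu fun e => hbound e ζ₀ hmem, ?_⟩
  refine hasDerivAt_tsum_of_isPreconnected (t := Metric.ball ζ₀ t) hu Metric.isOpen_ball
    (convex_ball ζ₀ t).isPreconnected ?_ hbound hmem (h ζ₀ ζ₂ hζ) hmem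
  intro e y _
  have h1 : HasDerivAt (fun ζ : ℂ => e.1 * ζ + e.2 * ζ₂) e.1 y := by
    simpa using ((hasDerivAt_id y).const_mul e.1).add_const (e.2 * ζ₂)
  have h2 := h1.cexp.const_mul (a e.1 e.2)
  exact h2.congr_deriv (by ring)

/-- The operator `z₁ ∂/∂z₁` turns `z₁^r f(z₂/z₁)` into `z₁^r (r f - x f')(z₂/z₁)`, and `x f'` has
`j`-th Taylor coefficient `j` times that of `f`. -/
theorem iteratedDeriv_euler {f : ℂ → ℂ} (hf : AnalyticOnNhd ℂ f (Metric.ball 0 1)) (r : ℂ)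
    (j : ℕ) : iteratedDeriv j (fun x => r * f x - x * deriv f x) 0 =
      (r - j) * iteratedDeriv j f 0 := by
  have h0 : (0 : ℂ) ∈ Metric.ball (0 : ℂ) 1 := Metric.mem_ball_self one_pos
  have hf0 : AnalyticAt ℂ f 0 := hf 0 h0
  have hd : ∀ n : WithTop ℕ∞, ContDiffAt ℂ n (deriv f) 0 := fun n => hf0.deriv.contDiffAt
  have hid : ∀ n : WithTop ℕ∞, ContDiffAt ℂ n (fun x : ℂ => x) 0 := fun n => contDiffAt_id
  rw [iteratedDeriv_fun_sub (contDiffAt_const.mul hf0.contDiffAt) ((hid _).mul (hd _)),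
    iteratedDeriv_const_mul_field]
  have key : iteratedDeriv j (fun x => x * deriv f x) 0 = j * iteratedDeriv j f 0 := by
    rw [iteratedDeriv_fun_mul (hid _) (hd _)]
    cases j with
    | zero => simp
    | succ j =>
      rw [Finset.sum_eq_single 1]
      · simp [iteratedDeriv_succ']
      · intro i hi h1
        rcases i with _ | _ | i
        · simp
        · exact absurd rfl h1
        · have : iteratedDeriv (i + 1 + 1) (fun x : ℂ => x) 0 = 0 := by
            simp [iteratedDeriv_succ']
          rw [this]
          ring
      · intro h
        exact absurd (Finset.mem_range.mpr (by omega)) h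
  rw [key]
  ring

/-- Differentiation with respect to `z₁`, for fixed `z₂`. -/
theorem IsE12.deriv_z₁ {a b : ℂ → ℂ → ℂ} (h : IsE12 a b) :
    IsE12 (fun p q => (p + 1) * a (p + 1) q) (fun p q => (p + 1) * b (p + 1) q) := by
  obtain ⟨k, r, s, f, ⟨h1, h2, h3⟩, rfl⟩ := h
  have key : ∀ ζ₀ ζ₂ : ℂ, (fun e : ℂ × ℂ =>
      (e.1 + 1) * a (e.1 + 1) e.2 * Complex.exp (e.1 * ζ₀ + e.2 * ζ₂)) =
      (fun e : ℂ × ℂ => Complex.exp (-ζ₀) *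
        (e.1 * a e.1 e.2 * Complex.exp (e.1 * ζ₀ + e.2 * ζ₂))) ∘
        (Equiv.addRight ((1, 0) : ℂ × ℂ)) := by
    intro ζ₀ ζ₂
    funext e
    simp only [Function.comp_apply, Equiv.coe_addRight, Prod.fst_add, Prod.snd_add, add_zero]
    rw [mul_left_comm, ← Complex.exp_add]
    ring_nf
  refine ⟨k, fun i => r i - 1, s, fun i x => r i * f i x - x * deriv (f i) x, ⟨?_, ?_, ?_⟩, ?_⟩
  · intro i
    exact (analyticOnNhd_const.mul (h1 i)).sub (analyticOnNhd_id.mul (h1 i).deriv)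
  · intro ζ₀ ζ₂ h
    rw [key, Equiv.summable_iff]
    exact (hasDerivAt_tsum_exp h2 h).1.mul_left _
  · intro ζ₀ ζ₁ ζ₂ e1 e2 e3 e4 e5
    rw [key]
    simp only [Function.comp_def]
    rw [Equiv.tsum_eq (Equiv.addRight ((1, 0) : ℂ × ℂ)) (fun e : ℂ × ℂ =>
        Complex.exp (-ζ₀) * (e.1 * a e.1 e.2 * Complex.exp (e.1 * ζ₀ + e.2 * ζ₂))),
      tsum_mul_left]
    -- A local branch of `log (z₁ - z₂)` as a function of `t = log z₁` for fixed `z₂`, normalized to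
    -- take the value `ζ₀` at `ζ₁`. Both sides of the extension identity are differentiated along
    -- it, and the chain rule contributes `z₁/z₀`.
    let g : ℂ → ℂ := fun t => ζ₀ + Complex.log ((Complex.exp t - Complex.exp ζ₂) / Complex.exp ζ₀)
    have hq : (Complex.exp ζ₁ - Complex.exp ζ₂) / Complex.exp ζ₀ = 1 := by
      rw [← e3, div_self (Complex.exp_ne_zero _)]
    have hg0 : g ζ₁ = ζ₀ := by simp [g, hq]
    have hgd : HasDerivAt g (Complex.exp ζ₁ / Complex.exp ζ₀) ζ₁ := by
      have h4 : HasDerivAt (fun t => (Complex.exp t - Complex.exp ζ₂) / Complex.exp ζ₀)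
          (Complex.exp ζ₁ / Complex.exp ζ₀) ζ₁ :=
        ((Complex.hasDerivAt_exp ζ₁).sub_const _).div_const _
      have h5 := (h4.clog (by rw [hq]; exact Complex.one_mem_slitPlane)).const_add ζ₀
      rwa [hq, div_one] at h5
    have hgc : ContinuousAt g ζ₁ := hgd.continuousAt
    have hgexp : ∀ᶠ t in nhds ζ₁, Complex.exp (g t) = Complex.exp t - Complex.exp ζ₂ := by
      have : ContinuousAt (fun t => (Complex.exp t - Complex.exp ζ₂) / Complex.exp ζ₀) ζ₁ := by
        have := Complex.exp_ne_zero ζ₀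
        fun_prop (disch := assumption)
      filter_upwards [this.eventually_ne (by rw [hq]; exact one_ne_zero)] with t ht
      simp only [g]
      rw [Complex.exp_add, Complex.exp_log ht, mul_div_cancel₀ _ (Complex.exp_ne_zero _)]
    have d1 : ∀ᶠ t in nhds ζ₁, (g t).re < ζ₂.re :=
      ContinuousAt.eventually_lt (Complex.continuous_re.continuousAt.comp hgc)
        continuousAt_const (by simpa [hg0] using e1)
    have d2 : ∀ᶠ t in nhds ζ₁, ζ₂.re < t.re :=
      ContinuousAt.eventually_lt continuousAt_const Complex.continuous_re.continuousAt e2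
    have d4 : ∀ᶠ t in nhds ζ₁, |ζ₂.im - t.im| < Real.pi / 2 :=
      ContinuousAt.eventually_lt
        (continuousAt_const.sub Complex.continuous_im.continuousAt).abs continuousAt_const e4
    have d5 : ∀ᶠ t in nhds ζ₁, |(g t).im - t.im| < Real.pi / 2 :=
      ContinuousAt.eventually_lt
        ((Complex.continuous_im.continuousAt.comp hgc).sub Complex.continuous_im.continuousAt).abs
        continuousAt_const (by simpa [hg0] using e5)
    have heq : (fun t => ∑' e : ℂ × ℂ, a e.1 e.2 * Complex.exp (e.1 * g t + e.2 * ζ₂)) =ᶠ[nhds ζ₁]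
        fun t => ∑ i, Complex.exp (r i * t + s i * ζ₂) * f i (Complex.exp (ζ₂ - t)) := by
      filter_upwards [hgexp, d1, d2, d4, d5] with t t3 t1 t2 t4 t5
      exact h3 _ _ _ t1 t2 t3 t4 t5
    have hL : HasDerivAt (fun t => ∑' e : ℂ × ℂ, a e.1 e.2 * Complex.exp (e.1 * g t + e.2 * ζ₂))
        ((∑' e : ℂ × ℂ, e.1 * a e.1 e.2 * Complex.exp (e.1 * ζ₀ + e.2 * ζ₂)) *
          (Complex.exp ζ₁ / Complex.exp ζ₀)) ζ₁ := by
      have h6 := (hasDerivAt_tsum_exp h2 e1).2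
      rw [← hg0] at h6
      have h7 := h6.comp ζ₁ hgd
      rw [hg0] at h7
      exact h7
    have hx : Complex.exp (ζ₂ - ζ₁) ∈ Metric.ball (0 : ℂ) 1 :=
      exp_mem_ball (ζ := (ζ₁, ζ₂)) e2
    have hR : HasDerivAt
        (fun t => ∑ i, Complex.exp (r i * t + s i * ζ₂) * f i (Complex.exp (ζ₂ - t)))
        (∑ i, Complex.exp (r i * ζ₁ + s i * ζ₂) * (r i * f i (Complex.exp (ζ₂ - ζ₁)) -
          Complex.exp (ζ₂ - ζ₁) * deriv (f i) (Complex.exp (ζ₂ - ζ₁)))) ζ₁ := by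
      refine HasDerivAt.fun_sum fun i _ => ?_
      have k1 : HasDerivAt (fun t : ℂ => Complex.exp (r i * t + s i * ζ₂))
          (Complex.exp (r i * ζ₁ + s i * ζ₂) * r i) ζ₁ := by
        have : HasDerivAt (fun t : ℂ => r i * t + s i * ζ₂) (r i) ζ₁ := by
          simpa using ((hasDerivAt_id ζ₁).const_mul (r i)).add_const (s i * ζ₂)
        exact this.cexp
      have k2 : HasDerivAt (fun t : ℂ => Complex.exp (ζ₂ - t)) (Complex.exp (ζ₂ - ζ₁) * (-1)) ζ₁ :=
        ((hasDerivAt_id ζ₁).const_sub ζ₂).cexp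
      have k3 : HasDerivAt (f i) (deriv (f i) (Complex.exp (ζ₂ - ζ₁))) (Complex.exp (ζ₂ - ζ₁)) :=
        (h1 i _ hx).differentiableAt.hasDerivAt
      refine (k1.mul (k3.comp ζ₁ k2)).congr_deriv ?_
      simp only [Function.comp_apply]
      ring
    have hfin := (hL.congr_of_eventuallyEq heq.symm).unique hR
    have hfin' := congrArg (fun x => Complex.exp (-ζ₁) * x) hfin
    rw [Finset.mul_sum] at hfin'
    have lhs : Complex.exp (-ζ₁) *
        ((∑' e : ℂ × ℂ, e.1 * a e.1 e.2 * Complex.exp (e.1 * ζ₀ + e.2 * ζ₂)) *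
          (Complex.exp ζ₁ / Complex.exp ζ₀)) = Complex.exp (-ζ₀) *
        ∑' e : ℂ × ℂ, e.1 * a e.1 e.2 * Complex.exp (e.1 * ζ₀ + e.2 * ζ₂) := by
      rw [Complex.exp_neg, Complex.exp_neg]
      generalize (∑' e : ℂ × ℂ, e.1 * a e.1 e.2 * Complex.exp (e.1 * ζ₀ + e.2 * ζ₂)) = T
      have := Complex.exp_ne_zero ζ₁
      have := Complex.exp_ne_zero ζ₀
      field_simp
    rw [← lhs, hfin']
    refine Finset.sum_congr rfl fun i _ => ?_
    rw [← mul_assoc, ← Complex.exp_add]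
    ring_nf
  · funext p q
    simp only [expansion_eq_sum, Finset.mul_sum]
    refine Finset.sum_congr rfl fun i _ => ?_
    rcases expTerm_cases (r i) (s i) (p + 1) q with ⟨j, hp, hq⟩ | h
    · rw [expTerm_eq j hp hq, expTerm_eq j (by linear_combination hp) hq, iteratedDeriv_euler (h1 i),
        hp]
      ring
    · rw [expTerm_eq_zero h, expTerm_eq_zero, mul_zero]
      intro j h1 h2
      exact h j (by linear_combination h1) h2

end DLM

namespace DLM

/-! ### Matrix coefficients indexed by modes -/

/-- The relation `E¹² α = β` for series indexed by modes: the coefficient `α p n` belongs to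
`z₀^{-p-1} z₂^{-n-1}`, and `β r n` to `z₁^{-r-1} z₂^{-n-1}`. -/
def ModeE12 (α β : ℂ → ℂ → ℂ) : Prop :=
  IsE12 (fun p q => α (-p - 1) (-q - 1)) (fun p q => β (-p - 1) (-q - 1))

namespace ModeE12

variable {α β α' β' : ℂ → ℂ → ℂ}

theorem of_isE12 {a b : ℂ → ℂ → ℂ} (h : IsE12 a b) :
    ModeE12 (fun p n => a (-p - 1) (-n - 1)) (fun r n => b (-r - 1) (-n - 1)) := by
  have e : ∀ x : ℂ, -(-x - 1) - 1 = x := fun x => by ring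
  simpa only [ModeE12, e] using h

theorem congr (h : ModeE12 α β) (hα : ∀ p n, α p n = α' p n) (hβ : ∀ r n, β r n = β' r n) :
    ModeE12 α' β' := by
  have h1 : α = α' := by funext p n; exact hα p n
  have h2 : β = β' := by funext p n; exact hβ p n
  rwa [← h1, ← h2]

theorem add (h : ModeE12 α β) (h' : ModeE12 α' β') :
    ModeE12 (fun p n => α p n + α' p n) (fun p n => β p n + β' p n) := IsE12.add h h'

theorem const_mul (c : ℂ) (h : ModeE12 α β) :
    ModeE12 (fun p n => c * α p n) (fun p n => c * β p n) := IsE12.const_mul c h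

theorem zero : ModeE12 (fun _ _ => 0) (fun _ _ => 0) := IsE12.zero

theorem sub (h : ModeE12 α β) (h' : ModeE12 α' β') :
    ModeE12 (fun p n => α p n - α' p n) (fun p n => β p n - β' p n) := by
  simpa [sub_eq_add_neg] using h.add (h'.const_mul (-1))

theorem sum {ι : Type*} (s : Finset ι) {α β : ι → ℂ → ℂ → ℂ} (h : ∀ i ∈ s, ModeE12 (α i) (β i)) :
    ModeE12 (fun p n => ∑ i ∈ s, α i p n) (fun p n => ∑ i ∈ s, β i p n) := by
  classical
  induction s using Finset.induction_on with
  | empty => simpa using zero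
  | insert i s hi ih =>
    simp only [Finset.sum_insert hi]
    exact (h i (Finset.mem_insert_self i s)).add
      (ih fun j hj => h j (Finset.mem_insert_of_mem hj))

/-- This is multiplication by `z₁`, which is `z₀ + z₂` on the iterate side, whence the two terms
there. Raising an exponent by one raises the mode index of the coefficient that is read. -/
theorem shift_z₁ (h : ModeE12 α β) :
    ModeE12 (fun p n => α (p + 1) n + α p (n + 1)) (fun r n => β (r + 1) n) := by
  have e : ∀ x : ℂ, -(x - 1) - 1 = -x - 1 + 1 := fun x => by ring
  have := IsE12.mul_z₁ h
  simpa only [ModeE12, e] using this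

theorem shift_z₂ (c : ℂ) (h : ModeE12 α β) :
    ModeE12 (fun p n => α p (n + c)) (fun r n => β r (n + c)) := by
  have e : ∀ x : ℂ, -(x - c) - 1 = -x - 1 + c := fun x => by ring
  have := IsE12.mul_z₂ c h
  simpa only [ModeE12, e] using this

theorem deriv_z₁ (h : ModeE12 α β) :
    ModeE12 (fun p n => -p * α (p - 1) n) (fun r n => -r * β (r - 1) n) := by
  have e : ∀ x : ℂ, -(x + 1) - 1 = -x - 1 - 1 := fun x => by ring
  have e' : ∀ x : ℂ, -(-x - 1) = x + 1 := fun x => by ring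
  have := IsE12.deriv_z₁ h
  simpa only [ModeE12, e, e'] using this

theorem unique (h : ModeE12 α β) (h' : ModeE12 α β') (r n : ℂ) : β r n = β' r n := by
  have e : ∀ x : ℂ, -(-x - 1) - 1 = x := fun x => by ring
  simpa only [e] using IsE12.unique h h' (-r - 1) (-n - 1)

theorem eq_zero (h : ModeE12 α β) (hα : ∀ p n, α p n = 0) (r n : ℂ) : β r n = 0 :=
  (h.congr hα (fun _ _ => rfl)).unique zero r n

theorem support {d : ℂ} (h : ModeE12 α β) (ha : ∀ p n, α p n ≠ 0 → p + n = d) {r n : ℂ}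
    (hb : β r n ≠ 0) : r + n = d := by
  have e : ∀ x : ℂ, -(-x - 1) - 1 = x := fun x => by ring
  have h1 := IsE12.support (d := -d - 2) h (fun p q h0 => by
    linear_combination -(ha _ _ h0)) (p := -r - 1) (q := -n - 1) (by simpa only [e] using hb)
  linear_combination -h1

end ModeE12

/-! ### The sums of the Jacobi identity -/

section Truncation

variable {X : Type*} [AddCommGroup X] {R : Type*} {R₁ R₂ : Type*} [CommRing R₂]

theorem choose_zero_left {i : ℕ} (hi : i ≠ 0) : Ring.choose (0 : ℤ) i = 0 := by
  obtain ⟨k, rfl⟩ := Nat.exists_eq_succ_of_ne_zero hi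
  exact Ring.choose_zero_succ ℤ k

theorem finsum_eq_sum_range {f : ℕ → X} {B : ℕ} (h : ∀ i, B ≤ i → f i = 0) :
    ∑ᶠ i, f i = ∑ i ∈ Finset.range B, f i := by
  refine finsum_eq_sum_of_support_subset f fun i hi => ?_
  by_contra h0
  exact hi (h i (by simpa using h0))

/-- `g x k` vanishes for all large `k`. -/
def UpperTrunc (g : R → ℤ → X) : Prop := ∃ B : ℤ, ∀ k, B ≤ k → ∀ x, g x k = 0

/-- `g x (n + i)` vanishes for all large `i`, for every `n`. -/
def CosetTrunc (g : R₁ → R₂ → X) : Prop := ∀ n : R₂, ∃ B : ℕ, ∀ i : ℕ, B ≤ i → ∀ x, g x (n + i) = 0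

theorem UpperTrunc.exists_bound {g : R → ℤ → X} (hg : UpperTrunc g) (l : ℤ) :
    ∃ B : ℕ, ∀ i : ℕ, B ≤ i → ∀ x, g x (l + i) = 0 := by
  obtain ⟨B, hB⟩ := hg
  exact ⟨(B - l).toNat, fun i hi x => hB _ (by omega) x⟩

theorem UpperTrunc.cosetTrunc {g : R → ℤ → X} (hg : UpperTrunc g) : CosetTrunc g :=
  fun l => hg.exists_bound l

end Truncation

section JacobiSums

variable {X : Type*} [AddCommGroup X] [Module ℂ X] {Z : Type*} [AddCommGroup Z] [Module ℂ Z]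
variable {R R₁ R₂ : Type*} [CommRing R] [CommRing R₁] [CommRing R₂]

/-- The sum on the left-hand side of the Jacobi identity. -/
noncomputable def assocSum (g : R → ℤ → X) (l m : ℤ) (n : R) : X :=
  ∑ᶠ i : ℕ, ((Ring.choose m i : ℤ) : ℂ) • g (m + n - i) (l + i)

/-- The sums on the right-hand side of the Jacobi identity. -/
noncomputable def commSum (g : R₁ → R₂ → X) (l : ℤ) (m : R₁) (n : R₂) : X :=
  ∑ᶠ i : ℕ, ((-1 : ℂ) ^ i * ((Ring.choose l i : ℤ) : ℂ)) • g (m + l - i) (n + i)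

theorem assocSum_eq_sum {g : R → ℤ → X} {l m : ℤ} {n : R} {B : ℕ}
    (h : ∀ i : ℕ, B ≤ i → g (m + n - i) (l + i) = 0) :
    assocSum g l m n =
      ∑ i ∈ Finset.range B, ((Ring.choose m i : ℤ) : ℂ) • g (m + n - i) (l + i) :=
  finsum_eq_sum_range fun i hi => by rw [h i hi, smul_zero]

theorem commSum_eq_sum {g : R₁ → R₂ → X} {l : ℤ} {m : R₁} {n : R₂} {B : ℕ}
    (h : ∀ i : ℕ, B ≤ i → g (m + l - i) (n + i) = 0) :
    commSum g l m n = ∑ i ∈ Finset.range B,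
      ((-1 : ℂ) ^ i * ((Ring.choose l i : ℤ) : ℂ)) • g (m + l - i) (n + i) :=
  finsum_eq_sum_range fun i hi => by rw [h i hi, smul_zero]

theorem assocSum_zero (g : R → ℤ → X) (l : ℤ) (n : R) : assocSum g l 0 n = g n l := by
  unfold assocSum
  rw [finsum_eq_single _ 0]
  · simp
  · intro i hi
    rw [choose_zero_left hi]
    simp

theorem commSum_zero (g : R₁ → R₂ → X) (m : R₁) (n : R₂) : commSum g 0 m n = g m n := by
  unfold commSum
  rw [finsum_eq_single _ 0]
  · simp
  · intro i hi
    rw [choose_zero_left hi]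
    simp

theorem assocSum_one {g : R → ℤ → X} (l : ℤ) (n : R) :
    assocSum g l 1 n = g (1 + n) l + g n (l + 1) := by
  have h : ∀ i : ℕ, 2 ≤ i → Ring.choose (1 : ℤ) i = 0 := by
    intro i hi
    have := Ring.choose_natCast (R := ℤ) 1 i
    rw [Nat.cast_one] at this
    rw [this, Nat.choose_eq_zero_of_lt (by omega), Nat.cast_zero]
  unfold assocSum
  rw [finsum_eq_sum_range (B := 2) fun i hi => by rw [h i hi]; simp]
  simp [Finset.sum_range_succ]

theorem assocSum_eq_zero {g : R → ℤ → X} {l : ℤ} (h : ∀ k, l ≤ k → ∀ x, g x k = 0) (m : ℤ)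
    (n : R) : assocSum g l m n = 0 := by
  unfold assocSum
  exact finsum_eq_zero_of_forall_eq_zero fun i => by rw [h _ (by omega), smul_zero]

theorem assocSum_eq_zero_of_forall {g : R → ℤ → X} {l m : ℤ} {n : R}
    (h : ∀ i : ℕ, g (m + n - i) (l + i) = 0) : assocSum g l m n = 0 := by
  unfold assocSum
  exact finsum_eq_zero_of_forall_eq_zero fun i => by rw [h i, smul_zero]

theorem commSum_eq_zero {g : R₁ → R₂ → X} {l : ℤ} {m : R₁} {n : R₂}
    (h : ∀ i : ℕ, g (m + l - i) (n + i) = 0) : commSum g l m n = 0 := by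
  unfold commSum
  exact finsum_eq_zero_of_forall_eq_zero fun i => by rw [h i, smul_zero]

theorem assocSum_congr {g g' : R → ℤ → X} {l m : ℤ} {n : R}
    (h : ∀ i : ℕ, g (m + n - i) (l + i) = g' (m + n - i) (l + i)) :
    assocSum g l m n = assocSum g' l m n := by
  unfold assocSum
  exact finsum_congr fun i => by rw [h i]

theorem commSum_congr {g g' : R₁ → R₂ → X} {l : ℤ} {m : R₁} {n : R₂}
    (h : ∀ i : ℕ, g (m + l - i) (n + i) = g' (m + l - i) (n + i)) :
    commSum g l m n = commSum g' l m n := by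
  unfold commSum
  exact finsum_congr fun i => by rw [h i]

theorem assocSum_sub {g g' : R → ℤ → X} (hg : UpperTrunc g) (hg' : UpperTrunc g') (l m : ℤ)
    (n : R) : assocSum (fun x k => g x k - g' x k) l m n =
      assocSum g l m n - assocSum g' l m n := by
  obtain ⟨B, hB⟩ := hg.exists_bound l
  obtain ⟨B', hB'⟩ := hg'.exists_bound l
  rw [assocSum_eq_sum (B := max B B') fun i hi => hB i (le_trans (le_max_left _ _) hi) _,
    assocSum_eq_sum (B := max B B') fun i hi => hB' i (le_trans (le_max_right _ _) hi) _,
    assocSum_eq_sum (B := max B B') fun i hi => by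
      rw [hB i (le_trans (le_max_left _ _) hi), hB' i (le_trans (le_max_right _ _) hi), sub_zero],
    ← Finset.sum_sub_distrib]
  simp only [smul_sub]

theorem commSum_sub {g g' : R₁ → R₂ → X} (hg : CosetTrunc g) (hg' : CosetTrunc g') (l : ℤ)
    (m : R₁) (n : R₂) : commSum (fun x k => g x k - g' x k) l m n =
      commSum g l m n - commSum g' l m n := by
  obtain ⟨B, hB⟩ := hg n
  obtain ⟨B', hB'⟩ := hg' n
  rw [commSum_eq_sum (B := max B B') fun i hi => hB i (le_trans (le_max_left _ _) hi) _,
    commSum_eq_sum (B := max B B') fun i hi => hB' i (le_trans (le_max_right _ _) hi) _,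
    commSum_eq_sum (B := max B B') fun i hi => by
      rw [hB i (le_trans (le_max_left _ _) hi), hB' i (le_trans (le_max_right _ _) hi), sub_zero],
    ← Finset.sum_sub_distrib]
  simp only [smul_sub]

theorem map_assocSum (f : X →ₗ[ℂ] Z) {g : R → ℤ → X} (hg : UpperTrunc g) (l m : ℤ) (n : R) :
    f (assocSum g l m n) = assocSum (fun x k => f (g x k)) l m n := by
  obtain ⟨B, hB⟩ := hg.exists_bound l
  rw [assocSum_eq_sum (B := B) fun i hi => hB i hi _,
    assocSum_eq_sum (B := B) fun i hi => by rw [hB i hi, map_zero], map_sum]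
  simp only [map_smul]

theorem map_commSum (f : X →ₗ[ℂ] Z) {g : R₁ → R₂ → X} (hg : CosetTrunc g) (l : ℤ) (m : R₁)
    (n : R₂) : f (commSum g l m n) = commSum (fun x k => f (g x k)) l m n := by
  obtain ⟨B, hB⟩ := hg n
  rw [commSum_eq_sum (B := B) fun i hi => hB i hi _,
    commSum_eq_sum (B := B) fun i hi => by rw [hB i hi, map_zero], map_sum]
  simp only [map_smul]

/-- Pascal's rule for the left-hand side of the Jacobi identity. -/
theorem assocSum_succ {g : R → ℤ → X} (hg : UpperTrunc g) (l m : ℤ) (n : R) :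
    assocSum g (l + 1) m n = assocSum g l (m + 1) n - assocSum g l m (n + 1) := by
  obtain ⟨B, hB⟩ := hg.exists_bound l
  rw [assocSum_eq_sum (l := l) (B := B + 1) fun i hi => hB i (by omega) _,
    assocSum_eq_sum (l := l) (B := B + 1) fun i hi => hB i (by omega) _,
    assocSum_eq_sum (l := l + 1) (B := B) fun i hi => by
      have := hB (i + 1) (by omega)
      rw [show l + 1 + (i : ℤ) = l + ((i + 1 : ℕ) : ℤ) by push_cast; ring]
      exact this _, ← Finset.sum_sub_distrib, Finset.sum_range_succ', ]
  simp only [Ring.choose_zero_right, Nat.cast_zero, Int.cast_add, Int.cast_one]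
  rw [show (m + 1 + n - 0 : R) = m + (n + 1) - 0 by ring, sub_self, add_zero]
  refine Finset.sum_congr rfl fun i _ => ?_
  rw [Ring.choose_succ_succ, Int.cast_add, add_smul,
    show ((m : R) + 1 + n - (i + 1 : ℕ)) = m + n - i by push_cast; ring,
    show ((m : R) + (n + 1) - (i + 1 : ℕ)) = m + n - i by push_cast; ring,
    show l + ((i + 1 : ℕ) : ℤ) = l + 1 + i by push_cast; ring, add_sub_cancel_right]

/-- Pascal's rule for the right-hand side of the Jacobi identity. -/
theorem commSum_succ {g : R₁ → R₂ → X} (hg : CosetTrunc g) (l : ℤ) (m : R₁) (n : R₂) :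
    commSum g (l + 1) m n = commSum g l (m + 1) n - commSum g l m (n + 1) := by
  obtain ⟨B, hB⟩ := hg n
  have e : ∀ (i : ℕ), n + 1 + (i : R₂) = n + ((i + 1 : ℕ) : R₂) := fun i => by push_cast; ring
  rw [commSum_eq_sum (l := l + 1) (B := B + 1) fun i hi => hB i (by omega) _,
    commSum_eq_sum (l := l) (n := n) (B := B + 1) fun i hi => hB i (by omega) _,
    commSum_eq_sum (l := l) (n := n + 1) (B := B) fun i hi => by
      rw [e]; exact hB (i + 1) (by omega) _,
    Finset.sum_range_succ', Finset.sum_range_succ', add_sub_right_comm (α := X),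
    ← Finset.sum_sub_distrib]
  congr 1
  · refine Finset.sum_congr rfl fun i _ => ?_
    rw [Ring.choose_succ_succ, Int.cast_add, e,
      show (m + ((l + 1 : ℤ) : R₁) - (i + 1 : ℕ)) = m + l - i by push_cast; ring,
      show (m + 1 + (l : R₁) - (i + 1 : ℕ)) = m + l - i by push_cast; ring, ← sub_smul, pow_succ]
    congr 1
    ring
  · simp only [Ring.choose_zero_right, Nat.cast_zero, Int.cast_add, Int.cast_one]
    rw [show m + (l + 1) = m + 1 + (l : R₁) by ring]

end JacobiSums

/-! ### Difference operators -/

section Step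

variable {X : Type*} [AddCommGroup X]
variable {R S : Type*} [CommRing R] [CommRing S]

/-- The difference of the shifts in the two variables. -/
def step (f : S → R → X) (m : S) (r : R) : X := f (m + 1) r - f m (r + 1)

/-- Since `f (m + 1) r = step f m r + f m (r + 1)`, the values at every `m ≥ 0` are determined by
those of the iterated differences at `0`. -/
theorem eq_zero_of_iterate_step_zero {f : ℤ → R → X} (h : ∀ N r, step^[N] f 0 r = 0) (m : ℕ)
    (r : R) : f m r = 0 := by
  induction m generalizing f r with
  | zero => exact h 0 r
  | succ m ih =>
    have h1 := ih (f := step f) (fun N r => h (N + 1) r) r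
    have h2 := ih h (r + 1)
    rw [step, h2, sub_zero] at h1
    exact_mod_cast h1

/-- If a single difference vanishes, `f` is constant along the antidiagonals, and vanishing far out
along them gives `f = 0`. Induction on `N` peels off one difference at a time. -/
theorem eq_zero_of_iterate_step_of_tendsto {f : ℤ → R → X}
    (h0 : ∀ m r, ∃ j₀ : ℕ, ∀ j : ℕ, j₀ ≤ j → f (m + j) (r - j) = 0) (N : ℕ)
    (h : ∀ m r, step^[N] f m r = 0) (m : ℤ) (r : R) : f m r = 0 := by
  induction N generalizing f m r with
  | zero => exact h m r
  | succ N ih =>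
    have h1 : ∀ m r, step f m r = 0 := by
      refine ih (fun m r => ?_) h
      obtain ⟨j₁, hj₁⟩ := h0 (m + 1) r
      obtain ⟨j₂, hj₂⟩ := h0 m (r + 1)
      refine ⟨max j₁ j₂, fun j hj => ?_⟩
      rw [step, add_right_comm, hj₁ j (le_trans (le_max_left _ _) hj), sub_add_eq_add_sub,
        hj₂ j (le_trans (le_max_right _ _) hj), sub_zero]
    have h2 : ∀ j : ℕ, f m r = f (m + j) (r - j) := by
      intro j
      induction j with
      | zero => simp
      | succ j ihj =>
        have := h1 (m + j) (r - j - 1)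
        rw [step, sub_add_cancel, sub_eq_zero] at this
        rw [ihj, ← this]
        congr 1
        · push_cast; ring
        · push_cast; ring
    obtain ⟨j₀, hj₀⟩ := h0 m r
    rw [h2 j₀, hj₀ j₀ le_rfl]

/-- Same propagation along antidiagonals, now in the direction of increasing `r`, where truncation
is uniform in `m`. -/
theorem eq_zero_of_iterate_step_of_trunc {f : ℤ → R → X}
    (h0 : ∀ r : R, ∃ j₀ : ℕ, ∀ j : ℕ, j₀ ≤ j → ∀ m, f m (r + j) = 0) (N : ℕ)
    (h : ∀ m r, step^[N] f m r = 0) (m : ℤ) (r : R) : f m r = 0 := by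
  induction N generalizing f m r with
  | zero => exact h m r
  | succ N ih =>
    have h1 : ∀ m r, step f m r = 0 := by
      refine ih (fun r => ?_) h
      obtain ⟨j₁, hj₁⟩ := h0 r
      refine ⟨j₁, fun j hj m => ?_⟩
      have := hj₁ (j + 1) (by omega) m
      rw [step, hj₁ j hj, add_assoc, ← Nat.cast_succ, this, sub_zero]
    have h2 : ∀ j : ℕ, f m r = f (m - j) (r + j) := by
      intro j
      induction j with
      | zero => simp
      | succ j ihj =>
        have := h1 (m - j - 1) (r + j)
        rw [step, sub_add_cancel, sub_eq_zero] at this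
        rw [ihj, this]
        congr 1
        · push_cast; ring
        · push_cast; ring
    obtain ⟨j₀, hj₀⟩ := h0 r
    rw [h2 j₀, hj₀ j₀ le_rfl]

/-- The difference of the shifts in the two variables, on a half-line. -/
def natStep (f : ℕ → R → X) (m : ℕ) (r : R) : X := f (m + 1) r - f m (r + 1)

/-- On a half-line one cannot move to smaller `m` indefinitely, so only vanishing for large `m`
survives. For large `m` the value at `(m + 1, r)` equals that at `(m, r + 1)`, and `r` is pushed up
into the range where `f` is truncated. -/
theorem eventually_eq_zero_of_iterate_natStep {f : ℕ → R → X}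
    (h0 : ∀ r : R, ∃ j₀ : ℕ, ∀ j : ℕ, j₀ ≤ j → ∀ m, f m (r + j) = 0) (N : ℕ)
    (h : ∀ m r, natStep^[N] f m r = 0) (r : R) : ∃ m₀ : ℕ, ∀ m, m₀ ≤ m → f m r = 0 := by
  induction N generalizing f r with
  | zero => exact ⟨0, fun m _ => h m r⟩
  | succ N ih =>
    have h1 : ∀ r, ∃ m₀ : ℕ, ∀ m, m₀ ≤ m → natStep f m r = 0 := by
      intro r
      refine ih (fun r => ?_) h r
      obtain ⟨j₁, hj₁⟩ := h0 r
      refine ⟨j₁, fun j hj m => ?_⟩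
      have := hj₁ (j + 1) (by omega) m
      rw [natStep, hj₁ j hj, add_assoc, ← Nat.cast_succ, this, sub_zero]
    obtain ⟨j₀, hj₀⟩ := h0 r
    have h2 : ∀ j : ℕ, ∀ r, (∀ m, f m (r + j) = 0) → ∃ m₀ : ℕ, ∀ m, m₀ ≤ m → f m r = 0 := by
      intro j
      induction j with
      | zero => exact fun r hr => ⟨0, fun m _ => by simpa using hr m⟩
      | succ j ihj =>
        intro r hr
        obtain ⟨m₁, hm₁⟩ := ihj (r + 1) (fun m => by
          have := hr m
          rwa [Nat.cast_succ, add_comm (j : R) 1, ← add_assoc] at this)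
        obtain ⟨m₂, hm₂⟩ := h1 r
        refine ⟨max m₁ m₂ + 1, fun m hm => ?_⟩
        obtain ⟨k, rfl⟩ : ∃ k, m = k + 1 := ⟨m - 1, by omega⟩
        have h3 := hm₂ k (by omega)
        rw [natStep, hm₁ k (by omega), sub_zero] at h3
        exact h3
    exact h2 j₀ r (hj₀ j₀ le_rfl)

end Step

end DLM

namespace DLM

/-! ### Generalized weights -/

section LinearAlgebra

variable {W₁ W₂ W₃ : Type*} [AddCommGroup W₁] [Module ℂ W₁] [AddCommGroup W₂] [Module ℂ W₂]
  [AddCommGroup W₃] [Module ℂ W₃]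

/-- After subtraction of the eigenvalues, `L₃` acts on `B w u` as a derivation, so `k₁ + k₂`
applications annihilate it. This yields the weights of all modes at once. -/
theorem bilinear_mem_maxGenEigenspace {L₁ : End ℂ W₁} {L₂ : End ℂ W₂} {L₃ : End ℂ W₃}
    (B : W₁ →ₗ[ℂ] W₂ →ₗ[ℂ] W₃) (c : ℂ)
    (h : ∀ w u, L₃ (B w u) = B (L₁ w) u + B w (L₂ u) + c • B w u) {h₁ h₂ h₃ : ℂ}
    (hh : h₃ = h₁ + h₂ + c) {w : W₁} {u : W₂}
    (hw : w ∈ L₁.maxGenEigenspace h₁) (hu : u ∈ L₂.maxGenEigenspace h₂) :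
    B w u ∈ L₃.maxGenEigenspace h₃ := by
  rw [End.mem_maxGenEigenspace] at hw hu ⊢
  obtain ⟨k₁, hk₁⟩ := hw
  obtain ⟨k₂, hk₂⟩ := hu
  have key : ∀ (N k₁ k₂ : ℕ), k₁ + k₂ ≤ N → ∀ w u, ((L₁ - h₁ • (1 : End ℂ W₁)) ^ k₁) w = 0 →
      ((L₂ - h₂ • (1 : End ℂ W₂)) ^ k₂) u = 0 → ((L₃ - h₃ • (1 : End ℂ W₃)) ^ N) (B w u) = 0 := by
    intro N
    induction N with
    | zero =>
      intro k₁ k₂ hN w u hw _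
      obtain rfl : k₁ = 0 := by omega
      rw [pow_zero, End.one_apply] at hw
      simp [hw]
    | succ N ih =>
      intro k₁ k₂ hN w u hw hu
      have e : (L₃ - h₃ • (1 : End ℂ W₃)) (B w u) = B ((L₁ - h₁ • (1 : End ℂ W₁)) w) u +
          B w ((L₂ - h₂ • (1 : End ℂ W₂)) u) := by
        simp only [LinearMap.sub_apply, LinearMap.smul_apply, End.one_apply, map_sub, map_smul, h,
          hh]
        module
      rw [pow_succ, End.mul_apply, e, map_add]
      rcases k₁ with _ | k₁
      · rw [pow_zero, End.one_apply] at hw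
        simp [hw]
      rcases k₂ with _ | k₂
      · rw [pow_zero, End.one_apply] at hu
        simp [hu]
      rw [ih k₁ (k₂ + 1) (by omega) _ _ (by rwa [pow_succ, End.mul_apply] at hw) hu,
        ih (k₁ + 1) k₂ (by omega) _ _ hw (by rwa [pow_succ, End.mul_apply] at hu), add_zero]
  exact ⟨k₁ + k₂, key _ k₁ k₂ le_rfl w u hk₁ hk₂⟩

theorem maxGenEigenspace_eq_bot_of_eigenspace {L : End ℂ W₁} {μ : ℂ} (h : L.eigenspace μ = ⊥) :
    L.maxGenEigenspace μ = ⊥ := by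
  rw [eq_bot_iff]
  intro x hx
  rw [End.mem_maxGenEigenspace] at hx
  obtain ⟨k, hk⟩ := hx
  have h1 : ∀ y, (L - μ • (1 : End ℂ W₁)) y = 0 → y = 0 := by
    intro y hy
    have : y ∈ L.eigenspace μ := by
      rw [End.mem_eigenspace_iff]
      simpa [sub_eq_zero] using hy
    rwa [h, Submodule.mem_bot] at this
  rw [Submodule.mem_bot]
  induction k with
  | zero => simpa using hk
  | succ k ih =>
    rw [pow_succ', End.mul_apply] at hk
    exact ih (h1 _ hk)

/-- Every vector lies in a finite-dimensional invariant subspace, which over `ℂ` decomposes into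
generalized eigenspaces. -/
theorem iSup_maxGenEigenspace_eq_top_of_locallyFinite {L : End ℂ W₁}
    (h : ∀ x : W₁, ∃ U : Submodule ℂ W₁, FiniteDimensional ℂ U ∧ x ∈ U ∧ ∀ y ∈ U, L y ∈ U) :
    ⨆ μ : ℂ, L.maxGenEigenspace μ = ⊤ := by
  rw [eq_top_iff]
  intro x _
  obtain ⟨U, hfin, hx, hU⟩ := h x
  have htop := End.iSup_maxGenEigenspace_eq_top (K := ℂ) (V := U) (L.restrict hU)
  have hmap : ∀ μ, (End.maxGenEigenspace (R := ℂ) (M := U) (L.restrict hU) μ).map U.subtype ≤ L.maxGenEigenspace μ := by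
    rintro μ _ ⟨y, hy, rfl⟩
    rw [SetLike.mem_coe, End.mem_maxGenEigenspace] at hy
    obtain ⟨k, hk⟩ := hy
    rw [End.mem_maxGenEigenspace]
    refine ⟨k, ?_⟩
    have : ∀ k : ℕ, ∀ y : U, ((L - μ • (1 : End ℂ W₁)) ^ k) (U.subtype y) =
        U.subtype ((((show End ℂ U from L.restrict hU) - μ • (1 : End ℂ U)) ^ k) y) := by
      intro k
      induction k with
      | zero => intro y; simp
      | succ k ih =>
        intro y
        rw [pow_succ, pow_succ, End.mul_apply, End.mul_apply, ← ih]
        rfl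
    rw [this, hk, map_zero]
  have hx' : U.subtype ⟨x, hx⟩ ∈ (⊤ : Submodule ℂ U).map U.subtype :=
    Submodule.mem_map_of_mem trivial
  rw [← htop, Submodule.map_iSup] at hx'
  exact iSup_mono hmap hx'

/-- The projections onto the generalized eigenspaces. -/
theorem exists_maxGenEigenspace_proj {L : End ℂ W₁} (hL : ⨆ μ : ℂ, L.maxGenEigenspace μ = ⊤) :
    ∃ P : ℂ → W₁ →ₗ[ℂ] W₁, (∀ h, ∀ x ∈ L.maxGenEigenspace h, P h x = x) ∧
      (∀ h h', h' ≠ h → ∀ x ∈ L.maxGenEigenspace h', P h x = 0) := by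
  have hcompl : ∀ h, IsCompl (L.maxGenEigenspace h) (⨆ j, ⨆ (_ : j ≠ h), L.maxGenEigenspace j) := by
    intro h
    refine ⟨L.independent_maxGenEigenspace h, codisjoint_iff_le_sup.mpr ?_⟩
    rw [← hL]
    refine iSup_le fun j => ?_
    by_cases hj : j = h
    · subst hj
      exact le_sup_left
    · exact le_trans (le_iSup₂ (f := fun j (_ : j ≠ h) => L.maxGenEigenspace j) j hj) le_sup_right
  refine ⟨fun h => (L.maxGenEigenspace h).subtype ∘ₗ
    Submodule.projectionOnto _ _ (hcompl h), ?_, ?_⟩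
  · intro h x hx
    have := Submodule.projectionOnto_apply_left (hcompl h) ⟨x, hx⟩
    simp only at this
    rw [LinearMap.comp_apply, this]
    rfl
  · intro h h' hne x hx
    have := Submodule.projectionOnto_apply_of_mem_right (hcompl h)
      (Submodule.mem_iSup_of_mem h' (Submodule.mem_iSup_of_mem hne hx))
    rw [LinearMap.comp_apply, this, map_zero]

end LinearAlgebra

section Weights

variable {V : Type v} [AddCommGroup V] [Module ℂ V] {A : VOA V}
variable {W₁ : Type u} [AddCommGroup W₁] [Module ℂ W₁] {Y₁ : WeakModule A W₁}
variable {W₂ : Type u} [AddCommGroup W₂] [Module ℂ W₂] {Y₂ : WeakModule A W₂}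
variable {W₃ : Type u} [AddCommGroup W₃] [Module ℂ W₃] {Y₃ : WeakModule A W₃}

theorem WeakModule.jacobi_sum (Y : WeakModule A W₁) (a b : V) (w : W₁) (l m n : ℤ) :
    assocSum (fun x k => Y.act x (A.mode k a b) w) l m n =
      commSum (fun x y => Y.act x a (Y.act y b w)) l m n -
      (-1 : ℂ) ^ l • commSum (fun x y => Y.act x b (Y.act y a w)) l n m := by
  have h := Y.jacobi a b w l m n
  unfold assocSum commSum
  simp only [Int.cast_id]
  rw [h, smul_finsum]
  simp only [smul_smul, mul_assoc]

theorem IntertwiningOperator.jacobi_sum (I : IntertwiningOperator Y₁ Y₂ Y₃) (a : V) (w : W₁)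
    (u : W₂) (l m : ℤ) (n : ℂ) :
    assocSum (fun x k => I.mode x (Y₁.act k a w) u) l m n =
      commSum (fun x y => Y₃.act x a (I.mode y w u)) l m n -
      (-1 : ℂ) ^ l • commSum (fun x y => I.mode x w (Y₂.act y a u)) l n m := by
  have h := I.jacobi a w u l m n
  unfold assocSum commSum
  simp only [Int.cast_id]
  rw [h, smul_finsum]
  simp only [smul_smul, mul_assoc]

theorem WeakModule.commutator (Y : WeakModule A W₁) (a b : V) (w : W₁) (m n : ℤ) :
    Y.act m a (Y.act n b w) = Y.act n b (Y.act m a w) +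
      assocSum (fun x k => Y.act x (A.mode k a b) w) 0 m n := by
  rw [Y.jacobi_sum, commSum_zero, commSum_zero, zpow_zero, one_smul]
  abel

theorem IntertwiningOperator.commutator (I : IntertwiningOperator Y₁ Y₂ Y₃) (a : V) (w : W₁)
    (u : W₂) (m : ℤ) (n : ℂ) :
    Y₃.act m a (I.mode n w u) = I.mode n w (Y₂.act m a u) +
      assocSum (fun x k => I.mode x (Y₁.act k a w) u) 0 m n := by
  rw [I.jacobi_sum, commSum_zero, commSum_zero, zpow_zero, one_smul]
  abel

theorem WeakModule.act_mem_wt (Y : WeakModule A W₁) {d : ℤ} {a : V} (ha : a ∈ A.grade d) {h : ℂ}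
    {w : W₁} (hw : w ∈ Y.wt h) (n : ℤ) : Y.act n a w ∈ Y.wt (h + d - n - 1) := by
  refine bilinear_mem_maxGenEigenspace (L₁ := A.mode 1 A.conf) (L₂ := Y.L 0) (h₁ := d) (h₂ := h)
    (Y.act n) (-n - 1) (fun b u => ?_) (by ring) ?_ hw
  · have h1 := Y.commutator A.conf b u 1 n
    rw [assocSum_one] at h1
    have h2 := Y.derivative b (1 + n)
    rw [h2] at h1
    change Y.act (0 + 1) A.conf _ = _ + Y.act n b (Y.act (0 + 1) A.conf u) + _
    simp only [zero_add, add_sub_cancel_left] at h1 ⊢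
    rw [h1]
    simp only [LinearMap.smul_apply]
    push_cast
    module
  · exact End.eigenspace_le_maxGenEigenspace (End.mem_eigenspace_iff.mpr (A.grade_eq d a ha))

theorem IntertwiningOperator.mode_mem_wt (I : IntertwiningOperator Y₁ Y₂ Y₃) {h₁ h₂ : ℂ} {w : W₁}
    {u : W₂} (hw : w ∈ Y₁.wt h₁) (hu : u ∈ Y₂.wt h₂) (n : ℂ) :
    I.mode n w u ∈ Y₃.wt (h₁ + h₂ - n - 1) := by
  refine bilinear_mem_maxGenEigenspace (L₁ := Y₁.L 0) (L₂ := Y₂.L 0) (h₁ := h₁) (h₂ := h₂)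
    (I.mode n) (-n - 1) (fun b u => ?_) (by ring) hw hu
  have h1 := I.commutator A.conf b u 1 n
  rw [assocSum_one] at h1
  have h2 := I.derivative b (1 + n)
  change I.mode (1 + n) (Y₁.act (-1 + 1) A.conf b) = _ at h2
  simp only [Int.reduceNeg, neg_add_cancel] at h2
  rw [h2] at h1
  change Y₃.act (0 + 1) A.conf _ = I.mode n (Y₁.act (0 + 1) A.conf b) u +
    I.mode n b (Y₂.act (0 + 1) A.conf u) + _
  simp only [zero_add, add_sub_cancel_left] at h1 ⊢
  rw [h1]
  simp only [LinearMap.smul_apply]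
  module

/-- The weak module is the sum of its generalized weight spaces. -/
def WeakModule.Spanned (Y : WeakModule A W₁) : Prop := ⨆ h : ℂ, Y.wt h = ⊤

/-- In every coset of `ℤ` the generalized weights are bounded below. -/
def WeakModule.LowerTrunc (Y : WeakModule A W₁) : Prop :=
  ∀ h : ℂ, ∃ N : ℤ, ∀ n : ℤ, n ≤ N → Y.wt (h + n) = ⊥

theorem VCat.Mem.spanned {D : VCat} (h : D.Mem Y₁) : Y₁.Spanned := by
  cases D with
  | C =>
    obtain ⟨h1, -, -⟩ := h
    rw [WeakModule.Spanned, eq_top_iff]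
    rw [h1]
    exact iSup_mono fun μ => inf_le_left.trans End.eigenspace_le_maxGenEigenspace
  | C1 =>
    obtain ⟨h1, -⟩ := h
    refine iSup_maxGenEigenspace_eq_top_of_locallyFinite fun x => ?_
    obtain ⟨U, -, hU⟩ := h1 x trivial
    exact ⟨U, hU⟩

theorem VCat.Mem.lowerTrunc {D : VCat} (h : D.Mem Y₁) : Y₁.LowerTrunc := by
  cases D with
  | C =>
    obtain ⟨-, -, h3⟩ := h
    intro μ
    obtain ⟨N, hN⟩ := h3 μ
    refine ⟨N, fun n hn => maxGenEigenspace_eq_bot_of_eigenspace ?_⟩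
    simpa using hN n hn
  | C1 =>
    obtain ⟨-, S, hS⟩ := h
    intro μ
    -- The sum of the absolute values dominates each one, so this integer is below `Re (s - μ)` for
    -- every `s` in `S` at once.
    refine ⟨⌊-∑ s ∈ S, |(s - μ).re|⌋ - 1, fun n hn => ?_⟩
    rw [eq_bot_iff]
    intro x hx
    by_contra hx0
    obtain ⟨k, hk⟩ := (End.mem_maxGenEigenspace _ _ _).mp hx
    obtain ⟨s, hs, j, hj⟩ := hS (μ + n) ⟨x, trivial, hx0, k, by
      rwa [Algebra.algebraMap_eq_smul_one]⟩
    have h1 : |(s - μ).re| ≤ ∑ s ∈ S, |(s - μ).re| :=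
      Finset.single_le_sum (f := fun s : ℂ => |(s - μ).re|) (fun _ _ => abs_nonneg _) hs
    have h2 : (n : ℝ) = (s - μ).re + j := by
      have := congrArg Complex.re hj
      simp only [Complex.add_re, Complex.intCast_re, Complex.natCast_re, Complex.sub_re] at this ⊢
      linarith
    have h3 : (n : ℝ) ≤ ⌊-∑ s ∈ S, |(s - μ).re|⌋ - 1 := by exact_mod_cast hn
    have h4 := Int.floor_le (-∑ s ∈ S, |(s - μ).re|)
    have h5 := neg_abs_le (s - μ).re
    have h6 : (0 : ℝ) ≤ j := Nat.cast_nonneg j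
    linarith

theorem WeakModule.Spanned.induction (hY : Y₁.Spanned) {p : W₁ → Prop}
    (hmem : ∀ h, ∀ w ∈ Y₁.wt h, p w)
    (hadd : ∀ x y, p x → p y → p (x + y)) (w : W₁) : p w := by
  have hw : w ∈ ⨆ h : ℂ, Y₁.wt h := by
    rw [hY]; trivial
  exact Submodule.iSup_induction _ (motive := p) hw hmem (hmem 0 0 (Submodule.zero_mem _)) hadd

theorem VOA.grade_induction {p : V → Prop} (hmem : ∀ d, ∀ a ∈ A.grade d, p a)
    (hadd : ∀ x y, p x → p y → p (x + y)) (a : V) : p a := by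
  have ha : a ∈ ⨆ d, A.grade d := by
    rw [A.decomposition.submodule_iSup_eq_top]; trivial
  exact Submodule.iSup_induction _ (motive := p) ha hmem (hmem 0 0 (Submodule.zero_mem _)) hadd

/-- A chosen system of projections onto the generalized weight spaces. -/
noncomputable def WeakModule.Spanned.proj (hY : Y₁.Spanned) : ℂ → W₁ →ₗ[ℂ] W₁ :=
  (exists_maxGenEigenspace_proj hY).choose

namespace WeakModule.Spanned

theorem proj_of_mem (hY : Y₁.Spanned) {h : ℂ} {x : W₁} (hx : x ∈ Y₁.wt h) : hY.proj h x = x :=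
  (exists_maxGenEigenspace_proj hY).choose_spec.1 h x hx

theorem proj_of_ne (hY : Y₁.Spanned) {h h' : ℂ} (hne : h' ≠ h) {x : W₁} (hx : x ∈ Y₁.wt h') :
    hY.proj h x = 0 :=
  (exists_maxGenEigenspace_proj hY).choose_spec.2 h h' hne x hx

theorem proj_mem (hY : Y₁.Spanned) (h : ℂ) (x : W₁) : hY.proj h x ∈ Y₁.wt h := by
  refine hY.induction (p := fun x => hY.proj h x ∈ Y₁.wt h) (fun h' w hw => ?_)
    (fun x y hx hy => ?_) x
  · by_cases hh : h' = h
    · subst hh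
      rwa [hY.proj_of_mem hw]
    · rw [hY.proj_of_ne hh hw]
      exact Submodule.zero_mem _
  · rw [map_add]
    exact Submodule.add_mem _ hx hy

theorem exists_sum_proj (hY : Y₁.Spanned) (x : W₁) :
    ∃ s : Finset ℂ, ∀ t, s ⊆ t → ∑ h ∈ t, hY.proj h x = x := by
  classical
  refine hY.induction (p := fun x => ∃ s : Finset ℂ, ∀ t, s ⊆ t → ∑ h ∈ t, hY.proj h x = x)
    (fun h w hw => ?_) (fun x y hx hy => ?_) x
  · refine ⟨{h}, fun t ht => ?_⟩
    rw [Finset.sum_eq_single h, hY.proj_of_mem hw]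
    · exact fun j _ hj => hY.proj_of_ne hj.symm hw
    · exact fun hn => absurd (ht (Finset.mem_singleton_self h)) hn
  · obtain ⟨s, hs⟩ := hx
    obtain ⟨s', hs'⟩ := hy
    refine ⟨s ∪ s', fun t ht => ?_⟩
    simp only [map_add, Finset.sum_add_distrib]
    rw [hs t (Finset.union_subset_left ht), hs' t (Finset.union_subset_right ht)]

theorem dualHomogeneous_comp_proj (hY : Y₁.Spanned) (f : Dual ℂ W₁) (h : ℂ) :
    Y₁.DualHomogeneous h (f ∘ₗ hY.proj h) := by
  intro h' hne w hw
  rw [LinearMap.comp_apply, hY.proj_of_ne hne hw, map_zero]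

theorem _root_.DLM.WeakModule.DualHomogeneous.memDual {h : ℂ} {w' : Dual ℂ W₁}
    (hw : Y₁.DualHomogeneous h w') : Y₁.MemDual w' := by
  refine (Set.finite_singleton h).subset ?_
  rintro h' ⟨w, hw1, hw2⟩
  by_contra hne
  exact hw2 (hw h' hne w hw1)

theorem dualHomogeneous_apply_proj (hY : Y₁.Spanned) {h : ℂ} {w' : Dual ℂ W₁}
    (hw : Y₁.DualHomogeneous h w') (x : W₁) : w' (hY.proj h x) = w' x := by
  refine hY.induction (p := fun x => w' (hY.proj h x) = w' x) (fun h' w hw' => ?_)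
    (fun x y hx hy => ?_) x
  · by_cases hh : h' = h
    · subst hh
      rw [hY.proj_of_mem hw']
    · rw [hY.proj_of_ne hh hw', map_zero, hw h' hh w hw']
  · rw [map_add, map_add, map_add, hx, hy]

/-- Homogeneous functionals separate points. -/
theorem eq_zero_of_dual (hY : Y₁.Spanned) {x : W₁}
    (h : ∀ (μ : ℂ) (w' : Dual ℂ W₁), Y₁.DualHomogeneous μ w' → w' x = 0) : x = 0 := by
  have h0 : ∀ μ, hY.proj μ x = 0 := by
    intro μ
    rw [← Module.forall_dual_apply_eq_zero_iff ℂ]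
    intro f
    exact h μ _ (hY.dualHomogeneous_comp_proj f μ)
  obtain ⟨s, hs⟩ := hY.exists_sum_proj x
  rw [← hs s subset_rfl]
  exact Finset.sum_eq_zero fun μ _ => h0 μ

theorem eq_of_memDual (hY : Y₁.Spanned) {x y : W₁}
    (h : ∀ w' : Dual ℂ W₁, Y₁.MemDual w' → w' x = w' y) : x = y := by
  rw [← sub_eq_zero]
  refine hY.eq_zero_of_dual fun μ w' hw' => ?_
  rw [map_sub, h w' hw'.memDual, sub_self]

theorem dual_eq_sum (hY : Y₁.Spanned) {w' : Dual ℂ W₁} (hw : Y₁.MemDual w') :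
    w' = ∑ h ∈ hw.toFinset, w' ∘ₗ hY.proj h := by
  ext x
  rw [LinearMap.sum_apply]
  refine hY.induction (p := fun x => w' x = ∑ h ∈ hw.toFinset, (w' ∘ₗ hY.proj h) x)
    (fun h' w hw' => ?_) (fun x y hx hy => ?_) x
  · by_cases h0 : w' w = 0
    · rw [h0, Finset.sum_eq_zero]
      intro j _
      by_cases hj : h' = j
      · subst hj
        rw [LinearMap.comp_apply, hY.proj_of_mem hw', h0]
      · rw [LinearMap.comp_apply, hY.proj_of_ne hj hw', map_zero]
    · rw [Finset.sum_eq_single h', LinearMap.comp_apply, hY.proj_of_mem hw']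
      · intro j _ hj
        rw [LinearMap.comp_apply, hY.proj_of_ne hj.symm hw', map_zero]
      · intro hn
        exact absurd (hw.mem_toFinset.mpr ⟨w, hw', h0⟩) hn
  · simp only [map_add, Finset.sum_add_distrib, hx, hy]

/-- Induction on an element of the restricted dual. -/
theorem dual_induction (hY : Y₁.Spanned) {p : Dual ℂ W₁ → Prop}
    (hmem : ∀ h w', Y₁.DualHomogeneous h w' → p w') (hadd : ∀ x y, p x → p y → p (x + y))
    {w' : Dual ℂ W₁} (hw : Y₁.MemDual w') : p w' := by
  rw [hY.dual_eq_sum hw]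
  refine Finset.sum_induction _ p hadd (hmem 0 0 fun _ _ _ _ => rfl) fun h _ => ?_
  exact hmem h _ (hY.dualHomogeneous_comp_proj w' h)

end WeakModule.Spanned

theorem WeakModule.MemDual.add {w₁ w₂ : Dual ℂ W₁} (h₁ : Y₁.MemDual w₁) (h₂ : Y₁.MemDual w₂) :
    Y₁.MemDual (w₁ + w₂) := by
  refine (h₁.union h₂).subset ?_
  rintro h ⟨w, hw, hne⟩
  by_cases h0 : w₁ w = 0
  · exact Or.inr ⟨w, hw, by simpa [h0] using hne⟩
  · exact Or.inl ⟨w, hw, h0⟩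

theorem WeakModule.MemDual.comp_act {w' : Dual ℂ W₁} (hw : Y₁.MemDual w') (k : ℤ) (a : V) :
    Y₁.MemDual (w' ∘ₗ Y₁.act k a) := by
  refine VOA.grade_induction (A := A) (p := fun a => Y₁.MemDual (w' ∘ₗ Y₁.act k a))
    (fun d a ha => ?_) (fun x y hx hy => ?_) a
  · refine (Set.Finite.preimage (s := {h : ℂ | ∃ w ∈ Y₁.wt h, w' w ≠ 0}) (f := fun h : ℂ => h + (d : ℂ) - (k : ℂ) - 1) ?_ hw).subset ?_
    · intro x _ y _ hxy
      simpa using hxy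
    · rintro h ⟨w, hw1, hw2⟩
      exact ⟨_, Y₁.act_mem_wt ha hw1 k, hw2⟩
  · rw [map_add, LinearMap.comp_add]
    exact hx.add hy

/-- A vector that `w' ∘ a_k` detects has weight `μ - d + 1 + k` for one of the finitely many weights
`μ` seen by `w'`, and such weight spaces are zero for `k` very negative. This makes the sums over
`a_k` with decreasing `k` finite after pairing with `w'`. -/
theorem WeakModule.MemDual.exists_lower_bound (hY : Y₁.Spanned) (hY' : Y₁.LowerTrunc)
    {w' : Dual ℂ W₁} (hw : Y₁.MemDual w') (a : V) :
    ∃ K : ℤ, ∀ k, k ≤ K → ∀ x, w' (Y₁.act k a x) = 0 := by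
  refine VOA.grade_induction (A := A) (p := fun a => ∃ K : ℤ, ∀ k, k ≤ K → ∀ x,
    w' (Y₁.act k a x) = 0) (fun d a ha => ?_) (fun x y hx hy => ?_) a
  · have h1 : ∀ᶠ k : ℤ in Filter.atBot, ∀ μ ∈ {h : ℂ | ∃ w ∈ Y₁.wt h, w' w ≠ 0},
        Y₁.wt (μ - d + 1 + k) = ⊥ := by
      rw [Filter.eventually_all_finite hw]
      intro μ _
      rw [Filter.eventually_atBot]
      exact hY' _
    obtain ⟨K, hK⟩ := Filter.eventually_atBot.mp h1
    refine ⟨K, fun k hk x => ?_⟩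
    refine hY.induction (p := fun x => w' (Y₁.act k a x) = 0) (fun h w hw1 => ?_)
      (fun x y hx hy => by rw [map_add, map_add, hx, hy, add_zero]) x
    by_contra hne
    have h2 := hK k hk (h + d - k - 1) ⟨_, Y₁.act_mem_wt ha hw1 k, hne⟩
    rw [show h + d - k - 1 - d + 1 + (k : ℂ) = h by ring] at h2
    rw [h2, Submodule.mem_bot] at hw1
    rw [hw1, map_zero, map_zero] at hne
    exact hne rfl
  · obtain ⟨K₁, h₁⟩ := hx
    obtain ⟨K₂, h₂⟩ := hy
    refine ⟨min K₁ K₂, fun k hk z => ?_⟩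
    rw [map_add, LinearMap.add_apply, map_add, h₁ k (le_trans hk (min_le_left _ _)),
      h₂ k (le_trans hk (min_le_right _ _)), add_zero]

end Weights

end DLM

/-! ### Existence of the operators `φ_n` -/

namespace DLM

/-- On a maximal independent subfamily a functional can be prescribed with `f (v k) = (c k)⁻¹`.
Summability of the constant `1` then makes the subfamily finite. -/
theorem finiteDimensional_span_of_summable {W : Type*} [AddCommGroup W] [Module ℂ W] {ι : Type*}
    (v : ι → W) (c : ι → ℂ) (hc : ∀ i, c i ≠ 0)
    (h : ∀ f : Dual ℂ W, Summable fun i => f (v i) * c i) :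
    FiniteDimensional ℂ (Submodule.span ℂ (Set.range v)) := by
  obtain ⟨κ, a, ha, hspan, hli⟩ := exists_linearIndependent' ℂ v
  rw [← hspan]
  have hfin : Finite κ := by
    let b := Basis.extend hli.linearIndepOn_id
    let f : Dual ℂ W := b.constr ℂ fun x => ∑ᶠ k : κ, open Classical in
      if v (a k) = x then (c (a k))⁻¹ else 0
    have hf : ∀ k, f (v (a k)) * c (a k) = 1 := by
      intro k
      have hmem : v (a k) ∈ hli.linearIndepOn_id.extend (Set.subset_univ _) :=
        Basis.subset_extend hli.linearIndepOn_id ⟨k, rfl⟩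
      have hb : b ⟨v (a k), hmem⟩ = v (a k) := Basis.extend_apply_self _ _
      have : f (b ⟨v (a k), hmem⟩) = (c (a k))⁻¹ := by
        rw [Basis.constr_basis, finsum_eq_single _ k]
        · simp
        · intro j hj
          rw [if_neg]
          exact fun he => hj (hli.injective he)
      rw [hb] at this
      rw [this, inv_mul_cancel₀ (hc _)]
    have hs := (h f).comp_injective ha
    have h1 : (fun k => f (v (a k)) * c (a k)) = fun _ => (1 : ℂ) := funext hf
    by_contra hinf
    have : Infinite κ := not_finite_iff_infinite.mp hinf
    rw [Function.comp_def, h1, summable_const_iff] at hs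
    exact one_ne_zero hs
  exact FiniteDimensional.span_of_finite ℂ (Set.finite_range _)

section Phi

variable {V : Type v} [AddCommGroup V] [Module ℂ V] {A : VOA V}
variable {W₁ : Type u} [AddCommGroup W₁] [Module ℂ W₁] {Y₁ : WeakModule A W₁}
variable {W₂ : Type u} [AddCommGroup W₂] [Module ℂ W₂] {Y₂ : WeakModule A W₂}
variable {W₃ : Type u} [AddCommGroup W₃] [Module ℂ W₃] {Y₃ : WeakModule A W₃}
variable {W₄ : Type u} [AddCommGroup W₄] [Module ℂ W₄] {Y₄ : WeakModule A W₄}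
variable {W₅ : Type u} [AddCommGroup W₅] [Module ℂ W₅] {Y₅ : WeakModule A W₅}

/-- The matrix coefficients of an iterate, indexed by modes. -/
def iterModes (F : IntertwiningOperator Y₁ Y₂ Y₅) (G : IntertwiningOperator Y₅ Y₃ Y₄)
    (w' : Dual ℂ W₄) (w₁ : W₁) (w₂ : W₂) (w₃ : W₃) (p n : ℂ) : ℂ :=
  w' (G.mode n (F.mode p w₁ w₂) w₃)

/-- The vector `v` is the coefficient of `z₁^{-r-1} z₂^{-n-1}` in `E¹²` of the iterate. -/
def IsCoeff (F : IntertwiningOperator Y₁ Y₂ Y₅) (G : IntertwiningOperator Y₅ Y₃ Y₄)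
    (w₁ : W₁) (w₂ : W₂) (w₃ : W₃) (r n : ℂ) (v : W₄) : Prop :=
  ∀ w' : Dual ℂ W₄, Y₄.MemDual w' →
    ∃ β, ModeE12 (iterModes F G w' w₁ w₂ w₃) β ∧ w' v = β r n

variable {F : IntertwiningOperator Y₁ Y₂ Y₅} {G : IntertwiningOperator Y₅ Y₃ Y₄}

theorem IsCoeff.unique (h₄ : Y₄.Spanned) {w₁ : W₁} {w₂ : W₂} {w₃ : W₃} {r n : ℂ} {v v' : W₄}
    (h : IsCoeff F G w₁ w₂ w₃ r n v) (h' : IsCoeff F G w₁ w₂ w₃ r n v') : v = v' := by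
  refine h₄.eq_of_memDual fun w' hw' => ?_
  obtain ⟨β, hβ, e⟩ := h w' hw'
  obtain ⟨β', hβ', e'⟩ := h' w' hw'
  rw [e, e', hβ.unique hβ']

theorem IsCoeff.lin {w₁ x₁ y₁ : W₁} {w₂ x₂ y₂ : W₂} {w₃ x₃ y₃ : W₃} {r n : ℂ} {v x : W₄}
    (h : IsCoeff F G w₁ w₂ w₃ r n v) (h' : IsCoeff F G x₁ x₂ x₃ r n x) (c d : ℂ)
    (he : ∀ w' p n, iterModes F G w' y₁ y₂ y₃ p n =
      c * iterModes F G w' w₁ w₂ w₃ p n + d * iterModes F G w' x₁ x₂ x₃ p n) :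
    IsCoeff F G y₁ y₂ y₃ r n (c • v + d • x) := by
  intro w' hw'
  obtain ⟨β, hβ, e⟩ := h w' hw'
  obtain ⟨β', hβ', e'⟩ := h' w' hw'
  refine ⟨_, ((hβ.const_mul c).add (hβ'.const_mul d)).congr (fun p n => (he w' p n).symm)
    (fun _ _ => rfl), ?_⟩
  rw [map_add, map_smul, map_smul, e, e', smul_eq_mul, smul_eq_mul]

theorem iterModes_support {h₁ h₂ h₃ μ : ℂ} {w₁ : W₁} {w₂ : W₂} {w₃ : W₃} (hw₁ : w₁ ∈ Y₁.wt h₁)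
    (hw₂ : w₂ ∈ Y₂.wt h₂) (hw₃ : w₃ ∈ Y₃.wt h₃) {w' : Dual ℂ W₄} (hw' : Y₄.DualHomogeneous μ w')
    (p n : ℂ) (hne : iterModes F G w' w₁ w₂ w₃ p n ≠ 0) : p + n = h₁ + h₂ + h₃ - 2 - μ := by
  have hmem := G.mode_mem_wt (F.mode_mem_wt hw₁ hw₂ p) hw₃ n
  by_contra hcon
  refine hne (hw' _ (fun he => hcon ?_) _ hmem)
  linear_combination -he

theorem ConvergenceExtensionIterates.exists_modeE12 (hconv : ConvergenceExtensionIterates F G)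
    {h₁ h₂ h₃ μ : ℂ} {w₁ : W₁} {w₂ : W₂} {w₃ : W₃} (hw₁ : w₁ ∈ Y₁.wt h₁)
    (hw₂ : w₂ ∈ Y₂.wt h₂) (hw₃ : w₃ ∈ Y₃.wt h₃) {w' : Dual ℂ W₄} (hw' : Y₄.DualHomogeneous μ w') :
    (∃ β, ModeE12 (iterModes F G w' w₁ w₂ w₃) β) ∧
      ∀ ζ₀ ζ₂ : ℂ, ζ₀.re < ζ₂.re → Summable fun e : ℂ × ℂ =>
        iterModes F G w' w₁ w₂ w₃ (-e.1 - 1) (-e.2 - 1) *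
          Complex.exp (e.1 * ζ₀ + e.2 * ζ₂) := by
  obtain ⟨N, hN⟩ := hconv
  obtain ⟨k, r, s, f, -, hext⟩ := hN h₁ h₂ h₃ μ w₁ hw₁ w₂ hw₂ w₃ hw₃ w' hw'
  refine ⟨⟨_, (ModeE12.of_isE12 ⟨k, r, s, f, hext, rfl⟩).congr (fun p n => ?_) (fun _ _ => rfl)⟩,
    hext.2.1⟩
  rw [iterateSeries, iterModes]
  congr 3
  · ring_nf
  · ring_nf

/-- The coefficients of `E¹²` are given only as numbers depending on `w'`. The components of the
iterate in the relevant weight space span a finite-dimensional `U`, and a linear functional on the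
dual of `U` is evaluation at a vector of `U`. -/
theorem exists_isCoeff_of_homogeneous (hconv : ConvergenceExtensionIterates F G)
    (h₄ : Y₄.Spanned) {h₁ h₂ h₃ : ℂ} {w₁ : W₁} {w₂ : W₂} {w₃ : W₃} (hw₁ : w₁ ∈ Y₁.wt h₁)
    (hw₂ : w₂ ∈ Y₂.wt h₂) (hw₃ : w₃ ∈ Y₃.wt h₃) (r n : ℂ) :
    ∃ v, IsCoeff F G w₁ w₂ w₃ r n v := by
  -- The only weight that the coefficient at `(r, n)` can have, because `E¹²` preserves total
  -- degree.
  set μ : ℂ := h₁ + h₂ + h₃ - 2 - (r + n) with hμ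
  let x : ℂ × ℂ → W₄ := fun e =>
    h₄.proj μ (G.mode (-e.2 - 1) (F.mode (-e.1 - 1) w₁ w₂) w₃)
  have hU : FiniteDimensional ℂ (Submodule.span ℂ (Set.range x)) := by
    refine finiteDimensional_span_of_summable x (fun e => Complex.exp (e.1 * 0 + e.2 * 1))
      (fun e => Complex.exp_ne_zero _) fun f => ?_
    exact (hconv.exists_modeE12 hw₁ hw₂ hw₃ (h₄.dualHomogeneous_comp_proj f μ)).2 0 1 (by simp)
  set U := Submodule.span ℂ (Set.range x) with hUdef
  have hUle : U ≤ Y₄.wt μ := by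
    rw [hUdef, Submodule.span_le]
    rintro _ ⟨e, rfl⟩
    exact h₄.proj_mem μ _
  obtain ⟨g, hg⟩ := U.subtype.exists_leftInverse_of_injective (Submodule.ker_subtype U)
  have hg' : ∀ y : U, g y = y := fun y => LinearMap.congr_fun hg y
  have hext : ∀ f : Dual ℂ U, Y₄.DualHomogeneous μ ((f ∘ₗ g) ∘ₗ h₄.proj μ) := fun f =>
    h₄.dualHomogeneous_comp_proj _ μ
  choose β hβ using fun f : Dual ℂ U => (hconv.exists_modeE12 hw₁ hw₂ hw₃ (hext f)).1
  -- Linearity in the functional is the uniqueness of `E¹²`.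
  let lam : Dual ℂ (Dual ℂ U) :=
    { toFun := fun f => β f r n
      map_add' := fun f f' => (hβ (f + f')).unique
        (((hβ f).add (hβ f')).congr (fun p n => rfl) (fun _ _ => rfl)) r n
      map_smul' := fun c f => (hβ (c • f)).unique
        (((hβ f).const_mul c).congr (fun p n => rfl) (fun _ _ => rfl)) r n }
  obtain ⟨v, hv⟩ := (Module.evalEquiv ℂ U).surjective lam
  have hv' : ∀ f : Dual ℂ U, f v = β f r n := fun f => LinearMap.congr_fun hv f
  refine ⟨v, fun w' hw' => ?_⟩
  refine h₄.dual_induction (p := fun w' => ∃ β, ModeE12 (iterModes F G w' w₁ w₂ w₃) β ∧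
    w' v = β r n) (fun μ' w' hw' => ?_) (fun y y' hy hy' => ?_) hw'
  · by_cases hne : μ = μ'
    · subst hne
      refine ⟨β (w' ∘ₗ U.subtype), (hβ _).congr (fun p n => ?_) (fun _ _ => rfl), ?_⟩
      · have hx : h₄.proj μ (G.mode n (F.mode p w₁ w₂) w₃) ∈ U := by
          refine Submodule.subset_span ⟨(-p - 1, -n - 1), ?_⟩
          simp only [x]
          ring_nf
        have := hg' ⟨_, hx⟩
        simp only [iterModes, LinearMap.comp_apply]
        rw [this]
        exact h₄.dualHomogeneous_apply_proj hw' _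
      · exact hv' (w' ∘ₗ U.subtype)
    -- For a functional of another weight both sides vanish: `v` has weight `μ`, and `β' r n` is
    -- excluded by the total degree.
    · obtain ⟨β', hβ'⟩ := (hconv.exists_modeE12 hw₁ hw₂ hw₃ hw').1
      refine ⟨β', hβ', ?_⟩
      rw [hw' μ hne v (hUle v.2)]
      by_contra h0
      have := hβ'.support (iterModes_support hw₁ hw₂ hw₃ hw') (Ne.symm h0)
      exact hne (by rw [hμ, this]; ring)
  · obtain ⟨β₁, hβ₁, e₁⟩ := hy
    obtain ⟨β₂, hβ₂, e₂⟩ := hy'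
    exact ⟨_, (hβ₁.add hβ₂).congr (fun p n => rfl) (fun _ _ => rfl), by
      rw [LinearMap.add_apply, e₁, e₂]⟩

theorem exists_isCoeff (hconv : ConvergenceExtensionIterates F G) (h₁ : Y₁.Spanned)
    (h₂ : Y₂.Spanned) (h₃ : Y₃.Spanned) (h₄ : Y₄.Spanned) (w₁ : W₁) (w₂ : W₂) (w₃ : W₃) (r n : ℂ) :
    ∃ v, IsCoeff F G w₁ w₂ w₃ r n v := by
  refine h₁.induction (p := fun w₁ => ∃ v, IsCoeff F G w₁ w₂ w₃ r n v) (fun μ₁ w₁ hw₁ => ?_) ?_ w₁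
  · refine h₂.induction (p := fun w₂ => ∃ v, IsCoeff F G w₁ w₂ w₃ r n v) (fun μ₂ w₂ hw₂ => ?_) ?_ w₂
    · refine h₃.induction (p := fun w₃ => ∃ v, IsCoeff F G w₁ w₂ w₃ r n v) (fun μ₃ w₃ hw₃ => ?_) ?_ w₃
      · exact exists_isCoeff_of_homogeneous hconv h₄ hw₁ hw₂ hw₃ r n
      · rintro x y ⟨v, hv⟩ ⟨v', hv'⟩
        exact ⟨_, hv.lin hv' 1 1 fun w' p n => by simp [iterModes]⟩
    · rintro x y ⟨v, hv⟩ ⟨v', hv'⟩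
      exact ⟨_, hv.lin hv' 1 1 fun w' p n => by simp [iterModes]⟩
  · rintro x y ⟨v, hv⟩ ⟨v', hv'⟩
    exact ⟨_, hv.lin hv' 1 1 fun w' p n => by simp [iterModes]⟩

/-- The operator `φ` exists as a family of bilinear maps into `Hom(W₁, W₄){z₁}`. -/
theorem exists_phi (hconv : ConvergenceExtensionIterates F G) (h₁ : Y₁.Spanned)
    (h₂ : Y₂.Spanned) (h₃ : Y₃.Spanned) (h₄ : Y₄.Spanned) :
    ∃ φ : ℂ → W₂ →ₗ[ℂ] W₃ →ₗ[ℂ] (ℂ → W₁ →ₗ[ℂ] W₄),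
      ∀ (w₁ : W₁) (w₂ : W₂) (w₃ : W₃) (w' : Dual ℂ W₄), Y₄.MemDual w' →
        ModeE12 (iterModes F G w' w₁ w₂ w₃) (fun r n => w' (φ n w₂ w₃ r w₁)) := by
  choose c hc using exists_isCoeff hconv h₁ h₂ h₃ h₄
  have add : ∀ {w₁ x₁ y₁ : W₁} {w₂ x₂ y₂ : W₂} {w₃ x₃ y₃ : W₃} (r n : ℂ),
      (∀ w' p n, iterModes F G w' y₁ y₂ y₃ p n =
        iterModes F G w' w₁ w₂ w₃ p n + iterModes F G w' x₁ x₂ x₃ p n) →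
      c y₁ y₂ y₃ r n = c w₁ w₂ w₃ r n + c x₁ x₂ x₃ r n := by
    intro w₁ x₁ y₁ w₂ x₂ y₂ w₃ x₃ y₃ r n h
    have := (hc y₁ y₂ y₃ r n).unique h₄ ((hc w₁ w₂ w₃ r n).lin (hc x₁ x₂ x₃ r n) 1 1
      fun w' p n => by rw [h, one_mul, one_mul])
    simpa using this
  have smul : ∀ {w₁ y₁ : W₁} {w₂ y₂ : W₂} {w₃ y₃ : W₃} (d r n : ℂ),
      (∀ w' p n, iterModes F G w' y₁ y₂ y₃ p n = d * iterModes F G w' w₁ w₂ w₃ p n) →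
      c y₁ y₂ y₃ r n = d • c w₁ w₂ w₃ r n := by
    intro w₁ y₁ w₂ y₂ w₃ y₃ d r n h
    have := (hc y₁ y₂ y₃ r n).unique h₄ ((hc w₁ w₂ w₃ r n).lin (hc w₁ w₂ w₃ r n) d 0
      fun w' p n => by rw [h, zero_mul, add_zero])
    simpa using this
  let Φ : ℂ → W₂ → W₃ → ℂ → W₁ →ₗ[ℂ] W₄ := fun n w₂ w₃ r =>
    { toFun := fun w₁ => c w₁ w₂ w₃ r n
      map_add' := fun x y => add r n fun w' p n => by simp [iterModes]
      map_smul' := fun d x => smul d r n fun w' p n => by simp [iterModes] }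
  refine ⟨fun n => LinearMap.mk₂ ℂ (Φ n) ?_ ?_ ?_ ?_, ?_⟩
  · intro x y w₃
    funext r
    ext w₁
    exact add r n fun w' p n => by simp [iterModes]
  · intro d x w₃
    funext r
    ext w₁
    exact smul d r n fun w' p n => by simp [iterModes]
  · intro w₂ x y
    funext r
    ext w₁
    exact add r n fun w' p n => by simp [iterModes]
  · intro d w₂ x
    funext r
    ext w₁
    exact smul d r n fun w' p n => by simp [iterModes]
  · intro w₁ w₂ w₃ w' hw'
    obtain ⟨β, hβ, -⟩ := hc w₁ w₂ w₃ 0 0 w' hw'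
    refine hβ.congr (fun _ _ => rfl) fun r n => ?_
    obtain ⟨β', hβ', e⟩ := hc w₁ w₂ w₃ r n w' hw'
    rw [hβ.unique hβ']
    exact e.symm

end Phi

end DLM

namespace DLM

/-! ### Sums of the Jacobi identity and `E¹²` -/

namespace ModeE12

theorem assocSum {α β : ℤ → ℂ → ℂ → ℂ} (h : ∀ k, ModeE12 (α k) (β k)) {B : ℤ}
    (hα : ∀ k, B ≤ k → ∀ p n, α k p n = 0) (hβ : ∀ k, B ≤ k → ∀ r n, β k r n = 0) (l m : ℤ) :
    ModeE12 (fun p n => DLM.assocSum (fun x k => α k p x) l m n)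
      (fun r n => DLM.assocSum (fun x k => β k r x) l m n) := by
  have := ModeE12.sum (Finset.range (B - l).toNat) fun i _ =>
    (((h (l + i)).shift_z₂ ((m : ℂ) - i)).const_mul ((Ring.choose m i : ℤ) : ℂ))
  refine this.congr (fun p n => ?_) (fun r n => ?_)
  · rw [assocSum_eq_sum (B := (B - l).toNat) fun i hi => hα _ (by omega) _ _]
    exact Finset.sum_congr rfl fun i _ => by
      rw [smul_eq_mul, show (n : ℂ) + (m - i) = m + n - i by ring]
  · rw [assocSum_eq_sum (B := (B - l).toNat) fun i hi => hβ _ (by omega) _ _]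
    exact Finset.sum_congr rfl fun i _ => by
      rw [smul_eq_mul, show (n : ℂ) + (m - i) = m + n - i by ring]

/-- Here the first index decreases along the sum, so finiteness comes from a bound below. It is
available for `w' ∘ a_k` by `WeakModule.MemDual.exists_lower_bound`. -/
theorem commSum_left {α β : ℤ → ℂ → ℂ → ℂ} (h : ∀ k, ModeE12 (α k) (β k)) {K : ℤ}
    (hα : ∀ k, k ≤ K → ∀ p n, α k p n = 0) (hβ : ∀ k, k ≤ K → ∀ r n, β k r n = 0) (l m : ℤ) :
    ModeE12 (fun p n => commSum (fun x y => α x p y) l m n)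
      (fun r n => commSum (fun x y => β x r y) l m n) := by
  have := ModeE12.sum (Finset.range (m + l - K).toNat) fun i _ =>
    (((h (m + l - i)).shift_z₂ (i : ℂ)).const_mul ((-1 : ℂ) ^ i * ((Ring.choose l i : ℤ) : ℂ)))
  have key : ∀ γ : ℤ → ℂ → ℂ → ℂ, (∀ k, k ≤ K → ∀ p n, γ k p n = 0) → ∀ p n : ℂ,
      ∑ i ∈ Finset.range (m + l - K).toNat,
        (-1 : ℂ) ^ i * ((Ring.choose l i : ℤ) : ℂ) * γ (m + l - i) p (n + i) =
      commSum (fun x y => γ x p y) l m n := fun γ hγ p n =>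
    (commSum_eq_sum (g := fun x y => γ x p y) fun i hi =>
      hγ _ (by simp only [Int.cast_id]; omega) _ _).symm
  exact this.congr (key α hα) (key β hβ)

theorem commSum_right {α β : ℤ → ℂ → ℂ → ℂ} (h : ∀ k, ModeE12 (α k) (β k)) {B : ℤ}
    (hα : ∀ k, B ≤ k → ∀ p n, α k p n = 0) (hβ : ∀ k, B ≤ k → ∀ r n, β k r n = 0) (l m : ℤ) :
    ModeE12 (fun p n => commSum (fun x y => α y p x) l n m)
      (fun r n => commSum (fun x y => β y r x) l n m) := by
  have := ModeE12.sum (Finset.range (B - m).toNat) fun i _ =>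
    (((h (m + i)).shift_z₂ ((l : ℂ) - i)).const_mul ((-1 : ℂ) ^ i * ((Ring.choose l i : ℤ) : ℂ)))
  have key : ∀ γ : ℤ → ℂ → ℂ → ℂ, (∀ k, B ≤ k → ∀ p n, γ k p n = 0) → ∀ p n : ℂ,
      ∑ i ∈ Finset.range (B - m).toNat,
        (-1 : ℂ) ^ i * ((Ring.choose l i : ℤ) : ℂ) * γ (m + i) p (n + (l - i)) =
      commSum (fun x y => γ y p x) l n m := fun γ hγ p n => by
    rw [commSum_eq_sum (g := fun x y => γ y p x) (B := (B - m).toNat) fun i hi =>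
      hγ _ (by omega) _ _]
    simp only [smul_eq_mul, add_sub_assoc]
  exact this.congr (key α hα) (key β hβ)

end ModeE12

theorem assocSum_shift {X R : Type*} [AddCommGroup X] [Module ℂ X] [CommRing R] (g : R → ℤ → X)
    (l m : ℤ) (n : R) : assocSum g (l + 1) m n = assocSum (fun x k => g x (k + 1)) l m n := by
  unfold assocSum
  exact finsum_congr fun i => by rw [add_right_comm]

theorem iterate_step_add {X R S : Type*} [AddCommGroup X] [CommRing R] [CommRing S]
    (f g : S → R → X) (N : ℕ) :
    step^[N] (fun m r => f m r + g m r) = fun m r => step^[N] f m r + step^[N] g m r := by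
  induction N with
  | zero => rfl
  | succ N ih =>
    rw [Function.iterate_succ_apply', Function.iterate_succ_apply', Function.iterate_succ_apply',
      ih]
    funext m r
    simp only [step]
    abel

/-! ### Weights and truncation of `φ` -/

section Phi

variable {V : Type v} [AddCommGroup V] [Module ℂ V] {A : VOA V}
variable {W₁ : Type u} [AddCommGroup W₁] [Module ℂ W₁] {Y₁ : WeakModule A W₁}
variable {W₂ : Type u} [AddCommGroup W₂] [Module ℂ W₂] {Y₂ : WeakModule A W₂}
variable {W₃ : Type u} [AddCommGroup W₃] [Module ℂ W₃] {Y₃ : WeakModule A W₃}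
variable {W₄ : Type u} [AddCommGroup W₄] [Module ℂ W₄] {Y₄ : WeakModule A W₄}
variable {W₅ : Type u} [AddCommGroup W₅] [Module ℂ W₅] {Y₅ : WeakModule A W₅}

theorem rightAction_apply (a : V) (m : ℤ) (Φ : ℂ → W₁ →ₗ[ℂ] W₂) (n : ℂ) (w : W₁) :
    rightAction Y₁ Y₂ a m Φ n w =
      Y₂.act m a (Φ n w) - assocSum (fun x k => Φ x (Y₁.act k a w)) 0 m n := by
  unfold assocSum
  simp only [rightAction, LinearMap.coe_mk, AddHom.coe_mk, zero_add, add_comm (m : ℂ) n]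

theorem WeakModule.Spanned.mem_wt_of_dual (hY : Y₁.Spanned) {h : ℂ} {x : W₁}
    (hx : ∀ (μ : ℂ) (w' : Dual ℂ W₁), μ ≠ h → Y₁.DualHomogeneous μ w' → w' x = 0) :
    x ∈ Y₁.wt h := by
  have : x - hY.proj h x = 0 := by
    refine hY.eq_zero_of_dual fun μ w' hw' => ?_
    by_cases hμ : μ = h
    · subst hμ
      rw [map_sub, hY.dualHomogeneous_apply_proj hw', sub_self]
    · rw [map_sub, hx μ w' hμ hw', hw' h (Ne.symm hμ) _ (hY.proj_mem h x), sub_self]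
  rw [sub_eq_zero] at this
  rw [this]
  exact hY.proj_mem h x

/-- The defining property of `φ`. -/
def PhiSpec (F : IntertwiningOperator Y₁ Y₂ Y₅) (G : IntertwiningOperator Y₅ Y₃ Y₄)
    (φ : ℂ → W₂ →ₗ[ℂ] W₃ →ₗ[ℂ] (ℂ → W₁ →ₗ[ℂ] W₄)) : Prop :=
  ∀ (w₁ : W₁) (w₂ : W₂) (w₃ : W₃) (w' : Dual ℂ W₄), Y₄.MemDual w' →
    ModeE12 (iterModes F G w' w₁ w₂ w₃) (fun r n => w' (φ n w₂ w₃ r w₁))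

/-- The truncation property of `φ`: the exponents of `z₂` are bounded below in terms of weights. -/
def PhiBound (Y₂ : WeakModule A W₂) (Y₃ : WeakModule A W₃)
    (φ : ℂ → W₂ →ₗ[ℂ] W₃ →ₗ[ℂ] (ℂ → W₁ →ₗ[ℂ] W₄)) : Prop :=
  ∃ N : ℤ, ∀ h₂ h₃ : ℂ, ∀ w₂ ∈ Y₂.wt h₂, ∀ w₃ ∈ Y₃.wt h₃, ∀ n : ℂ,
    (h₂ + h₃ - n - 1).re ≤ N → φ n w₂ w₃ = 0

variable {F : IntertwiningOperator Y₁ Y₂ Y₅} {G : IntertwiningOperator Y₅ Y₃ Y₄}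
variable {φ : ℂ → W₂ →ₗ[ℂ] W₃ →ₗ[ℂ] (ℂ → W₁ →ₗ[ℂ] W₄)}

theorem PhiSpec.mem_wt (hφ : PhiSpec F G φ) (h₄ : Y₄.Spanned) {h₁ h₂ h₃ : ℂ} {w₁ : W₁} {w₂ : W₂}
    {w₃ : W₃} (hw₁ : w₁ ∈ Y₁.wt h₁) (hw₂ : w₂ ∈ Y₂.wt h₂) (hw₃ : w₃ ∈ Y₃.wt h₃) (r n : ℂ) :
    φ n w₂ w₃ r w₁ ∈ Y₄.wt (h₁ + h₂ + h₃ - 2 - (r + n)) := by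
  refine h₄.mem_wt_of_dual fun μ w' hμ hw' => ?_
  by_contra hne
  have := (hφ w₁ w₂ w₃ w' hw'.memDual).support (iterModes_support hw₁ hw₂ hw₃ hw') hne
  exact hμ (by rw [this]; ring)

theorem PhiSpec.trunc_z₁ (hφ : PhiSpec F G φ) (h₁ : Y₁.Spanned) (h₂ : Y₂.Spanned)
    (h₃ : Y₃.Spanned) (h₄ : Y₄.Spanned) (h₄' : Y₄.LowerTrunc) (n α : ℂ) (w₂ : W₂) (w₃ : W₃)
    (w₁ : W₁) : ∃ N : ℤ, ∀ k : ℤ, N ≤ k → φ n w₂ w₃ (α + k) w₁ = 0 := by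
  refine h₁.induction (p := fun w₁ => ∃ N : ℤ, ∀ k : ℤ, N ≤ k → φ n w₂ w₃ (α + k) w₁ = 0)
    (fun μ₁ w₁ hw₁ => ?_) ?_ w₁
  · refine h₂.induction (p := fun w₂ => ∃ N : ℤ, ∀ k : ℤ, N ≤ k → φ n w₂ w₃ (α + k) w₁ = 0)
      (fun μ₂ w₂ hw₂ => ?_) ?_ w₂
    · refine h₃.induction (p := fun w₃ => ∃ N : ℤ, ∀ k : ℤ, N ≤ k → φ n w₂ w₃ (α + k) w₁ = 0)
        (fun μ₃ w₃ hw₃ => ?_) ?_ w₃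
      · obtain ⟨N, hN⟩ := h₄' (μ₁ + μ₂ + μ₃ - 2 - (α + n))
        refine ⟨-N, fun k hk => ?_⟩
        have hm := hφ.mem_wt h₄ hw₁ hw₂ hw₃ (α + k) n
        rw [show μ₁ + μ₂ + μ₃ - 2 - (α + k + n) = μ₁ + μ₂ + μ₃ - 2 - (α + n) + ((-k : ℤ) : ℂ) by
          push_cast; ring, hN (-k) (by omega), Submodule.mem_bot] at hm
        exact hm
      · rintro x y ⟨N, hN⟩ ⟨N', hN'⟩
        exact ⟨max N N', fun k hk => by
          rw [map_add, Pi.add_apply, LinearMap.add_apply, hN k (le_trans (le_max_left _ _) hk),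
            hN' k (le_trans (le_max_right _ _) hk), add_zero]⟩
    · rintro x y ⟨N, hN⟩ ⟨N', hN'⟩
      exact ⟨max N N', fun k hk => by
        rw [map_add, LinearMap.add_apply, Pi.add_apply, LinearMap.add_apply,
          hN k (le_trans (le_max_left _ _) hk), hN' k (le_trans (le_max_right _ _) hk), add_zero]⟩
  · rintro x y ⟨N, hN⟩ ⟨N', hN'⟩
    exact ⟨max N N', fun k hk => by
      rw [map_add, hN k (le_trans (le_max_left _ _) hk),
        hN' k (le_trans (le_max_right _ _) hk), add_zero]⟩

/-- The exponents of `z₂` in the expansion are `s_i + j` with `j ≥ 0`. The bound on `Re s_i` depends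
on neither `w₁` nor `w'`, so the whole operator `φ_n(w₂,w₃)` vanishes. -/
theorem PhiSpec.phiBound (hφ : PhiSpec F G φ) (hconv : ConvergenceExtensionIterates F G)
    (h₁ : Y₁.Spanned) (h₄ : Y₄.Spanned) : PhiBound Y₂ Y₃ φ := by
  obtain ⟨N, hN⟩ := hconv
  refine ⟨N, fun h₂ h₃ w₂ hw₂ w₃ hw₃ n hn => ?_⟩
  funext r
  ext w₁
  refine h₁.induction (p := fun w₁ => φ n w₂ w₃ r w₁ = 0) (fun μ₁ w₁ hw₁ => ?_)
    (fun x y hx hy => by rw [map_add, hx, hy, add_zero]) w₁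
  refine h₄.eq_zero_of_dual fun μ w' hw' => ?_
  obtain ⟨k, ρ, s, f, hs, hext⟩ := hN μ₁ h₂ h₃ μ w₁ hw₁ w₂ hw₂ w₃ hw₃ w' hw'
  have h1 : ModeE12 (iterModes F G w' w₁ w₂ w₃)
      (fun r n => expansion ρ s f (-r - 1) (-n - 1)) := by
    refine (ModeE12.of_isE12 ⟨k, ρ, s, f, hext, rfl⟩).congr (fun p n => ?_) (fun _ _ => rfl)
    rw [iterateSeries, iterModes]
    congr 3
    · ring_nf
    · ring_nf
  rw [(hφ w₁ w₂ w₃ w' hw'.memDual).unique h1 r n, expansion_eq_sum]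
  refine Finset.sum_eq_zero fun i _ => expTerm_eq_zero fun j _ hj => ?_
  have h2 := hs i
  rw [show h₂ + h₃ - n - 1 = h₂ + h₃ + s i + j by linear_combination hj, Complex.add_re,
    Complex.natCast_re] at hn
  have : (0 : ℝ) ≤ j := Nat.cast_nonneg j
  linarith

theorem PhiBound.trunc (hb : PhiBound Y₂ Y₃ φ) (h₂ : Y₂.Spanned) (h₃ : Y₃.Spanned) (α : ℂ)
    (w₂ : W₂) (w₃ : W₃) : ∃ N : ℤ, ∀ k : ℤ, N ≤ k → φ (α + k) w₂ w₃ = 0 := by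
  obtain ⟨N, hN⟩ := hb
  refine h₂.induction (p := fun w₂ => ∃ N : ℤ, ∀ k : ℤ, N ≤ k → φ (α + k) w₂ w₃ = 0)
    (fun μ₂ w₂ hw₂ => ?_) ?_ w₂
  · refine h₃.induction (p := fun w₃ => ∃ N : ℤ, ∀ k : ℤ, N ≤ k → φ (α + k) w₂ w₃ = 0)
      (fun μ₃ w₃ hw₃ => ?_) ?_ w₃
    · refine ⟨⌈(μ₂ + μ₃ - α - 1).re - N⌉, fun k hk => hN μ₂ μ₃ w₂ hw₂ w₃ hw₃ _ ?_⟩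
      have h1 : (μ₂ + μ₃ - α - 1).re - N ≤ k := Int.ceil_le.mp hk
      simp only [Complex.sub_re, Complex.add_re, Complex.one_re, Complex.intCast_re] at h1 ⊢
      linarith
    · rintro x y ⟨N, hN⟩ ⟨N', hN'⟩
      exact ⟨max N N', fun k hk => by
        rw [map_add, hN k (le_trans (le_max_left _ _) hk),
          hN' k (le_trans (le_max_right _ _) hk), add_zero]⟩
  · rintro x y ⟨N, hN⟩ ⟨N', hN'⟩
    exact ⟨max N N', fun k hk => by
      rw [map_add, LinearMap.add_apply, hN k (le_trans (le_max_left _ _) hk),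
        hN' k (le_trans (le_max_right _ _) hk), add_zero]⟩

/-- The bound involves only weights, and `a_k` lowers the weight as `k` grows. Hence the truncation
depends only on `i + k`, which is the uniformity needed along the sums of the Jacobi identity. -/
theorem PhiBound.trunc_act (hb : PhiBound Y₂ Y₃ φ) (h₂ : Y₂.Spanned) (h₃ : Y₃.Spanned) (α : ℂ)
    (a : V) (w₂ : W₂) (w₃ : W₃) :
    ∃ N : ℤ, ∀ i k : ℤ, N ≤ i + k → φ (α + i) w₂ (Y₃.act k a w₃) = 0 := by
  obtain ⟨N, hN⟩ := hb
  refine VOA.grade_induction (A := A) (p := fun a =>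
    ∃ N : ℤ, ∀ i k : ℤ, N ≤ i + k → φ (α + i) w₂ (Y₃.act k a w₃) = 0) (fun d a ha => ?_) ?_ a
  · refine h₂.induction (p := fun w₂ =>
      ∃ N : ℤ, ∀ i k : ℤ, N ≤ i + k → φ (α + i) w₂ (Y₃.act k a w₃) = 0) (fun μ₂ w₂ hw₂ => ?_) ?_ w₂
    · refine h₃.induction (p := fun w₃ =>
        ∃ N : ℤ, ∀ i k : ℤ, N ≤ i + k → φ (α + i) w₂ (Y₃.act k a w₃) = 0)
        (fun μ₃ w₃ hw₃ => ?_) ?_ w₃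
      · refine ⟨⌈(μ₂ + μ₃ + d - α - 2).re - N⌉, fun i k hk =>
          hN μ₂ _ w₂ hw₂ _ (Y₃.act_mem_wt ha hw₃ k) _ ?_⟩
        have h1 : (μ₂ + μ₃ + d - α - 2).re - N ≤ ((i + k : ℤ) : ℝ) := Int.ceil_le.mp hk
        simp only [Complex.sub_re, Complex.add_re, Complex.one_re, Complex.intCast_re,
          Complex.re_ofNat, Int.cast_add] at h1 ⊢
        linarith
      · rintro x y ⟨N, hN⟩ ⟨N', hN'⟩
        exact ⟨max N N', fun i k hk => by
          rw [map_add, map_add, hN i k (le_trans (le_max_left _ _) hk),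
            hN' i k (le_trans (le_max_right _ _) hk), add_zero]⟩
    · rintro x y ⟨N, hN⟩ ⟨N', hN'⟩
      exact ⟨max N N', fun i k hk => by
        rw [map_add, LinearMap.add_apply, hN i k (le_trans (le_max_left _ _) hk),
          hN' i k (le_trans (le_max_right _ _) hk), add_zero]⟩
  · rintro x y ⟨N, hN⟩ ⟨N', hN'⟩
    exact ⟨max N N', fun i k hk => by
      rw [map_add, LinearMap.add_apply, map_add, hN i k (le_trans (le_max_left _ _) hk),
        hN' i k (le_trans (le_max_right _ _) hk), add_zero]⟩

end Phi

end DLM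

/-! ### Commutator formula and Jacobi identity for `φ` -/

namespace DLM

section Phi

variable {V : Type v} [AddCommGroup V] [Module ℂ V] {A : VOA V}
variable {W₁ : Type u} [AddCommGroup W₁] [Module ℂ W₁] {Y₁ : WeakModule A W₁}
variable {W₂ : Type u} [AddCommGroup W₂] [Module ℂ W₂] {Y₂ : WeakModule A W₂}
variable {W₃ : Type u} [AddCommGroup W₃] [Module ℂ W₃] {Y₃ : WeakModule A W₃}
variable {W₄ : Type u} [AddCommGroup W₄] [Module ℂ W₄] {Y₄ : WeakModule A W₄}
variable {W₅ : Type u} [AddCommGroup W₅] [Module ℂ W₅] {Y₅ : WeakModule A W₅}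
variable {F : IntertwiningOperator Y₁ Y₂ Y₅} {G : IntertwiningOperator Y₅ Y₃ Y₄}
variable {φ : ℂ → W₂ →ₗ[ℂ] W₃ →ₗ[ℂ] (ℂ → W₁ →ₗ[ℂ] W₄)}

/-- Evaluation of an operator at `w₁`, followed by the coefficient of `z₁^{-r-1}` and a
functional. -/
def coeffEval (w' : Dual ℂ W₄) (r : ℂ) (w₁ : W₁) : (ℂ → W₁ →ₗ[ℂ] W₄) →ₗ[ℂ] ℂ where
  toFun Φ := w' (Φ r w₁)
  map_add' _ _ := by simp
  map_smul' _ _ := by simp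

theorem coeffEval_apply (w' : Dual ℂ W₄) (r : ℂ) (w₁ : W₁) (Φ : ℂ → W₁ →ₗ[ℂ] W₄) :
    coeffEval w' r w₁ Φ = w' (Φ r w₁) := rfl

/-- The modes of `a` acting on `w₁` in `F(w₁, z₀)w₂`, weighted by `z₀^N` and powers of `z₀ + x`. -/
noncomputable def leftSum (F : IntertwiningOperator Y₁ Y₂ Y₅) (a : V) (w₁ : W₁) (w₂ : W₂) (N k : ℤ)
    (p : ℂ) : W₅ :=
  assocSum (fun y j => F.mode y (Y₁.act j a w₁) w₂) N k p

theorem upperTrunc_of_act (Y : WeakModule A W₁) (a : V) (w : W₁) {X : Type*} [AddCommGroup X]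
    {R : Type*} (g : R → ℤ → W₁ → X) (hg : ∀ x k, g x k 0 = 0) :
    UpperTrunc (fun x k => g x k (Y.act k a w)) := by
  obtain ⟨B, hB⟩ := Y.truncation a w
  exact ⟨B, fun k hk x => by simp only [hB k hk, hg]⟩

theorem upperTrunc_mode (F : IntertwiningOperator Y₁ Y₂ Y₅) (a : V) (w₁ : W₁) (w₂ : W₂) :
    UpperTrunc (fun (y : ℂ) j => F.mode y (Y₁.act j a w₁) w₂) :=
  upperTrunc_of_act Y₁ a w₁ (fun y _ w => F.mode y w w₂) (by simp)

/-- With `x` the variable of `a` in `W₁₂`-coordinates, raising `N` is multiplication by `x - z₀`,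
the distance of `a` from `w₁`. -/
theorem leftSum_succ (a : V) (w₁ : W₁) (w₂ : W₂) (N k : ℤ) (p : ℂ) :
    leftSum F a w₁ w₂ (N + 1) k p = leftSum F a w₁ w₂ N (k + 1) p - leftSum F a w₁ w₂ N k (p + 1) :=
  assocSum_succ (upperTrunc_mode F a w₁ w₂) N k p

theorem leftSum_zero (a : V) (w₁ : W₁) (w₂ : W₂) (k : ℤ) (p : ℂ) :
    leftSum F a w₁ w₂ 0 k p = Y₅.act k a (F.mode p w₁ w₂) - F.mode p w₁ (Y₂.act k a w₂) := by
  rw [F.commutator, add_sub_cancel_left]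
  rfl

theorem leftSum_trunc (a : V) (w₁ : W₁) (w₂ : W₂) (N : ℕ) (p : ℂ) :
    ∃ B : ℤ, ∀ k, B ≤ k → leftSum F a w₁ w₂ N k p = 0 := by
  induction N generalizing p with
  | zero =>
    obtain ⟨B, hB⟩ := Y₅.truncation a (F.mode p w₁ w₂)
    obtain ⟨B', hB'⟩ := Y₂.truncation a w₂
    refine ⟨max B B', fun k hk => ?_⟩
    rw [Nat.cast_zero, leftSum_zero, hB k (le_trans (le_max_left _ _) hk),
      hB' k (le_trans (le_max_right _ _) hk), map_zero, sub_zero]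
  | succ N ih =>
    obtain ⟨B, hB⟩ := ih p
    obtain ⟨B', hB'⟩ := ih (p + 1)
    refine ⟨max B B', fun k hk => ?_⟩
    rw [Nat.cast_succ, leftSum_succ, hB (k + 1) (by have := le_max_left B B'; omega),
      hB' k (le_trans (le_max_right _ _) hk), sub_zero]

/-- The contribution of `w₁` to the action of `a` on the iterate. -/
noncomputable def iterLeft (F : IntertwiningOperator Y₁ Y₂ Y₅) (G : IntertwiningOperator Y₅ Y₃ Y₄)
    (a : V) (w₁ : W₁) (w₂ : W₂) (w₃ : W₃) (N l m : ℤ) (p n : ℂ) : W₄ :=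
  assocSum (fun x k => G.mode x (leftSum F a w₁ w₂ N k p) w₃) l m n

theorem upperTrunc_leftSum (a : V) (w₁ : W₁) (w₂ : W₂) (w₃ : W₃) (N : ℕ) (p : ℂ) :
    UpperTrunc (fun (x : ℂ) k => G.mode x (leftSum F a w₁ w₂ N k p) w₃) := by
  obtain ⟨B, hB⟩ := leftSum_trunc (F := F) a w₁ w₂ N p
  exact ⟨B, fun k hk x => by simp only [hB k hk, map_zero, LinearMap.zero_apply]⟩

/-- With `x` now the variable of `a` on the whole iterate, this is multiplication by `(x - z₂) - z₀
= x - z₁`. Under `E¹²` it becomes `step` in the indices of `x` and `z₁`. -/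
theorem iterLeft_succ (a : V) (w₁ : W₁) (w₂ : W₂) (w₃ : W₃) (N : ℕ) (l m : ℤ) (p n : ℂ) :
    iterLeft F G a w₁ w₂ w₃ (N + 1 : ℕ) l m p n = iterLeft F G a w₁ w₂ w₃ N l (m + 1) p n -
      (iterLeft F G a w₁ w₂ w₃ N l m (p + 1) n + iterLeft F G a w₁ w₂ w₃ N l m p (n + 1)) := by
  have h1 := assocSum_succ (upperTrunc_leftSum (F := F) (G := G) a w₁ w₂ w₃ N p) l m n
  rw [assocSum_shift] at h1
  have hT : UpperTrunc (fun (x : ℂ) k => G.mode x (leftSum F a w₁ w₂ N (k + 1) p) w₃) := by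
    obtain ⟨B, hB⟩ := upperTrunc_leftSum (F := F) (G := G) a w₁ w₂ w₃ N p
    exact ⟨B, fun k hk x => hB (k + 1) (by omega) x⟩
  have h2 := assocSum_sub hT (upperTrunc_leftSum (F := F) (G := G) a w₁ w₂ w₃ N (p + 1)) l m n
  unfold iterLeft
  rw [Nat.cast_succ]
  simp only [leftSum_succ, map_sub, LinearMap.sub_apply]
  rw [h2, h1]
  abel

theorem exists_act_eq_zero (Y : WeakModule A W₁) (a : V) (w : W₁) :
    ∃ N : ℕ, ∀ k : ℤ, N ≤ k → Y.act k a w = 0 := by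
  obtain ⟨B, hB⟩ := Y.truncation a w
  exact ⟨B.toNat, fun k hk => hB k (by omega)⟩

theorem leftSum_eq_zero {a : V} {w₁ : W₁} {N : ℤ} (h : ∀ k : ℤ, N ≤ k → Y₁.act k a w₁ = 0)
    (w₂ : W₂) (k : ℤ) (p : ℂ) : leftSum F a w₁ w₂ N k p = 0 :=
  assocSum_eq_zero (fun k hk x => by rw [h k hk, map_zero, LinearMap.zero_apply]) _ _

/-- The difference of the two sides of the Jacobi identity, for given families of coefficients. -/
noncomputable def jacobiForm {X : Type*} [AddCommGroup X] [Module ℂ X]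
    (g₁ : ℂ → ℤ → X) (g₂ : ℤ → ℂ → X) (g₃ : ℂ → ℤ → X) (l m : ℤ) (n : ℂ) : X :=
  assocSum g₁ l m n - commSum g₂ l m n + (-1 : ℂ) ^ l • commSum g₃ l n m

/-- The Jacobi identity of `G` for the vector `F(w₁,z₀)w₂` lets `a` act on that vector, whereas the
form only lets it act on `w₂`. By the commutator formula of `F` the discrepancy is the action on
`w₁`. -/
theorem iterModes_jacobiForm (w' : Dual ℂ W₄) (a : V) (w₁ : W₁) (w₂ : W₂) (w₃ : W₃) (l m : ℤ)
    (p n : ℂ) :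
    jacobiForm (fun x k => iterModes F G w' w₁ (Y₂.act k a w₂) w₃ p x)
      (fun x y => iterModes F G (w' ∘ₗ Y₄.act x a) w₁ w₂ w₃ p y)
      (fun x k => iterModes F G w' w₁ w₂ (Y₃.act k a w₃) p x) l m n =
      -w' (iterLeft F G a w₁ w₂ w₃ 0 l m p n) := by
  have T1 : UpperTrunc (fun (x : ℂ) k => G.mode x (F.mode p w₁ (Y₂.act k a w₂)) w₃) :=
    upperTrunc_of_act Y₂ a w₂ (fun x _ w => G.mode x (F.mode p w₁ w) w₃) (by simp)
  have T2 : UpperTrunc (fun (x : ℂ) k => G.mode x (Y₅.act k a (F.mode p w₁ w₂)) w₃) :=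
    upperTrunc_mode G a _ w₃
  have T3 : CosetTrunc (fun (x : ℤ) (y : ℂ) => Y₄.act x a (G.mode y (F.mode p w₁ w₂) w₃)) := by
    intro y
    obtain ⟨B, hB⟩ := G.truncation y (F.mode p w₁ w₂) w₃
    refine ⟨B.toNat, fun i hi x => ?_⟩
    have := hB i (by omega)
    rw [Int.cast_natCast] at this
    simp only [this, map_zero]
  have T4 : CosetTrunc (fun (x : ℂ) k => G.mode x (F.mode p w₁ w₂) (Y₃.act k a w₃)) :=
    (upperTrunc_of_act Y₃ a w₃ (fun x _ w => G.mode x (F.mode p w₁ w₂) w) (by simp)).cosetTrunc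
  have h1 : iterLeft F G a w₁ w₂ w₃ 0 l m p n =
      assocSum (fun (x : ℂ) k => G.mode x (Y₅.act k a (F.mode p w₁ w₂)) w₃) l m n -
      assocSum (fun (x : ℂ) k => G.mode x (F.mode p w₁ (Y₂.act k a w₂)) w₃) l m n := by
    rw [← assocSum_sub T2 T1]
    unfold iterLeft
    simp only [leftSum_zero, map_sub, LinearMap.sub_apply]
  rw [h1, G.jacobi_sum, map_sub, map_sub, map_smul, map_assocSum w' T1, map_commSum w' T3,
    map_commSum w' T4]
  unfold jacobiForm iterModes
  simp only [LinearMap.comp_apply]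
  abel

/-- The defect of the Jacobi identity for `φ`, as an operator. -/
noncomputable def phiDefect (Y₁ : WeakModule A W₁) (Y₂ : WeakModule A W₂) (Y₃ : WeakModule A W₃)
    (Y₄ : WeakModule A W₄) (φ : ℂ → W₂ →ₗ[ℂ] W₃ →ₗ[ℂ] (ℂ → W₁ →ₗ[ℂ] W₄)) (a : V) (w₂ : W₂)
    (w₃ : W₃) (l m : ℤ) (n : ℂ) : ℂ → W₁ →ₗ[ℂ] W₄ :=
  jacobiForm (fun x k => φ x (Y₂.act k a w₂) w₃)
    (fun x y => rightAction Y₁ Y₄ a x (φ y w₂ w₃))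
    (fun x k => φ x w₂ (Y₃.act k a w₃)) l m n

/-- The contribution of `w₁` to the action `∘_r`. -/
noncomputable def phiLeft (Y₁ : WeakModule A W₁) (φ : ℂ → W₂ →ₗ[ℂ] W₃ →ₗ[ℂ] (ℂ → W₁ →ₗ[ℂ] W₄))
    (a : V) (w₁ : W₁) (w₂ : W₂) (w₃ : W₃) (N l m : ℤ) (r n : ℂ) : W₄ :=
  commSum (fun (x : ℤ) (y : ℂ) =>
    assocSum (fun z j => φ y w₂ w₃ z (Y₁.act j a w₁)) N x r) l m n

theorem PhiBound.cosetTrunc (hb : PhiBound Y₂ Y₃ φ) (h₂ : Y₂.Spanned) (h₃ : Y₃.Spanned)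
    (w₂ : W₂) (w₃ : W₃) {X : Type*} [AddCommGroup X] {R : Type*}
    (g : R → (ℂ → W₁ →ₗ[ℂ] W₄) → X) (hg : ∀ x, g x 0 = 0) :
    CosetTrunc (fun (x : R) (y : ℂ) => g x (φ y w₂ w₃)) := by
  intro α
  obtain ⟨N, hN⟩ := hb.trunc h₂ h₃ α w₂ w₃
  refine ⟨N.toNat, fun i hi x => ?_⟩
  have := hN i (by omega)
  rw [Int.cast_natCast] at this
  simp only [this, hg]

theorem upperTrunc_apply_act (Φ : ℂ → W₁ →ₗ[ℂ] W₄) (a : V) (w₁ : W₁) :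
    UpperTrunc (fun (z : ℂ) j => Φ z (Y₁.act j a w₁)) :=
  upperTrunc_of_act Y₁ a w₁ (fun z _ w => Φ z w) (by simp)

theorem phiLeft_succ (hb : PhiBound Y₂ Y₃ φ) (h₂ : Y₂.Spanned) (h₃ : Y₃.Spanned) (a : V)
    (w₁ : W₁) (w₂ : W₂) (w₃ : W₃) (N l m : ℤ) (r n : ℂ) :
    phiLeft Y₁ φ a w₁ w₂ w₃ (N + 1) l m r n = phiLeft Y₁ φ a w₁ w₂ w₃ N l (m + 1) r n -
      phiLeft Y₁ φ a w₁ w₂ w₃ N l m (r + 1) n := by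
  have T : ∀ (r : ℂ) (c : ℤ), CosetTrunc (fun (x : ℤ) (y : ℂ) =>
      assocSum (fun z j => φ y w₂ w₃ z (Y₁.act j a w₁)) N (x + c) r) := fun r c =>
    hb.cosetTrunc h₂ h₃ w₂ w₃ (fun x Φ =>
      assocSum (fun z j => Φ z (Y₁.act j a w₁)) N (x + c) r) fun x =>
        assocSum_eq_zero (fun _ _ _ => rfl) _ _
  have h1 : phiLeft Y₁ φ a w₁ w₂ w₃ N l (m + 1) r n = commSum (fun (x : ℤ) (y : ℂ) =>
      assocSum (fun z j => φ y w₂ w₃ z (Y₁.act j a w₁)) N (x + 1) r) l m n := by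
    unfold phiLeft commSum
    refine finsum_congr fun i => ?_
    simp only [Int.cast_id]
    rw [show m + 1 + l - (i : ℤ) = m + l - i + 1 by ring]
  have T0 := T (r + 1) 0
  simp only [add_zero] at T0
  rw [h1]
  unfold phiLeft
  rw [← commSum_sub (T r 1) T0]
  refine commSum_congr fun i => ?_
  exact assocSum_succ (upperTrunc_apply_act _ a w₁) _ _ _

theorem phiLeft_eq_zero {a : V} {w₁ : W₁} {N : ℤ} (h : ∀ k : ℤ, N ≤ k → Y₁.act k a w₁ = 0)
    (w₂ : W₂) (w₃ : W₃) (l m : ℤ) (r n : ℂ) : phiLeft Y₁ φ a w₁ w₂ w₃ N l m r n = 0 :=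
  commSum_eq_zero fun i => assocSum_eq_zero (fun k hk x => by rw [h k hk, map_zero]) _ _

/-- `∘_r` differs from the action on `W₄` exactly by the term in which `a` acts on `w₁`; that term
gives `phiLeft`, the counterpart of `iterLeft` on the side of `φ`. -/
theorem coeffEval_phiDefect (hb : PhiBound Y₂ Y₃ φ) (h₂ : Y₂.Spanned) (h₃ : Y₃.Spanned) (a : V)
    (w₁ : W₁) (w₂ : W₂) (w₃ : W₃) (w' : Dual ℂ W₄) (l m : ℤ) (r n : ℂ) :
    coeffEval w' r w₁ (phiDefect Y₁ Y₂ Y₃ Y₄ φ a w₂ w₃ l m n) =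
      jacobiForm (fun x k => w' (φ x (Y₂.act k a w₂) w₃ r w₁))
        (fun x y => (w' ∘ₗ Y₄.act x a) (φ y w₂ w₃ r w₁))
        (fun x k => w' (φ x w₂ (Y₃.act k a w₃) r w₁)) l m n +
      w' (phiLeft Y₁ φ a w₁ w₂ w₃ 0 l m r n) := by
  have T1 : UpperTrunc (fun (x : ℂ) k => φ x (Y₂.act k a w₂) w₃) :=
    upperTrunc_of_act Y₂ a w₂ (fun x _ w => φ x w w₃) (by simp)
  have T2 : CosetTrunc (fun (x : ℤ) (y : ℂ) => rightAction Y₁ Y₄ a x (φ y w₂ w₃)) :=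
    hb.cosetTrunc h₂ h₃ w₂ w₃ (fun x Φ => rightAction Y₁ Y₄ a x Φ) (by simp)
  have T3 : CosetTrunc (fun (x : ℂ) k => φ x w₂ (Y₃.act k a w₃)) :=
    (upperTrunc_of_act Y₃ a w₃ (fun x _ w => φ x w₂ w) (by simp)).cosetTrunc
  have T4 : CosetTrunc (fun (x : ℤ) (y : ℂ) => Y₄.act x a (φ y w₂ w₃ r w₁)) :=
    hb.cosetTrunc h₂ h₃ w₂ w₃ (fun x Φ => Y₄.act x a (Φ r w₁)) (by simp)
  have T5 : CosetTrunc (fun (x : ℤ) (y : ℂ) =>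
      assocSum (fun z j => φ y w₂ w₃ z (Y₁.act j a w₁)) 0 x r) :=
    hb.cosetTrunc h₂ h₃ w₂ w₃ (fun x Φ =>
      assocSum (fun z j => Φ z (Y₁.act j a w₁)) 0 x r) fun x =>
        assocSum_eq_zero (fun _ _ _ => rfl) _ _
  unfold phiDefect jacobiForm phiLeft
  rw [map_add, map_sub, map_smul, map_assocSum _ T1, map_commSum _ T2, map_commSum _ T3]
  simp only [coeffEval_apply, rightAction_apply, LinearMap.comp_apply, map_sub]
  rw [map_commSum w' T5]
  have T4' : CosetTrunc (fun (x : ℤ) (y : ℂ) => w' (Y₄.act x a (φ y w₂ w₃ r w₁))) :=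
    hb.cosetTrunc h₂ h₃ w₂ w₃ (fun x Φ => w' (Y₄.act x a (Φ r w₁))) (by simp)
  have T5' : CosetTrunc (fun (x : ℤ) (y : ℂ) =>
      w' (assocSum (fun z j => φ y w₂ w₃ z (Y₁.act j a w₁)) 0 x r)) :=
    hb.cosetTrunc h₂ h₃ w₂ w₃ (fun x Φ =>
      w' (assocSum (fun z j => Φ z (Y₁.act j a w₁)) 0 x r)) fun x => by
        rw [show assocSum (fun (z : ℂ) j => (0 : ℂ → W₁ →ₗ[ℂ] W₄) z (Y₁.act j a w₁)) 0 x r = 0 from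
          assocSum_eq_zero (fun _ _ _ => rfl) _ _, map_zero]
  rw [commSum_sub T4' T5']
  abel

/-- With the truncation bounds all three sums are finite combinations of shifts in `z₂`, so `E¹²`
passes through them. -/
theorem modeE12_jacobiForm (hφ : PhiSpec F G φ) (h₄ : Y₄.Spanned) (h₄' : Y₄.LowerTrunc) (a : V)
    (w₁ : W₁) (w₂ : W₂) (w₃ : W₃) {w' : Dual ℂ W₄} (hw' : Y₄.MemDual w') (l m : ℤ) :
    ModeE12 (fun p n => -w' (iterLeft F G a w₁ w₂ w₃ 0 l m p n))
      (fun r n => jacobiForm (fun x k => w' (φ x (Y₂.act k a w₂) w₃ r w₁))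
        (fun x y => (w' ∘ₗ Y₄.act x a) (φ y w₂ w₃ r w₁))
        (fun x k => w' (φ x w₂ (Y₃.act k a w₃) r w₁)) l m n) := by
  obtain ⟨B₂, hB₂⟩ := Y₂.truncation a w₂
  obtain ⟨B₃, hB₃⟩ := Y₃.truncation a w₃
  obtain ⟨K, hK⟩ := hw'.exists_lower_bound h₄ h₄' a
  have e1 := ModeE12.assocSum (fun k => hφ w₁ (Y₂.act k a w₂) w₃ w' hw') (B := B₂)
    (fun k hk p n => by simp [iterModes, hB₂ k hk]) (fun k hk r n => by simp [hB₂ k hk]) l m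
  have e2 := ModeE12.commSum_left (fun k => hφ w₁ w₂ w₃ _ (hw'.comp_act k a)) (K := K)
    (fun k hk p n => by simp [iterModes, hK k hk]) (fun k hk r n => by simp [hK k hk]) l m
  have e3 := ModeE12.commSum_right (fun k => hφ w₁ w₂ (Y₃.act k a w₃) w' hw') (B := B₃)
    (fun k hk p n => by simp [iterModes, hB₃ k hk]) (fun k hk r n => by simp [hB₃ k hk]) l m
  refine ((e1.sub e2).add (e3.const_mul ((-1 : ℂ) ^ l))).congr (fun p n => ?_) (fun r n => rfl)
  exact iterModes_jacobiForm w' a w₁ w₂ w₃ l m p n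

theorem modeE12_iterate_step {α β : ℤ → ℂ → ℂ → ℂ} {γ : ℕ → ℤ → ℂ → ℂ → ℂ}
    (h : ∀ m, ModeE12 (α m) (β m)) (h0 : γ 0 = α)
    (hs : ∀ N m p n, γ (N + 1) m p n = γ N (m + 1) p n - (γ N m (p + 1) n + γ N m p (n + 1)))
    (N : ℕ) (m : ℤ) :
    ModeE12 (γ N m) (fun r n => step^[N] (fun m r => β m r n) m r) := by
  induction N generalizing m with
  | zero =>
    rw [h0]
    exact h m
  | succ N ih =>
    refine ((ih (m + 1)).sub (ih m).shift_z₁).congr (fun p n => (hs N m p n).symm) fun r n => ?_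
    rw [Function.iterate_succ_apply']
    rfl

theorem modeE12_iterate_step_jacobiForm (hφ : PhiSpec F G φ) (h₄ : Y₄.Spanned)
    (h₄' : Y₄.LowerTrunc) (a : V) (w₁ : W₁) (w₂ : W₂) (w₃ : W₃) {w' : Dual ℂ W₄}
    (hw' : Y₄.MemDual w') (N : ℕ) (l m : ℤ) :
    ModeE12 (fun p n => -w' (iterLeft F G a w₁ w₂ w₃ N l m p n))
      (fun r n => step^[N] (fun m r => jacobiForm (fun x k => w' (φ x (Y₂.act k a w₂) w₃ r w₁))
        (fun x y => (w' ∘ₗ Y₄.act x a) (φ y w₂ w₃ r w₁))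
        (fun x k => w' (φ x w₂ (Y₃.act k a w₃) r w₁)) l m n) m r) :=
  modeE12_iterate_step
    (β := fun m r n => jacobiForm (fun x k => w' (φ x (Y₂.act k a w₂) w₃ r w₁))
        (fun x y => (w' ∘ₗ Y₄.act x a) (φ y w₂ w₃ r w₁))
        (fun x k => w' (φ x w₂ (Y₃.act k a w₃) r w₁)) l m n)
    (γ := fun N m p n => -w' (iterLeft F G a w₁ w₂ w₃ N l m p n))
    (fun m => modeE12_jacobiForm hφ h₄ h₄' a w₁ w₂ w₃ hw' l m) rfl
    (fun N m p n => by rw [iterLeft_succ, map_sub, map_add]; ring) N m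

theorem iterate_step_phiLeft (hb : PhiBound Y₂ Y₃ φ) (h₂ : Y₂.Spanned) (h₃ : Y₃.Spanned) (a : V)
    (w₁ : W₁) (w₂ : W₂) (w₃ : W₃) (w' : Dual ℂ W₄) (l : ℤ) (n : ℂ) (N : ℕ) :
    step^[N] (fun m r => w' (phiLeft Y₁ φ a w₁ w₂ w₃ 0 l m r n)) =
      fun m r => w' (phiLeft Y₁ φ a w₁ w₂ w₃ N l m r n) := by
  induction N with
  | zero => rfl
  | succ N ih =>
    rw [Function.iterate_succ_apply', ih]
    funext m r
    rw [Nat.cast_succ, phiLeft_succ hb h₂ h₃, map_sub]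
    rfl

/-- Multiplication by `(x - z₁)^N` replaces `iterLeft` and `phiLeft` by sums over the modes `a_k` on
`w₁` with `k ≥ N`, all of which are zero. -/
theorem iterate_step_phiDefect_eq_zero (hφ : PhiSpec F G φ) (hb : PhiBound Y₂ Y₃ φ)
    (h₂ : Y₂.Spanned) (h₃ : Y₃.Spanned) (h₄ : Y₄.Spanned) (h₄' : Y₄.LowerTrunc) (a : V)
    (w₁ : W₁) (w₂ : W₂) (w₃ : W₃) {w' : Dual ℂ W₄} (hw' : Y₄.MemDual w') (l : ℤ) (n : ℂ) {N : ℕ}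
    (hN : ∀ k : ℤ, N ≤ k → Y₁.act k a w₁ = 0) (m : ℤ) (r : ℂ) :
    step^[N] (fun m r => coeffEval w' r w₁ (phiDefect Y₁ Y₂ Y₃ Y₄ φ a w₂ w₃ l m n)) m r = 0 := by
  simp only [coeffEval_phiDefect hb h₂ h₃]
  rw [iterate_step_add, iterate_step_phiLeft hb h₂ h₃]
  beta_reduce
  rw [phiLeft_eq_zero hN, map_zero, add_zero]
  refine (modeE12_iterate_step_jacobiForm hφ h₄ h₄' a w₁ w₂ w₃ hw' N l m).eq_zero
    (fun p n => ?_) r n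
  rw [iterLeft, assocSum_eq_zero_of_forall, map_zero, neg_zero]
  intro i
  rw [leftSum_eq_zero hN, map_zero, LinearMap.zero_apply]

/-- A power of `x - z₁` kills the defect, but that alone leaves delta-function solutions. They are
excluded by a direct check for `m ≥ 0`, after which the vanishing propagates along antidiagonals to
all `m`. -/
theorem phiDefect_zero (hφ : PhiSpec F G φ) (hb : PhiBound Y₂ Y₃ φ)
    (h₂ : Y₂.Spanned) (h₃ : Y₃.Spanned) (h₄ : Y₄.Spanned) (h₄' : Y₄.LowerTrunc) (a : V)
    (w₂ : W₂) (w₃ : W₃) (m : ℤ) (n : ℂ) :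
    phiDefect Y₁ Y₂ Y₃ Y₄ φ a w₂ w₃ 0 m n = 0 := by
  have key : ∀ (w₁ : W₁) (w' : Dual ℂ W₄), Y₄.MemDual w' → ∀ m r,
      coeffEval w' r w₁ (phiDefect Y₁ Y₂ Y₃ Y₄ φ a w₂ w₃ 0 m n) = 0 := by
    intro w₁ w' hw'
    obtain ⟨N, hN⟩ := exists_act_eq_zero Y₁ a w₁
    have h1 := iterate_step_phiDefect_eq_zero hφ hb h₂ h₃ h₄ h₄' a w₁ w₂ w₃ hw' 0 n hN
    have h2 : ∀ (M : ℕ) (r : ℂ), step^[M] (fun m r =>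
        coeffEval w' r w₁ (phiDefect Y₁ Y₂ Y₃ Y₄ φ a w₂ w₃ 0 m n)) (0 : ℤ) r = 0 := by
      intro M r
      simp only [coeffEval_phiDefect hb h₂ h₃]
      rw [iterate_step_add, iterate_step_phiLeft hb h₂ h₃]
      beta_reduce
      -- At `l = m = 0` each sum has one term: the `M`-th difference is `-φ` at `a_M w₁` from the
      -- iterate plus `φ` at `a_M w₁` from `phiLeft`, and these cancel.
      have e1 := modeE12_iterate_step_jacobiForm hφ h₄ h₄' a w₁ w₂ w₃ hw' M 0 0
      have e2 := (hφ (Y₁.act M a w₁) w₂ w₃ w' hw').const_mul (-1)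
      rw [(e1.congr (fun p n => by
        rw [iterLeft, assocSum_zero, leftSum, assocSum_zero, ← neg_one_mul]
        rfl) (fun _ _ => rfl)).unique e2 r n, phiLeft, commSum_zero, assocSum_zero]
      ring
    have h3 := eq_zero_of_iterate_step_zero h2
    refine eq_zero_of_iterate_step_of_tendsto
      (f := fun m r => coeffEval w' r w₁ (phiDefect Y₁ Y₂ Y₃ Y₄ φ a w₂ w₃ 0 m n))
      (fun m r => ⟨(-m).toNat, fun j hj => ?_⟩) N h1
    obtain ⟨t, ht⟩ := Int.eq_ofNat_of_zero_le (show 0 ≤ m + j by omega)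
    rw [ht]
    exact h3 t _
  funext r
  ext w₁
  exact h₄.eq_of_memDual fun w' hw' => by
    have := key w₁ w' hw' m r
    rw [coeffEval_apply] at this
    rw [this, Pi.zero_apply, LinearMap.zero_apply, map_zero]

/-- The commutator formula for `φ`. -/
theorem rightAction_phi (hφ : PhiSpec F G φ) (hb : PhiBound Y₂ Y₃ φ)
    (h₂ : Y₂.Spanned) (h₃ : Y₃.Spanned) (h₄ : Y₄.Spanned) (h₄' : Y₄.LowerTrunc) (a : V)
    (w₂ : W₂) (w₃ : W₃) (m : ℤ) (n : ℂ) :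
    rightAction Y₁ Y₄ a m (φ n w₂ w₃) = φ n w₂ (Y₃.act m a w₃) +
      assocSum (fun x k => φ x (Y₂.act k a w₂) w₃) 0 m n := by
  have := phiDefect_zero (Y₁ := Y₁) (Y₂ := Y₂) hφ hb h₂ h₃ h₄ h₄' a w₂ w₃ m n
  rw [phiDefect, jacobiForm, commSum_zero, commSum_zero, zpow_zero, one_smul] at this
  rw [← sub_eq_zero, ← neg_eq_zero, ← this]
  abel

/-- Only finitely many `a_{l+i} w₂` are nonzero, and the mode index of `φ` involves only `m + k`, so
the bound is uniform on lines of constant `m + k`. -/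
theorem assocSum_phi_eventually_zero (hb : PhiBound Y₂ Y₃ φ) (h₂ : Y₂.Spanned) (h₃ : Y₃.Spanned)
    (a : V) (w₂ : W₂) (w₃ : W₃) (l : ℤ) (α : ℂ) :
    ∃ N : ℤ, ∀ (m k : ℤ), N ≤ m + k →
      assocSum (fun x k => φ x (Y₂.act k a w₂) w₃) l m (α + k) = 0 := by
  obtain ⟨B, hB⟩ := (upperTrunc_of_act Y₂ a w₂ (fun (x : ℂ) (_ : ℤ) w => φ x w w₃)
    (by simp)).exists_bound l
  have h1 : ∀ᶠ N : ℤ in Filter.atTop, ∀ i ∈ Finset.range B, ∀ s : ℤ, N - i ≤ s →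
      φ (α + s) (Y₂.act (l + i) a w₂) w₃ = 0 := by
    rw [Filter.eventually_all_finset]
    intro i _
    obtain ⟨N, hN⟩ := hb.trunc h₂ h₃ α (Y₂.act (l + i) a w₂) w₃
    exact Filter.eventually_atTop.mpr ⟨N + i, fun M hM s hs => hN s (by omega)⟩
  obtain ⟨N, hN⟩ := h1.exists
  refine ⟨N, fun m k hmk => assocSum_eq_zero_of_forall fun i => ?_⟩
  by_cases hi : i < B
  · have := hN i (Finset.mem_range.mpr hi) (m + k - i) (by omega)
    rw [← this]
    congr 3
    push_cast
    ring
  · exact hB i (by omega) _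

/-- The Jacobi identity for `φ`. -/
theorem phiDefect_eq_zero (hφ : PhiSpec F G φ) (hb : PhiBound Y₂ Y₃ φ)
    (h₂ : Y₂.Spanned) (h₃ : Y₃.Spanned) (h₄ : Y₄.Spanned) (h₄' : Y₄.LowerTrunc) (a : V)
    (w₂ : W₂) (w₃ : W₃) (l m : ℤ) (n : ℂ) :
    phiDefect Y₁ Y₂ Y₃ Y₄ φ a w₂ w₃ l m n = 0 := by
  -- For large `m` the three sums vanish separately. The one with `∘_r` is rewritten by the
  -- commutator formula; its terms have indices of constant total `m + l`, so one bound serves for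
  -- every `i`.
  have hlarge : ∃ M : ℤ, ∀ m, M ≤ m → phiDefect Y₁ Y₂ Y₃ Y₄ φ a w₂ w₃ l m n = 0 := by
    obtain ⟨N₁, hN₁⟩ := assocSum_phi_eventually_zero hb h₂ h₃ a w₂ w₃ l n
    obtain ⟨N₂, hN₂⟩ := assocSum_phi_eventually_zero hb h₂ h₃ a w₂ w₃ 0 n
    obtain ⟨N₃, hN₃⟩ := Y₃.truncation a w₃
    obtain ⟨N₄, hN₄⟩ := hb.trunc_act h₂ h₃ n a w₂ w₃
    refine ⟨max (max N₁ N₃) (max (N₂ - l) (N₄ - l)), fun m hm => ?_⟩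
    have m1 : N₁ ≤ m := by omega
    have m2 : N₂ - l ≤ m := by omega
    have m3 : N₃ ≤ m := by omega
    have m4 : N₄ - l ≤ m := by omega
    unfold phiDefect jacobiForm
    have t1 := hN₁ m 0 (by omega)
    rw [Int.cast_zero, add_zero] at t1
    rw [t1, commSum_eq_zero, commSum_eq_zero]
    · simp
    · intro i
      simp only [hN₃ (m + i) (by omega), map_zero]
    · intro i
      have t2 := hN₂ (m + l - i) i (by omega)
      have t4 := hN₄ i (m + l - i) (by omega)
      rw [Int.cast_natCast] at t2 t4
      rw [rightAction_phi hφ hb h₂ h₃ h₄ h₄']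
      simp only [Int.cast_id]
      rw [t2, t4, add_zero]
  obtain ⟨M, hM⟩ := hlarge
  funext r
  ext w₁
  refine h₄.eq_of_memDual fun w' hw' => ?_
  obtain ⟨N, hN⟩ := exists_act_eq_zero Y₁ a w₁
  have := eq_zero_of_iterate_step_of_tendsto
    (f := fun m r => coeffEval w' r w₁ (phiDefect Y₁ Y₂ Y₃ Y₄ φ a w₂ w₃ l m n))
    (fun m r => ⟨(M - m).toNat, fun j hj => by
      rw [hM (m + j) (by omega), map_zero]⟩) N
    (iterate_step_phiDefect_eq_zero hφ hb h₂ h₃ h₄ h₄' a w₁ w₂ w₃ hw' l n hN) m r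
  rw [coeffEval_apply] at this
  rw [this, Pi.zero_apply, LinearMap.zero_apply, map_zero]

end Phi

end DLM

/-! ### Series killed by powers of two commuting differences -/

namespace DLM

section Trunc

variable {X : Type*} [AddCommGroup X] {R R₁ R₂ : Type*} [CommRing R₂]

theorem UpperTrunc.neg {g : R → ℤ → X} (hg : UpperTrunc g) : UpperTrunc fun x k => -g x k := by
  obtain ⟨B, hB⟩ := hg
  exact ⟨B, fun k hk x => by simp only [hB k hk, neg_zero]⟩

theorem CosetTrunc.sub {g g' : R₁ → R₂ → X} (hg : CosetTrunc g) (hg' : CosetTrunc g') :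
    CosetTrunc fun x k => g x k - g' x k := by
  intro n
  obtain ⟨B, hB⟩ := hg n
  obtain ⟨B', hB'⟩ := hg' n
  exact ⟨max B B', fun i hi x => by
    beta_reduce
    rw [hB i (le_trans (le_max_left _ _) hi), hB' i (le_trans (le_max_right _ _) hi), sub_zero]⟩

theorem CosetTrunc.neg {g : R₁ → R₂ → X} (hg : CosetTrunc g) : CosetTrunc fun x k => -g x k := by
  intro n
  obtain ⟨B, hB⟩ := hg n
  exact ⟨B, fun i hi x => by simp only [hB i hi, neg_zero]⟩

theorem CosetTrunc.add {g g' : R₁ → R₂ → X} (hg : CosetTrunc g) (hg' : CosetTrunc g') :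
    CosetTrunc fun x k => g x k + g' x k := by
  simpa only [sub_neg_eq_add] using hg.sub hg'.neg

end Trunc

section Sums

variable {X : Type*} [AddCommGroup X] [Module ℂ X] {R R₁ R₂ : Type*}
variable [CommRing R] [CommRing R₁] [CommRing R₂]

theorem assocSum_neg (g : R → ℤ → X) (l m : ℤ) (n : R) :
    assocSum (fun x k => -g x k) l m n = -assocSum g l m n := by
  unfold assocSum
  simp only [smul_neg, finsum_neg_distrib]

theorem commSum_neg (g : R₁ → R₂ → X) (l : ℤ) (m : R₁) (n : R₂) :
    commSum (fun x k => -g x k) l m n = -commSum g l m n := by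
  unfold commSum
  simp only [smul_neg, finsum_neg_distrib]

theorem assocSum_add {g g' : R → ℤ → X} (hg : UpperTrunc g) (hg' : UpperTrunc g') (l m : ℤ)
    (n : R) : assocSum (fun x k => g x k + g' x k) l m n =
      assocSum g l m n + assocSum g' l m n := by
  have := assocSum_sub hg hg'.neg l m n
  simpa only [sub_neg_eq_add, assocSum_neg] using this

theorem commSum_add {g g' : R₁ → R₂ → X} (hg : CosetTrunc g) (hg' : CosetTrunc g') (l : ℤ)
    (m : R₁) (n : R₂) : commSum (fun x k => g x k + g' x k) l m n =
      commSum g l m n + commSum g' l m n := by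
  have := commSum_sub hg hg'.neg l m n
  simpa only [sub_neg_eq_add, commSum_neg] using this

theorem commSum_shift_left (g : ℤ → R₂ → X) (l m : ℤ) (n : R₂) :
    commSum g l (m + 1) n = commSum (fun x y => g (x + 1) y) l m n := by
  unfold commSum
  refine finsum_congr fun i => ?_
  simp only [Int.cast_id]
  rw [show m + 1 + l - (i : ℤ) = m + l - i + 1 by ring]

theorem commSum_shift_right (g : R₁ → R₂ → X) (l : ℤ) (m : R₁) (n : R₂) :
    commSum g l m (n + 1) = commSum (fun x y => g x (y + 1)) l m n := by
  unfold commSum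
  exact finsum_congr fun i => by rw [add_right_comm]

theorem assocSum_shift_right (g : ℤ → ℤ → X) (l m n : ℤ) :
    assocSum g l m (n + 1) = assocSum (fun x k => g (x + 1) k) l m n := by
  unfold assocSum
  refine finsum_congr fun i => ?_
  simp only [Int.cast_id]
  rw [show m + (n + 1) - (i : ℤ) = m + n - i + 1 by ring]

end Sums

section Steps

section Pow

variable {X : Type*} [AddCommGroup X] [Module ℂ X] {R : Type*}

theorem pow_apply_zero {F : ℕ → ℤ → ℤ → R → X} {s : End ℂ (ℤ → ℤ → R → X)}
    (h : ∀ N, s (F N) = F (N + 1)) (N : ℕ) : (s ^ N) (F 0) = F N := by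
  induction N with
  | zero => rfl
  | succ N ih => rw [pow_succ', Module.End.mul_apply, ih, h]

theorem pow_apply_eq_zero_of_le {f : ℤ → ℤ → R → X} {s : End ℂ (ℤ → ℤ → R → X)} {N M : ℕ}
    (h : (s ^ N) f = 0) (hM : N ≤ M) : (s ^ M) f = 0 := by
  rw [← Nat.sub_add_cancel hM, pow_add, Module.End.mul_apply, h, map_zero]

end Pow

variable {X : Type*} [AddCommGroup X] [Module ℂ X] {R : Type*} [CommRing R]

/-- The difference of the shifts in the first and the third variable. -/
def stepFst : End ℂ (ℤ → ℤ → R → X) where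
  toFun f m n k := f (m + 1) n k - f m n (k + 1)
  map_add' f g := by
    funext m n k
    simp only [Pi.add_apply]
    abel
  map_smul' c f := by
    funext m n k
    simp only [Pi.smul_apply, RingHom.id_apply, smul_sub]

/-- The difference of the shifts in the second and the third variable. -/
def stepSnd : End ℂ (ℤ → ℤ → R → X) where
  toFun f m n k := f m (n + 1) k - f m n (k + 1)
  map_add' f g := by
    funext m n k
    simp only [Pi.add_apply]
    abel
  map_smul' c f := by
    funext m n k
    simp only [Pi.smul_apply, RingHom.id_apply, smul_sub]

theorem stepFst_apply (f : ℤ → ℤ → R → X) (m n : ℤ) (k : R) :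
    stepFst f m n k = f (m + 1) n k - f m n (k + 1) := rfl

theorem stepSnd_apply (f : ℤ → ℤ → R → X) (m n : ℤ) (k : R) :
    stepSnd f m n k = f m (n + 1) k - f m n (k + 1) := rfl

theorem commute_step : Commute (stepFst (X := X) (R := R)) stepSnd := by
  refine LinearMap.ext fun f => ?_
  funext m n k
  simp only [Module.End.mul_apply, stepFst_apply, stepSnd_apply]
  abel

theorem stepFst_pow_apply (f : ℤ → ℤ → R → X) (N : ℕ) (m n : ℤ) (k : R) :
    (stepFst ^ N) f m n k = step^[N] (fun m k => f m n k) m k := by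
  induction N generalizing m k with
  | zero => rfl
  | succ N ih =>
    rw [pow_succ', Module.End.mul_apply, stepFst_apply, ih, ih, Function.iterate_succ_apply']
    rfl

theorem stepSnd_pow_apply (f : ℤ → ℤ → R → X) (N : ℕ) (m n : ℤ) (k : R) :
    (stepSnd ^ N) f m n k = step^[N] (fun n k => f m n k) n k := by
  induction N generalizing n k with
  | zero => rfl
  | succ N ih =>
    rw [pow_succ', Module.End.mul_apply, stepSnd_apply, ih, ih, Function.iterate_succ_apply']
    rfl

/-- The product of the two commuting powers kills `f + g`. Truncation in the third variable, uniform
in the other two, then allows both powers to be cancelled in turn. -/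
theorem eq_zero_of_step_pow {f g : ℤ → ℤ → R → X} {N : ℕ}
    (h0 : ∀ k : R, ∃ j₀ : ℕ, ∀ j : ℕ, j₀ ≤ j → ∀ m n, (f + g) m n (k + j) = 0)
    (hf : (stepFst ^ N) f = 0) (hg : (stepSnd ^ N) g = 0) : f + g = 0 := by
  have h1 : ∀ m n k, (stepFst ^ N) (f + g) m n k = 0 := by
    intro m n k
    refine eq_zero_of_iterate_step_of_trunc (f := fun n k => (stepFst ^ N) (f + g) m n k) ?_ N ?_ n k
    · intro r
      obtain ⟨j₀, hj₀⟩ := h0 r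
      refine ⟨j₀, fun j hj n => ?_⟩
      have : ∀ (M : ℕ) (m n : ℤ) (j : ℕ), j₀ ≤ j → (stepFst ^ M) (f + g) m n (r + j) = 0 := by
        intro M
        induction M with
        | zero => exact fun m n j hj => hj₀ j hj m n
        | succ M ih =>
          intro m n j hj
          have := ih m n (j + 1) (by omega)
          rw [Nat.cast_succ, ← add_assoc] at this
          rw [pow_succ', Module.End.mul_apply, stepFst_apply, ih _ _ _ hj, this, sub_zero]
      exact this N m n j hj
    · intro n k
      rw [← stepSnd_pow_apply, ← Module.End.mul_apply, ← (commute_step.pow_pow N N).eq, map_add,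
        Module.End.mul_apply, Module.End.mul_apply, hg, map_zero, add_zero, ←
        Module.End.mul_apply, (commute_step.pow_pow N N).eq, Module.End.mul_apply, hf, map_zero]
      rfl
  funext m n k
  refine eq_zero_of_iterate_step_of_trunc (f := fun m k => (f + g) m n k) ?_ N ?_ m k
  · intro r
    obtain ⟨j₀, hj₀⟩ := h0 r
    exact ⟨j₀, fun j hj m => hj₀ j hj m n⟩
  · intro m k
    rw [← stepFst_pow_apply]
    exact h1 m n k

end Steps

end DLM

/-! ### Jacobi identity for the action `∘_r` -/

namespace DLM

section Phi

variable {V : Type v} [AddCommGroup V] [Module ℂ V] {A : VOA V}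
variable {W₁ : Type u} [AddCommGroup W₁] [Module ℂ W₁] {Y₁ : WeakModule A W₁}
variable {W₂ : Type u} [AddCommGroup W₂] [Module ℂ W₂] {Y₂ : WeakModule A W₂}
variable {W₃ : Type u} [AddCommGroup W₃] [Module ℂ W₃] {Y₃ : WeakModule A W₃}
variable {W₄ : Type u} [AddCommGroup W₄] [Module ℂ W₄] {Y₄ : WeakModule A W₄}
variable {φ : ℂ → W₂ →ₗ[ℂ] W₃ →ₗ[ℂ] (ℂ → W₁ →ₗ[ℂ] W₄)}

/-- The contribution of `w₂` to the action of `a` on `φ(w₂, w₃; z₁, z₂)`. -/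
noncomputable def phiMid (Y₂ : WeakModule A W₂) (φ : ℂ → W₂ →ₗ[ℂ] W₃ →ₗ[ℂ] (ℂ → W₁ →ₗ[ℂ] W₄))
    (a : V) (w₂ : W₂) (w₃ : W₃) (N m : ℤ) (k : ℂ) : ℂ → W₁ →ₗ[ℂ] W₄ :=
  assocSum (fun x j => φ x (Y₂.act j a w₂) w₃) N m k

/-- The commutator formula for `φ`. -/
def PhiCommutator (Y₁ : WeakModule A W₁) (Y₂ : WeakModule A W₂) (Y₃ : WeakModule A W₃)
    (Y₄ : WeakModule A W₄) (φ : ℂ → W₂ →ₗ[ℂ] W₃ →ₗ[ℂ] (ℂ → W₁ →ₗ[ℂ] W₄)) : Prop :=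
  ∀ (a : V) (w₂ : W₂) (w₃ : W₃) (m : ℤ) (n : ℂ),
    rightAction Y₁ Y₄ a m (φ n w₂ w₃) = φ n w₂ (Y₃.act m a w₃) + phiMid Y₂ φ a w₂ w₃ 0 m n

theorem upperTrunc_phi (a : V) (w₂ : W₂) (w₃ : W₃) :
    UpperTrunc fun x j => φ x (Y₂.act j a w₂) w₃ :=
  upperTrunc_of_act Y₂ a w₂ (fun x _ w => φ x w w₃) (by simp)

theorem phiMid_succ (a : V) (w₂ : W₂) (w₃ : W₃) (N m : ℤ) (k : ℂ) :
    phiMid Y₂ φ a w₂ w₃ (N + 1) m k =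
      phiMid Y₂ φ a w₂ w₃ N (m + 1) k - phiMid Y₂ φ a w₂ w₃ N m (k + 1) :=
  assocSum_succ (upperTrunc_phi a w₂ w₃) N m k

theorem phiMid_eq_zero {a : V} {w₂ : W₂} {N : ℤ} (h : ∀ k : ℤ, N ≤ k → Y₂.act k a w₂ = 0)
    (w₃ : W₃) (m : ℤ) (k : ℂ) : phiMid Y₂ φ a w₂ w₃ N m k = 0 :=
  assocSum_eq_zero (fun j hj x => by rw [h j hj, map_zero, LinearMap.zero_apply]) _ _

theorem phiMid_zero_left (w₂ : W₂) (w₃ : W₃) (N m : ℤ) (k : ℂ) :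
    phiMid Y₂ φ 0 w₂ w₃ N m k = 0 :=
  assocSum_eq_zero (fun j _ x => by simp) _ _

theorem phiMid_zero_right (a : V) (w₂ : W₂) (N m : ℤ) (k : ℂ) :
    phiMid Y₂ φ a w₂ 0 N m k = 0 :=
  assocSum_eq_zero (fun j _ x => by simp) _ _

/-- The action on `w₂` by the modes of `a` and on `w₃` by those of `b`. -/
noncomputable def mixedSum (Y₂ : WeakModule A W₂) (Y₃ : WeakModule A W₃)
    (φ : ℂ → W₂ →ₗ[ℂ] W₃ →ₗ[ℂ] (ℂ → W₁ →ₗ[ℂ] W₄)) (a b : V) (w₂ : W₂) (w₃ : W₃) (l : ℤ)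
    (N : ℕ) (m n : ℤ) (k : ℂ) : ℂ → W₁ →ₗ[ℂ] W₄ :=
  commSum (fun x y => phiMid Y₂ φ a w₂ (Y₃.act y b w₃) N x k) l m n

/-- The action of `a` on the contribution of `w₂` to the action of `b`. -/
noncomputable def nestedSum (Y₁ : WeakModule A W₁) (Y₂ : WeakModule A W₂) (Y₄ : WeakModule A W₄)
    (φ : ℂ → W₂ →ₗ[ℂ] W₃ →ₗ[ℂ] (ℂ → W₁ →ₗ[ℂ] W₄)) (a b : V) (w₂ : W₂) (w₃ : W₃) (l : ℤ)
    (N : ℕ) (m n : ℤ) (k : ℂ) : ℂ → W₁ →ₗ[ℂ] W₄ :=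
  commSum (fun x y => rightAction Y₁ Y₄ a x (phiMid Y₂ φ b w₂ w₃ N y k)) l m n

/-- The action on `w₂` by the modes of the products of `a` and `b`. -/
noncomputable def productSum (Y₂ : WeakModule A W₂)
    (φ : ℂ → W₂ →ₗ[ℂ] W₃ →ₗ[ℂ] (ℂ → W₁ →ₗ[ℂ] W₄)) (a b : V) (w₂ : W₂) (w₃ : W₃) (l : ℤ)
    (N : ℕ) (m n : ℤ) (k : ℂ) : ℂ → W₁ →ₗ[ℂ] W₄ :=
  assocSum (fun x j => phiMid Y₂ φ (A.mode j a b) w₂ w₃ N x k) l m n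

theorem upperTrunc_productSum (a b : V) (w₂ : W₂) (w₃ : W₃) (N : ℤ) (g : ℤ → ℤ) (k : ℂ) :
    UpperTrunc fun x j => phiMid Y₂ φ (A.mode j a b) w₂ w₃ N (g x) k := by
  obtain ⟨B, hB⟩ := A.truncation a b
  exact ⟨B, fun j hj x => by simp only [hB j hj, phiMid_zero_left]⟩

theorem cosetTrunc_mixedSum (a b : V) (w₂ : W₂) (w₃ : W₃) (N : ℤ) (g : ℤ → ℤ) (k : ℂ) :
    CosetTrunc fun x y => phiMid Y₂ φ a w₂ (Y₃.act y b w₃) N (g x) k := by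
  intro n
  obtain ⟨B, hB⟩ := Y₃.truncation b w₃
  exact ⟨(B - n).toNat, fun i hi x => by
    have := hB (n + i) (by omega)
    simp only [this, phiMid_zero_right]⟩

theorem phiMid_trunc (hb : PhiBound Y₂ Y₃ φ) (h₂ : Y₂.Spanned) (h₃ : Y₃.Spanned)
    (a : V) (w₂ : W₂) (w₃ : W₃) (N : ℤ) (k : ℂ) :
    ∃ M : ℤ, ∀ m s : ℤ, M ≤ m + s → phiMid Y₂ φ a w₂ w₃ N m (k + s) = 0 :=
  assocSum_phi_eventually_zero hb h₂ h₃ a w₂ w₃ N k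

theorem cosetTrunc_nestedSum (hb : PhiBound Y₂ Y₃ φ) (h₂ : Y₂.Spanned) (h₃ : Y₃.Spanned)
    (a b : V) (w₂ : W₂) (w₃ : W₃) (N : ℤ) (k : ℂ) :
    CosetTrunc fun x y => rightAction Y₁ Y₄ a x (phiMid Y₂ φ b w₂ w₃ N y k) := by
  intro n
  obtain ⟨B, hB⟩ := phiMid_trunc hb h₂ h₃ b w₂ w₃ N k
  refine ⟨(B - n).toNat, fun i hi x => ?_⟩
  have := hB (n + i) 0 (by omega)
  rw [Int.cast_zero, add_zero] at this
  simp only [this, map_zero]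

theorem mixedSum_succ (a b : V) (w₂ : W₂) (w₃ : W₃) (l : ℤ) (N : ℕ) (m n : ℤ) (k : ℂ) :
    mixedSum Y₂ Y₃ φ a b w₂ w₃ l (N + 1) m n k =
      mixedSum Y₂ Y₃ φ a b w₂ w₃ l N (m + 1) n k - mixedSum Y₂ Y₃ φ a b w₂ w₃ l N m n (k + 1) := by
  unfold mixedSum
  rw [commSum_shift_left, ← commSum_sub (cosetTrunc_mixedSum a b w₂ w₃ N (· + 1) k)
    (cosetTrunc_mixedSum a b w₂ w₃ N (·) (k + 1))]
  simp only [Nat.cast_succ, phiMid_succ]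

theorem nestedSum_succ (hb : PhiBound Y₂ Y₃ φ) (h₂ : Y₂.Spanned) (h₃ : Y₃.Spanned)
    (a b : V) (w₂ : W₂) (w₃ : W₃) (l : ℤ) (N : ℕ) (m n : ℤ) (k : ℂ) :
    nestedSum Y₁ Y₂ Y₄ φ a b w₂ w₃ l (N + 1) m n k =
      nestedSum Y₁ Y₂ Y₄ φ a b w₂ w₃ l N m (n + 1) k -
        nestedSum Y₁ Y₂ Y₄ φ a b w₂ w₃ l N m n (k + 1) := by
  have T := cosetTrunc_nestedSum (Y₁ := Y₁) (Y₄ := Y₄) hb h₂ h₃ a b w₂ w₃ N k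
  have T' : CosetTrunc fun x y => rightAction Y₁ Y₄ a x (phiMid Y₂ φ b w₂ w₃ N (y + 1) k) := by
    intro n
    obtain ⟨B, hB⟩ := T (n + 1)
    exact ⟨B, fun i hi x => by rw [← hB i hi x, add_right_comm]⟩
  unfold nestedSum
  rw [commSum_shift_right, ← commSum_sub T' (cosetTrunc_nestedSum hb h₂ h₃ a b w₂ w₃ N (k + 1))]
  simp only [Nat.cast_succ, phiMid_succ, map_sub]

theorem productSum_succ (a b : V) (w₂ : W₂) (w₃ : W₃) (l : ℤ) (N : ℕ) (m n : ℤ) (k : ℂ) :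
    productSum Y₂ φ a b w₂ w₃ l (N + 1) m n k =
      productSum Y₂ φ a b w₂ w₃ l N m (n + 1) k - productSum Y₂ φ a b w₂ w₃ l N m n (k + 1) := by
  unfold productSum
  rw [assocSum_shift_right, ← assocSum_sub (upperTrunc_productSum a b w₂ w₃ N (· + 1) k)
    (upperTrunc_productSum a b w₂ w₃ N (·) (k + 1))]
  simp only [Nat.cast_succ, phiMid_succ]

theorem stepFst_pow_mixedSum {a : V} {w₂ : W₂} {N : ℕ} (h : ∀ k : ℤ, N ≤ k → Y₂.act k a w₂ = 0)
    (b : V) (w₃ : W₃) (l : ℤ) : (stepFst ^ N) (mixedSum Y₂ Y₃ φ a b w₂ w₃ l 0) = 0 := by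
  rw [pow_apply_zero (F := mixedSum Y₂ Y₃ φ a b w₂ w₃ l) fun N => by
    funext m n k
    rw [mixedSum_succ, stepFst_apply]]
  funext m n k
  exact commSum_eq_zero fun i => phiMid_eq_zero h _ _ _

theorem stepSnd_pow_mixedSum_swap {a : V} {w₂ : W₂} {N : ℕ}
    (h : ∀ k : ℤ, N ≤ k → Y₂.act k a w₂ = 0) (b : V) (w₃ : W₃) (l : ℤ) :
    (stepSnd ^ N) (fun m n k => mixedSum Y₂ Y₃ φ a b w₂ w₃ l 0 n m k) = 0 := by
  rw [pow_apply_zero (F := fun N m n k => mixedSum Y₂ Y₃ φ a b w₂ w₃ l N n m k) fun N => by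
    funext m n k
    rw [mixedSum_succ, stepSnd_apply]]
  funext m n k
  exact commSum_eq_zero fun i => phiMid_eq_zero h _ _ _

theorem stepSnd_pow_nestedSum (hb : PhiBound Y₂ Y₃ φ) (h₂ : Y₂.Spanned) (h₃ : Y₃.Spanned)
    {b : V} {w₂ : W₂} {N : ℕ} (h : ∀ k : ℤ, N ≤ k → Y₂.act k b w₂ = 0) (a : V) (w₃ : W₃) (l : ℤ) :
    (stepSnd ^ N) (nestedSum Y₁ Y₂ Y₄ φ a b w₂ w₃ l 0) = 0 := by
  rw [pow_apply_zero (F := nestedSum Y₁ Y₂ Y₄ φ a b w₂ w₃ l) fun N => by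
    funext m n k
    rw [nestedSum_succ hb h₂ h₃, stepSnd_apply]]
  funext m n k
  exact commSum_eq_zero fun i => by rw [phiMid_eq_zero h, map_zero]

theorem stepFst_pow_nestedSum_swap (hb : PhiBound Y₂ Y₃ φ) (h₂ : Y₂.Spanned) (h₃ : Y₃.Spanned)
    {b : V} {w₂ : W₂} {N : ℕ} (h : ∀ k : ℤ, N ≤ k → Y₂.act k b w₂ = 0) (a : V) (w₃ : W₃) (l : ℤ) :
    (stepFst ^ N) (fun m n k => nestedSum Y₁ Y₂ Y₄ φ a b w₂ w₃ l 0 n m k) = 0 := by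
  rw [pow_apply_zero (F := fun N m n k => nestedSum Y₁ Y₂ Y₄ φ a b w₂ w₃ l N n m k) fun N => by
    funext m n k
    rw [nestedSum_succ hb h₂ h₃, stepFst_apply]]
  funext m n k
  exact commSum_eq_zero fun i => by rw [phiMid_eq_zero h, map_zero]

/-- Only finitely many products `a_j b` with `j ≥ l` are nonzero, so a common exponent exists. -/
theorem exists_stepSnd_pow_productSum (a b : V) (w₂ : W₂) (w₃ : W₃) (l : ℤ) :
    ∃ N : ℕ, (stepSnd ^ N) (productSum Y₂ φ a b w₂ w₃ l 0) = 0 := by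
  obtain ⟨B, hB⟩ := A.truncation a b
  have : ∀ᶠ N : ℕ in Filter.atTop, ∀ i ∈ Finset.range (B - l).toNat, ∀ k : ℤ, N ≤ k →
      Y₂.act k (A.mode (l + i) a b) w₂ = 0 := by
    rw [Filter.eventually_all_finset]
    intro i _
    obtain ⟨N, hN⟩ := exists_act_eq_zero Y₂ (A.mode (l + i) a b) w₂
    exact Filter.eventually_atTop.mpr ⟨N, fun M hM k hk => hN k (by omega)⟩
  obtain ⟨N, hN⟩ := this.exists
  refine ⟨N, ?_⟩
  rw [pow_apply_zero (F := productSum Y₂ φ a b w₂ w₃ l) fun N => by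
    funext m n k
    rw [productSum_succ, stepSnd_apply]]
  funext m n k
  refine assocSum_eq_zero_of_forall fun i => ?_
  by_cases hi : i < (B - l).toNat
  · exact phiMid_eq_zero (hN i (Finset.mem_range.mpr hi)) _ _ _
  · rw [hB (l + i) (by omega), phiMid_zero_left]

/-- The iterated action `∘_r` on `φ`, in the Jacobi identity. -/
noncomputable def compSum (Y₁ : WeakModule A W₁) (Y₄ : WeakModule A W₄)
    (Φ : ℂ → W₁ →ₗ[ℂ] W₄) (a b : V) (l m n : ℤ) : ℂ → W₁ →ₗ[ℂ] W₄ :=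
  commSum (fun x y => rightAction Y₁ Y₄ a x (rightAction Y₁ Y₄ b y Φ)) l m n

/-- The commutator formula is applied to `b` and then, on the term `φ_k(w₂, b_y w₃)`, once more to
`a`. The part with both actions on `w₃` is set aside because it satisfies the Jacobi identity of
`Y₃`. -/
theorem compSum_phi (hc : PhiCommutator Y₁ Y₂ Y₃ Y₄ φ) (hb : PhiBound Y₂ Y₃ φ) (h₂ : Y₂.Spanned)
    (h₃ : Y₃.Spanned) (a b : V) (w₂ : W₂) (w₃ : W₃) (l m n : ℤ) (k : ℂ) :
    compSum Y₁ Y₄ (φ k w₂ w₃) a b l m n =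
      φ k w₂ (commSum (fun x y => Y₃.act x a (Y₃.act y b w₃)) l m n) +
      (mixedSum Y₂ Y₃ φ a b w₂ w₃ l 0 m n k + nestedSum Y₁ Y₂ Y₄ φ a b w₂ w₃ l 0 m n k) := by
  have T1 : CosetTrunc fun x y => Y₃.act x a (Y₃.act y b w₃) :=
    (upperTrunc_of_act Y₃ b w₃ (fun x _ w => Y₃.act x a w) (by simp)).cosetTrunc
  have T1' : CosetTrunc fun x y => φ k w₂ (Y₃.act x a (Y₃.act y b w₃)) :=
    (upperTrunc_of_act Y₃ b w₃ (fun x _ w => φ k w₂ (Y₃.act x a w)) (by simp)).cosetTrunc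
  have T2 : CosetTrunc fun x y => phiMid Y₂ φ a w₂ (Y₃.act y b w₃) (0 : ℕ) x k :=
    cosetTrunc_mixedSum a b w₂ w₃ (0 : ℕ) (·) k
  have T3 : CosetTrunc fun x y => rightAction Y₁ Y₄ a x (phiMid Y₂ φ b w₂ w₃ (0 : ℕ) y k) :=
    cosetTrunc_nestedSum hb h₂ h₃ a b w₂ w₃ (0 : ℕ) k
  rw [map_commSum _ T1, mixedSum, nestedSum, ← commSum_add T2 T3, ← commSum_add T1' (T2.add T3)]
  refine commSum_congr fun i => ?_
  rw [hc, map_add, hc, add_assoc]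
  rfl

/-- The Jacobi identity for the action `∘_r` on the coefficients of `φ`. -/
theorem rightAction_jacobi_phi (hc : PhiCommutator Y₁ Y₂ Y₃ Y₄ φ) (hb : PhiBound Y₂ Y₃ φ)
    (h₂ : Y₂.Spanned) (h₃ : Y₃.Spanned) (a b : V) (w₂ : W₂) (w₃ : W₃) (l m n : ℤ) (k : ℂ) :
    assocSum (fun x j => rightAction Y₁ Y₄ (A.mode j a b) x (φ k w₂ w₃)) l m n =
      compSum Y₁ Y₄ (φ k w₂ w₃) a b l m n -
      (-1 : ℂ) ^ l • compSum Y₁ Y₄ (φ k w₂ w₃) b a l n m := by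
  have hprod : ∀ (m n : ℤ) (k : ℂ),
      assocSum (fun x j => rightAction Y₁ Y₄ (A.mode j a b) x (φ k w₂ w₃)) l m n =
      φ k w₂ (assocSum (fun x j => Y₃.act x (A.mode j a b) w₃) l m n) +
        productSum Y₂ φ a b w₂ w₃ l 0 m n k := by
    intro m n k
    obtain ⟨B, hB⟩ := A.truncation a b
    have T1 : UpperTrunc fun x j => Y₃.act x (A.mode j a b) w₃ :=
      ⟨B, fun j hj x => by simp [hB j hj]⟩
    have T1' : UpperTrunc fun x j => φ k w₂ (Y₃.act x (A.mode j a b) w₃) :=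
      ⟨B, fun j hj x => by simp [hB j hj]⟩
    rw [map_assocSum _ T1, productSum,
      ← assocSum_add T1' (upperTrunc_productSum a b w₂ w₃ (0 : ℕ) (·) k)]
    refine assocSum_congr fun i => ?_
    rw [hc]
    rfl
  obtain ⟨N₁, hN₁⟩ := exists_act_eq_zero Y₂ a w₂
  obtain ⟨N₂, hN₂⟩ := exists_act_eq_zero Y₂ b w₂
  obtain ⟨N₃, hN₃⟩ := exists_stepSnd_pow_productSum (Y₂ := Y₂) (φ := φ) a b w₂ w₃ l
  let N := max N₁ (max N₂ N₃)
  -- What is left of the Jacobi identity after removing the action on `w₃` is `f + g`. In `f` the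
  -- element `a` acts on `w₂`, so a power of `x - z₂` kills it. In `g` either `b` or a product `a_j
  -- b` acts on `w₂`, so a power of `y - z₂` kills it.
  let f : ℤ → ℤ → ℂ → ℂ → W₁ →ₗ[ℂ] W₄ := (-1 : ℂ) ^ l •
    (fun m n k => nestedSum Y₁ Y₂ Y₄ φ b a w₂ w₃ l 0 n m k) - mixedSum Y₂ Y₃ φ a b w₂ w₃ l 0
  let g : ℤ → ℤ → ℂ → ℂ → W₁ →ₗ[ℂ] W₄ := productSum Y₂ φ a b w₂ w₃ l 0 -
    nestedSum Y₁ Y₂ Y₄ φ a b w₂ w₃ l 0 +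
      (-1 : ℂ) ^ l • (fun m n k => mixedSum Y₂ Y₃ φ b a w₂ w₃ l 0 n m k)
  have hf : (stepFst ^ N) f = 0 := by
    rw [map_sub, map_smul,
      pow_apply_eq_zero_of_le (stepFst_pow_mixedSum hN₁ b w₃ l) (by omega),
      pow_apply_eq_zero_of_le (stepFst_pow_nestedSum_swap hb h₂ h₃ hN₁ b w₃ l) (by omega),
      smul_zero, sub_zero]
  have hg : (stepSnd ^ N) g = 0 := by
    rw [map_add, map_sub, map_smul, pow_apply_eq_zero_of_le hN₃ (by omega),
      pow_apply_eq_zero_of_le (stepSnd_pow_mixedSum_swap hN₂ a w₃ l) (by omega),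
      pow_apply_eq_zero_of_le (stepSnd_pow_nestedSum hb h₂ h₃ hN₂ a w₃ l) (by omega),
      smul_zero, sub_zero, add_zero]
  have key : ∀ m n k, (f + g) m n k =
      assocSum (fun x j => rightAction Y₁ Y₄ (A.mode j a b) x (φ k w₂ w₃)) l m n -
      (compSum Y₁ Y₄ (φ k w₂ w₃) a b l m n -
      (-1 : ℂ) ^ l • compSum Y₁ Y₄ (φ k w₂ w₃) b a l n m) := by
    intro m n k
    rw [hprod, compSum_phi hc hb h₂ h₃, compSum_phi hc hb h₂ h₃, Y₃.jacobi_sum, map_sub, map_smul]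
    simp only [f, g, Pi.add_apply, Pi.sub_apply, Pi.smul_apply, smul_add]
    abel
  have h0 : f + g = 0 := by
    refine eq_zero_of_step_pow (fun k => ?_) hf hg
    -- Each term of the identity is linear in `φ_k(w₂,w₃)`, so the truncation of `φ` holds for the
    -- defect, uniformly in `m` and `n`.
    obtain ⟨M, hM⟩ := hb.trunc h₂ h₃ k w₂ w₃
    refine ⟨M.toNat, fun j hj m n => ?_⟩
    have h1 := hM j (by omega)
    rw [Int.cast_natCast] at h1
    rw [key, h1]
    unfold compSum
    rw [assocSum_eq_zero_of_forall, commSum_eq_zero, commSum_eq_zero, smul_zero, sub_zero, sub_zero]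
    all_goals intro i; simp
  rw [← sub_eq_zero, ← key, h0]
  rfl

end Phi

end DLM

/-! ### The weak module `M` -/

namespace DLM

/-- This is the absorption identity `(i + 1) (m choose i + 1) = m (m - 1 choose i)`. -/
theorem assocSum_derivative {X : Type*} [AddCommGroup X] [Module ℂ X] {R : Type*} [CommRing R]
    {g : R → ℤ → X} (hg : UpperTrunc g) (m : ℤ) (n : R) :
    assocSum (fun x k => -(k : ℂ) • g x (k - 1)) 0 m n = -(m : ℂ) • assocSum g 0 (m - 1) n := by
  obtain ⟨B, hB⟩ := hg.exists_bound 0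
  rw [assocSum_eq_sum (g := g) (B := B) fun i hi => hB i hi _,
    assocSum_eq_sum (g := fun x k => -(k : ℂ) • g x (k - 1)) (B := B + 1) fun i hi => by
      have h1 := hB (i - 1) (by omega) (m + n - i)
      rw [Nat.cast_sub (by omega), Nat.cast_one] at h1
      rw [show (0 : ℤ) + i - 1 = 0 + (i - 1) by ring, h1, smul_zero], Finset.sum_range_succ', Finset.smul_sum]
  simp only [CharP.cast_eq_zero, add_zero, Int.cast_zero, neg_zero, zero_smul, smul_zero]
  refine Finset.sum_congr rfl fun i _ => ?_
  have h2 := Ring.choose_smul_choose m (n := i + 1) (k := 1) (by omega)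
  rw [Nat.choose_one_right, Ring.choose_one_right, add_tsub_cancel_right, nsmul_eq_mul,
    Nat.cast_one] at h2
  have h3 : ((i : ℂ) + 1) * ((Ring.choose m (i + 1) : ℤ) : ℂ) =
      m * ((Ring.choose (m - 1) i : ℤ) : ℂ) := by exact_mod_cast h2
  rw [smul_smul, smul_smul]
  congr 1
  · push_cast
    linear_combination -h3
  · congr 1
    · push_cast
      ring
    · push_cast
      ring

section Phi

variable {V : Type v} [AddCommGroup V] [Module ℂ V] {A : VOA V}
variable {W₁ : Type u} [AddCommGroup W₁] [Module ℂ W₁] {Y₁ : WeakModule A W₁}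
variable {W₂ : Type u} [AddCommGroup W₂] [Module ℂ W₂] {Y₂ : WeakModule A W₂}
variable {W₃ : Type u} [AddCommGroup W₃] [Module ℂ W₃] {Y₃ : WeakModule A W₃}
variable {W₄ : Type u} [AddCommGroup W₄] [Module ℂ W₄] {Y₄ : WeakModule A W₄}
variable {W₅ : Type u} [AddCommGroup W₅] [Module ℂ W₅] {Y₅ : WeakModule A W₅}
variable {F : IntertwiningOperator Y₁ Y₂ Y₅} {G : IntertwiningOperator Y₅ Y₃ Y₄}
variable {φ : ℂ → W₂ →ₗ[ℂ] W₃ →ₗ[ℂ] (ℂ → W₁ →ₗ[ℂ] W₄)}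

/-- By uniqueness of `E¹²` and since the restricted dual separates points, the generators of `M` are
exactly the values of the chosen `φ`. -/
theorem PhiSpec.isPhi_iff (hφ : PhiSpec F G φ) (h₄ : Y₄.Spanned) {w₂ : W₂} {w₃ : W₃} {n : ℂ}
    {Φ : ℂ → W₁ →ₗ[ℂ] W₄} : IsPhi F G w₂ w₃ n Φ ↔ Φ = φ n w₂ w₃ := by
  constructor
  · intro h
    funext r
    ext w₁
    refine h₄.eq_of_memDual fun w' hw' => ?_
    obtain ⟨b, hb, hb'⟩ := h w₁ w' hw'
    rw [hb']
    refine ((ModeE12.of_isE12 hb).congr (fun p n => ?_) fun _ _ => rfl).unique (hφ w₁ w₂ w₃ w' hw')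
      r n
    simp only [iterateSeries, iterModes, neg_sub, sub_neg_eq_add, add_sub_cancel_left]
  · rintro rfl w₁ w' hw'
    refine ⟨_, hφ w₁ w₂ w₃ w' hw', fun m => ?_⟩
    simp only [neg_sub, sub_neg_eq_add, add_sub_cancel_left]

theorem PhiSpec.mem_spaceM (hφ : PhiSpec F G φ) (h₄ : Y₄.Spanned) (n : ℂ) (w₂ : W₂) (w₃ : W₃) :
    φ n w₂ w₃ ∈ spaceM F G :=
  Submodule.subset_span ⟨w₂, w₃, n, (hφ.isPhi_iff h₄).mpr rfl⟩

/-- No closure under scalars is required, because a scalar can be moved into `w₂`. -/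
theorem PhiSpec.spaceM_induction (hφ : PhiSpec F G φ) (h₄ : Y₄.Spanned)
    {p : (ℂ → W₁ →ₗ[ℂ] W₄) → Prop} (hmem : ∀ n w₂ w₃, p (φ n w₂ w₃))
    (hadd : ∀ x ∈ spaceM F G, ∀ y ∈ spaceM F G, p x → p y → p (x + y)) {Φ : ℂ → W₁ →ₗ[ℂ] W₄}
    (hΦ : Φ ∈ spaceM F G) : p Φ := by
  refine Submodule.closure_induction (p := fun Φ _ => p Φ) ?_ ?_ ?_ hΦ
  · have := hmem 0 0 0
    simpa using this
  · intro x y hx hy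
    exact hadd x hx y hy
  · rintro c Φ ⟨w₂, w₃, n, h⟩
    rw [(hφ.isPhi_iff h₄).mp h]
    have := hmem n (c • w₂) w₃
    simpa using this

theorem assocSum_mem {X : Type*} [AddCommGroup X] [Module ℂ X] {R : Type*} [CommRing R]
    (M : Submodule ℂ X) {g : R → ℤ → X} {l m : ℤ} {n : R} (h : ∀ x k, g x k ∈ M) :
    assocSum g l m n ∈ M :=
  finsum_induction (· ∈ M) M.zero_mem (fun _ _ => M.add_mem) fun _ => M.smul_mem _ (h _ _)

theorem rightAction_mem_spaceM (hφ : PhiSpec F G φ) (hc : PhiCommutator Y₁ Y₂ Y₃ Y₄ φ)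
    (h₄ : Y₄.Spanned) (a : V) (m : ℤ) {Φ : ℂ → W₁ →ₗ[ℂ] W₄} (hΦ : Φ ∈ spaceM F G) :
    rightAction Y₁ Y₄ a m Φ ∈ spaceM F G := by
  refine hφ.spaceM_induction h₄ (p := fun Φ => rightAction Y₁ Y₄ a m Φ ∈ spaceM F G)
    (fun n w₂ w₃ => ?_) (fun x _ y _ hx hy => ?_) hΦ
  · rw [hc]
    exact add_mem (hφ.mem_spaceM h₄ _ _ _) (assocSum_mem _ fun x k => hφ.mem_spaceM h₄ _ _ _)
  · rw [map_add]
    exact add_mem hx hy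

theorem rightAction_add_left (a b : V) (m : ℤ) (Φ : ℂ → W₁ →ₗ[ℂ] W₄) :
    rightAction Y₁ Y₄ (a + b) m Φ = rightAction Y₁ Y₄ a m Φ + rightAction Y₁ Y₄ b m Φ := by
  funext r
  ext w
  have := assocSum_add (upperTrunc_apply_act (Y₁ := Y₁) Φ a w)
    (upperTrunc_apply_act (Y₁ := Y₁) Φ b w) 0 m r
  simp only [Pi.add_apply, LinearMap.add_apply, rightAction_apply, map_add, this]
  abel

theorem rightAction_smul_left (c : ℂ) (a : V) (m : ℤ) (Φ : ℂ → W₁ →ₗ[ℂ] W₄) :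
    rightAction Y₁ Y₄ (c • a) m Φ = c • rightAction Y₁ Y₄ a m Φ := by
  funext r
  ext w
  have := map_assocSum (LinearMap.lsmul ℂ W₄ c) (upperTrunc_apply_act (Y₁ := Y₁) Φ a w) 0 m r
  simp only [LinearMap.lsmul_apply] at this
  simp only [Pi.smul_apply, LinearMap.smul_apply, rightAction_apply, map_smul, smul_sub, this]

theorem rightAction_vac (m : ℤ) (Φ : ℂ → W₁ →ₗ[ℂ] W₄) :
    rightAction Y₁ Y₄ A.vac m Φ = if m = -1 then Φ else 0 := by
  funext r
  ext w
  rw [rightAction_apply, assocSum_eq_zero fun k hk x => by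
    rw [Y₁.vac_act, if_neg (by omega), map_zero], sub_zero, Y₄.vac_act]
  split_ifs <;> rfl

theorem rightAction_derivative (a : V) (m : ℤ) (Φ : ℂ → W₁ →ₗ[ℂ] W₄) :
    rightAction Y₁ Y₄ (A.mode 0 A.conf a) m Φ = -(m : ℂ) • rightAction Y₁ Y₄ a (m - 1) Φ := by
  funext r
  ext w
  have h1 := assocSum_derivative (upperTrunc_apply_act (Y₁ := Y₁) Φ a w) m r
  simp only [Pi.smul_apply, LinearMap.smul_apply, rightAction_apply, smul_sub, ← h1,
    Y₁.derivative, Y₄.derivative, map_smul]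

theorem upperTrunc_rightAction_mode (a b : V) (Φ : ℂ → W₁ →ₗ[ℂ] W₄) :
    UpperTrunc fun x j => rightAction Y₁ Y₄ (A.mode j a b) x Φ := by
  obtain ⟨B, hB⟩ := A.truncation a b
  exact ⟨B, fun j hj x => by
    have := rightAction_smul_left (Y₁ := Y₁) (Y₄ := Y₄) 0 0 x Φ
    simp only [hB j hj]
    simpa using this⟩

/-- The conditions under which the coefficients of `φ` span a weak module. -/
structure PhiData (F : IntertwiningOperator Y₁ Y₂ Y₅) (G : IntertwiningOperator Y₅ Y₃ Y₄)
    (φ : ℂ → W₂ →ₗ[ℂ] W₃ →ₗ[ℂ] (ℂ → W₁ →ₗ[ℂ] W₄)) : Prop where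
  spec : PhiSpec F G φ
  bound : PhiBound Y₂ Y₃ φ
  spanned₁ : Y₁.Spanned
  spanned₂ : Y₂.Spanned
  spanned₃ : Y₃.Spanned
  spanned₄ : Y₄.Spanned
  lowerTrunc₄ : Y₄.LowerTrunc

namespace PhiData

theorem commutator (h : PhiData F G φ) : PhiCommutator Y₁ Y₂ Y₃ Y₄ φ := fun a w₂ w₃ m n =>
  rightAction_phi h.spec h.bound h.spanned₂ h.spanned₃ h.spanned₄ h.lowerTrunc₄ a w₂ w₃ m n

theorem truncation (h : PhiData F G φ) (a : V) {Φ : ℂ → W₁ →ₗ[ℂ] W₄} (hΦ : Φ ∈ spaceM F G) :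
    ∃ N : ℤ, ∀ n : ℤ, N ≤ n → rightAction Y₁ Y₄ a n Φ = 0 := by
  refine h.spec.spaceM_induction h.spanned₄
    (p := fun Φ => ∃ N : ℤ, ∀ n : ℤ, N ≤ n → rightAction Y₁ Y₄ a n Φ = 0)
    (fun n w₂ w₃ => ?_) (fun x _ y _ hx hy => ?_) hΦ
  · obtain ⟨N, hN⟩ := phiMid_trunc h.bound h.spanned₂ h.spanned₃ a w₂ w₃ 0 n
    obtain ⟨N', hN'⟩ := Y₃.truncation a w₃
    refine ⟨max N N', fun m hm => ?_⟩
    have := hN m 0 (by omega)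
    rw [Int.cast_zero, add_zero] at this
    rw [h.commutator, this, hN' m (by omega), map_zero, add_zero]
  · obtain ⟨N, hN⟩ := hx
    obtain ⟨N', hN'⟩ := hy
    exact ⟨max N N', fun m hm => by rw [map_add, hN m (by omega), hN' m (by omega), add_zero]⟩

theorem cosetTrunc_comp (h : PhiData F G φ) (a b : V) {Φ : ℂ → W₁ →ₗ[ℂ] W₄} (hΦ : Φ ∈ spaceM F G) :
    CosetTrunc fun x y => rightAction Y₁ Y₄ a x (rightAction Y₁ Y₄ b y Φ) := by
  intro n
  obtain ⟨N, hN⟩ := h.truncation b hΦ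
  exact ⟨(N - n).toNat, fun i hi x => by simp only [hN (n + i) (by omega), map_zero]⟩

theorem jacobi (h : PhiData F G φ) (a b : V) {Φ : ℂ → W₁ →ₗ[ℂ] W₄}
    (hΦ : Φ ∈ spaceM F G) (l m n : ℤ) :
    assocSum (fun x j => rightAction Y₁ Y₄ (A.mode j a b) x Φ) l m n =
      compSum Y₁ Y₄ Φ a b l m n - (-1 : ℂ) ^ l • compSum Y₁ Y₄ Φ b a l n m := by
  refine h.spec.spaceM_induction h.spanned₄ (p := fun Φ =>
    assocSum (fun x j => rightAction Y₁ Y₄ (A.mode j a b) x Φ) l m n =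
      compSum Y₁ Y₄ Φ a b l m n - (-1 : ℂ) ^ l • compSum Y₁ Y₄ Φ b a l n m)
    (fun k w₂ w₃ => ?_) (fun x hx y hy hx' hy' => ?_) hΦ
  · exact rightAction_jacobi_phi h.commutator h.bound h.spanned₂ h.spanned₃ a b w₂ w₃ l m n k
  · have h1 := assocSum_add (upperTrunc_rightAction_mode (A := A) (Y₁ := Y₁) (Y₄ := Y₄) a b x)
      (upperTrunc_rightAction_mode (A := A) (Y₁ := Y₁) (Y₄ := Y₄) a b y) l m n
    have h2 := commSum_add (h.cosetTrunc_comp a b hx) (h.cosetTrunc_comp a b hy) l m n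
    have h3 := commSum_add (h.cosetTrunc_comp b a hx) (h.cosetTrunc_comp b a hy) l n m
    unfold compSum at hx' hy' ⊢
    simp only [map_add]
    rw [h1, h2, h3, hx', hy', smul_add]
    abel

end PhiData

/-- The action `∘_r` on `M`. -/
noncomputable def PhiData.act (h : PhiData F G φ) (n : ℤ) :
    V →ₗ[ℂ] spaceM F G →ₗ[ℂ] spaceM F G where
  toFun a := (rightAction Y₁ Y₄ a n).restrict fun _ hΦ =>
    rightAction_mem_spaceM h.spec h.commutator h.spanned₄ a n hΦ
  map_add' a b := LinearMap.ext fun Φ => Subtype.ext (rightAction_add_left a b n Φ.1)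
  map_smul' c a := LinearMap.ext fun Φ => Subtype.ext (rightAction_smul_left c a n Φ.1)

theorem PhiData.coe_act (h : PhiData F G φ) (n : ℤ) (a : V) (Φ : spaceM F G) :
    (h.act n a Φ : ℂ → W₁ →ₗ[ℂ] W₄) = rightAction Y₁ Y₄ a n Φ := rfl

/-- The weak module `M`. -/
noncomputable def PhiData.weakModule (h : PhiData F G φ) : WeakModule A (spaceM F G) where
  act := h.act
  vac_act n Φ := by
    refine Subtype.ext ?_
    rw [h.coe_act, rightAction_vac]
    split_ifs <;> rfl
  truncation a Φ := by
    obtain ⟨N, hN⟩ := h.truncation a Φ.2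
    exact ⟨N, fun n hn => Subtype.ext (hN n hn)⟩
  derivative a n := LinearMap.ext fun Φ => Subtype.ext (rightAction_derivative a n Φ.1)
  jacobi a b Φ l m n := by
    have T1 : UpperTrunc fun x j => h.act x (A.mode j a b) Φ := by
      obtain ⟨B, hB⟩ := A.truncation a b
      exact ⟨B, fun j hj x => by simp [hB j hj]⟩
    have T2 : ∀ a b : V, CosetTrunc fun x y => h.act x a (h.act y b Φ) := by
      intro a b n
      obtain ⟨N, hN⟩ := h.truncation b Φ.2
      exact ⟨(N - n).toNat, fun i hi x => by
        have := show h.act (n + i) b Φ = 0 from Subtype.ext (hN (n + i) (by omega))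
        simp only [this, map_zero]⟩
    have key : assocSum (fun x j => h.act x (A.mode j a b) Φ) l m n =
        commSum (fun x y => h.act x a (h.act y b Φ)) l m n -
        (-1 : ℂ) ^ l • commSum (fun x y => h.act x b (h.act y a Φ)) l n m := by
      refine (spaceM F G).subtype_injective ?_
      rw [map_assocSum _ T1, map_sub, map_smul, map_commSum _ (T2 a b), map_commSum _ (T2 b a)]
      exact h.jacobi a b Φ.2 l m n
    unfold assocSum commSum at key
    simp only [Int.cast_id] at key
    rw [key, smul_finsum]
    simp only [smul_smul, mul_assoc]

end Phi

end DLM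

/-! ### `φ` as an intertwining operator into `M` -/

namespace DLM

theorem coe_restrict_sub_pow {E : Type u} [AddCommGroup E] [Module ℂ E] {L : End ℂ E}
    {M : Submodule ℂ E} (hL : ∀ x ∈ M, L x ∈ M) (h : ℂ) (n : ℕ) (x : M) :
    ((((L.restrict hL) - algebraMap ℂ (End ℂ M) h) ^ n) x : E) =
      ((L - algebraMap ℂ (End ℂ E) h) ^ n) x := by
  induction n generalizing x with
  | zero => rfl
  | succ n ih =>
    rw [pow_succ, pow_succ, Module.End.mul_apply, Module.End.mul_apply, ih]
    rfl

theorem map_eigenspace_restrict {E : Type u} [AddCommGroup E] [Module ℂ E] {L : End ℂ E}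
    {M : Submodule ℂ E} (hL : ∀ x ∈ M, L x ∈ M) (h : ℂ) :
    Submodule.map M.subtype (End.eigenspace (L.restrict hL) h ⊓ ⊤) = End.eigenspace L h ⊓ M := by
  ext x
  simp only [Submodule.mem_map, Submodule.mem_inf, Submodule.mem_top, and_true,
    End.mem_eigenspace_iff, Submodule.subtype_apply]
  constructor
  · rintro ⟨y, hy, rfl⟩
    exact ⟨congrArg Subtype.val hy, y.2⟩
  · rintro ⟨hx, hM⟩
    exact ⟨⟨x, hM⟩, Subtype.ext hx, rfl⟩

/-- The hypothesis on `M` speaks of a subspace of the ambient space of series, on which no module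
structure is assumed. Membership in the category needs the same condition for the restricted
operator on `M` itself. -/
theorem VCat.Holds.restrict {D : VCat} {E : Type u} [AddCommGroup E] [Module ℂ E] {L : End ℂ E}
    {M : Submodule ℂ E} (hL : ∀ x ∈ M, L x ∈ M) (h : D.Holds L M) :
    D.Holds (L.restrict hL) ⊤ := by
  have hinj : Function.Injective M.subtype := M.subtype_injective
  have hmap := map_eigenspace_restrict hL
  cases D with
  | C =>
    obtain ⟨h1, h2, h3⟩ := h
    refine ⟨?_, fun μ => ?_, fun μ => ?_⟩
    · refine Submodule.map_injective_of_injective hinj ?_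
      rw [Submodule.map_iSup]
      simp only [hmap]
      rw [← h1, Submodule.map_top, Submodule.range_subtype]
    · have := h2 μ
      rw [← hmap] at this
      exact (Submodule.equivMapOfInjective M.subtype hinj _).symm.finiteDimensional
    · obtain ⟨N, hN⟩ := h3 μ
      refine ⟨N, fun n hn => Submodule.map_injective_of_injective hinj ?_⟩
      rw [hmap, hN n hn, Submodule.map_bot]
  | C1 =>
    obtain ⟨h1, S, hS⟩ := h
    refine ⟨fun x _ => ?_, S, ?_⟩
    · obtain ⟨U, hUM, hU, hxU, hLU⟩ := h1 x x.2
      refine ⟨U.comap M.subtype, le_top, ?_, hxU, fun y hy => hLU y hy⟩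
      have : FiniteDimensional ℂ (Submodule.map M.subtype (U.comap M.subtype)) := by
        rwa [Submodule.map_comap_subtype, inf_eq_right.mpr hUM]
      exact (Submodule.equivMapOfInjective M.subtype hinj _).symm.finiteDimensional
    · rintro μ ⟨x, -, hx, n, hn⟩
      refine hS μ ⟨x, x.2, fun h => hx (Subtype.ext h), n, ?_⟩
      rw [← coe_restrict_sub_pow hL, hn]
      rfl

section Phi

variable {V : Type v} [AddCommGroup V] [Module ℂ V] {A : VOA V}
variable {W₁ : Type u} [AddCommGroup W₁] [Module ℂ W₁] {Y₁ : WeakModule A W₁}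
variable {W₂ : Type u} [AddCommGroup W₂] [Module ℂ W₂] {Y₂ : WeakModule A W₂}
variable {W₃ : Type u} [AddCommGroup W₃] [Module ℂ W₃] {Y₃ : WeakModule A W₃}
variable {W₄ : Type u} [AddCommGroup W₄] [Module ℂ W₄] {Y₄ : WeakModule A W₄}
variable {W₅ : Type u} [AddCommGroup W₅] [Module ℂ W₅] {Y₅ : WeakModule A W₅}
variable {F : IntertwiningOperator Y₁ Y₂ Y₅} {G : IntertwiningOperator Y₅ Y₃ Y₄}
variable {φ : ℂ → W₂ →ₗ[ℂ] W₃ →ₗ[ℂ] (ℂ → W₁ →ₗ[ℂ] W₄)}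

theorem PhiSpec.derivative_z₁ (hφ : PhiSpec F G φ) (h₄ : Y₄.Spanned) (n r : ℂ) (w₂ : W₂)
    (w₃ : W₃) (w₁ : W₁) :
    φ n w₂ w₃ r (Y₁.L (-1) w₁) = -r • φ n w₂ w₃ (r - 1) w₁ := by
  refine h₄.eq_of_memDual fun w' hw' => ?_
  rw [map_smul, smul_eq_mul]
  refine (hφ (Y₁.L (-1) w₁) w₂ w₃ w' hw').unique
    ((hφ w₁ w₂ w₃ w' hw').deriv_z₁.congr (fun p n => ?_) fun _ _ => rfl) r n
  unfold iterModes
  rw [F.derivative]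
  simp only [LinearMap.smul_apply, map_smul, smul_eq_mul]

/-- On series of total degree `-d - 2` Euler's relation gives `∂/∂z₂ = z₂⁻¹ (-(d + 2) - z₁ ∂/∂z₁)`,
so no second analytic argument is needed. On the iterate side, where `z₀ = z₁ - z₂`, the derivative
at fixed `z₁` is `∂/∂z₂ - ∂/∂z₀`. -/
theorem ModeE12.deriv_z₂ {α β : ℂ → ℂ → ℂ} (h : ModeE12 α β) {d : ℂ}
    (hd : ∀ p n, α p n ≠ 0 → p + n = d) :
    ModeE12 (fun p n => -n * α p (n - 1) + p * α (p - 1) n) (fun r n => -n * β r (n - 1)) := by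
  have h1 := (h.deriv_z₁.shift_z₁.shift_z₂ (-1)).const_mul (-1)
  have h2 := (h.shift_z₂ (-1)).const_mul (-(d + 2))
  refine (h1.add h2).congr (fun p n => ?_) (fun r n => ?_)
  · simp only [← sub_eq_add_neg n 1, sub_add_cancel, add_sub_cancel_right]
    by_cases h0 : α p (n - 1) = 0
    · rw [h0]
      ring
    · rw [← hd _ _ h0]
      ring
  · simp only [← sub_eq_add_neg n 1, add_sub_cancel_right]
    by_cases h0 : β r (n - 1) = 0
    · rw [h0]
      ring
    · rw [← h.support hd h0]
      ring

/-- `L(-1)` acts as a derivation on `F(w₁,z₀)w₂`, so its action on `w₂` is its action on the product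
minus its action on `w₁`. -/
theorem iterModes_L_neg_one (w' : Dual ℂ W₄) (w₁ : W₁) (w₂ : W₂) (w₃ : W₃) (p n : ℂ) :
    iterModes F G w' w₁ (Y₂.L (-1) w₂) w₃ p n =
      -n * iterModes F G w' w₁ w₂ w₃ p (n - 1) + p * iterModes F G w' w₁ w₂ w₃ (p - 1) n := by
  have h1 : F.mode p w₁ (Y₂.L (-1) w₂) =
      Y₅.L (-1) (F.mode p w₁ w₂) - F.mode p (Y₁.L (-1) w₁) w₂ := by
    have := F.commutator A.conf w₁ w₂ 0 p
    rw [assocSum_zero] at this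
    exact eq_sub_of_add_eq this.symm
  unfold iterModes
  rw [h1, F.derivative, map_sub, G.derivative]
  simp only [LinearMap.smul_apply, LinearMap.sub_apply, map_sub, map_smul, smul_eq_mul]
  ring

theorem PhiData.derivative_z₂ (h : PhiData F G φ) (n : ℂ) (w₂ : W₂) :
    φ n (Y₂.L (-1) w₂) = -n • φ (n - 1) w₂ := by
  ext w₃ : 1
  funext r
  ext w₁
  simp only [LinearMap.smul_apply, Pi.smul_apply]
  refine h.spanned₂.induction (p := fun w₂ => φ n (Y₂.L (-1) w₂) w₃ r w₁ =
    -n • φ (n - 1) w₂ w₃ r w₁) (fun d₂ w₂ hw₂ => ?_) (fun x y hx hy => ?_) w₂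
  · refine h.spanned₃.induction (p := fun w₃ => φ n (Y₂.L (-1) w₂) w₃ r w₁ =
      -n • φ (n - 1) w₂ w₃ r w₁) (fun d₃ w₃ hw₃ => ?_) (fun x y hx hy => ?_) w₃
    · refine h.spanned₁.induction (p := fun w₁ => φ n (Y₂.L (-1) w₂) w₃ r w₁ =
        -n • φ (n - 1) w₂ w₃ r w₁) (fun d₁ w₁ hw₁ => ?_) (fun x y hx hy => ?_) w₁
      · rw [← sub_eq_zero]
        refine h.spanned₄.eq_zero_of_dual fun μ w' hw' => ?_
        rw [map_sub, map_smul, smul_eq_mul, sub_eq_zero]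
        have h1 := (h.spec w₁ w₂ w₃ w' hw'.memDual).deriv_z₂
          (iterModes_support hw₁ hw₂ hw₃ hw')
        exact (h.spec w₁ (Y₂.L (-1) w₂) w₃ w' hw'.memDual).unique (h1.congr
          (fun p n => (iterModes_L_neg_one w' w₁ w₂ w₃ p n).symm) fun _ _ => rfl) r n
      · rw [map_add, map_add, hx, hy, smul_add]
    · simp only [map_add, Pi.add_apply, LinearMap.add_apply, hx, hy, smul_add]
  · simp only [map_add, Pi.add_apply, LinearMap.add_apply, hx, hy, smul_add]

theorem PhiData.mem_category (h : PhiData F G φ) {D : VCat} (hM : SpaceMInCategory D F G) :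
    D.Mem h.weakModule :=
  VCat.Holds.restrict (fun _ hΦ => rightAction_mem_spaceM h.spec h.commutator h.spanned₄ A.conf 1
    hΦ) hM

/-- `φ` as an intertwining operator. -/
noncomputable def PhiData.intertwiner (h : PhiData F G φ) :
    IntertwiningOperator Y₂ Y₃ h.weakModule where
  mode n := LinearMap.mk₂ ℂ (fun w₂ w₃ => ⟨φ n w₂ w₃, h.spec.mem_spaceM h.spanned₄ n w₂ w₃⟩)
    (fun x y z => Subtype.ext (by simp)) (fun c x y => Subtype.ext (by simp))
    (fun x y z => Subtype.ext (by simp)) (fun c x y => Subtype.ext (by simp))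
  truncation α w₂ w₃ := by
    obtain ⟨N, hN⟩ := h.bound.trunc h.spanned₂ h.spanned₃ α w₂ w₃
    exact ⟨N, fun n hn => Subtype.ext (hN n hn)⟩
  derivative w₂ n := LinearMap.ext fun w₃ => Subtype.ext
    (by
      have := congrArg (fun f => f w₃) (h.derivative_z₂ n w₂)
      simpa using this)
  jacobi a w₂ w₃ l m n := by
    let ι : ℂ → W₂ → W₃ → spaceM F G := fun n w₂ w₃ =>
      ⟨φ n w₂ w₃, h.spec.mem_spaceM h.spanned₄ n w₂ w₃⟩
    have T1 : UpperTrunc fun x k => ι x (Y₂.act k a w₂) w₃ := by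
      obtain ⟨B, hB⟩ := upperTrunc_phi (Y₂ := Y₂) (φ := φ) a w₂ w₃
      exact ⟨B, fun k hk x => Subtype.ext (hB k hk x)⟩
    have T2 : CosetTrunc fun x y => h.weakModule.act x a (ι y w₂ w₃) := by
      intro k
      obtain ⟨N, hN⟩ := h.bound.trunc h.spanned₂ h.spanned₃ k w₂ w₃
      refine ⟨N.toNat, fun i hi x => ?_⟩
      have := hN i (by omega)
      rw [Int.cast_natCast] at this
      have h0 : ι (k + i) w₂ w₃ = 0 := Subtype.ext this
      simp only [h0, map_zero]
    have T3 : CosetTrunc fun x y => ι x w₂ (Y₃.act y a w₃) := by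
      intro k
      obtain ⟨B, hB⟩ := Y₃.truncation a w₃
      refine ⟨(B - k).toNat, fun i hi x => Subtype.ext ?_⟩
      have := hB (k + i) (by omega)
      simp [ι, this]
    have key : assocSum (fun x k => ι x (Y₂.act k a w₂) w₃) l m n =
        commSum (fun x y => h.weakModule.act x a (ι y w₂ w₃)) l m n -
        (-1 : ℂ) ^ l • commSum (fun x y => ι x w₂ (Y₃.act y a w₃)) l n m := by
      refine (spaceM F G).subtype_injective ?_
      rw [map_assocSum _ T1, map_sub, map_smul, map_commSum _ T2, map_commSum _ T3]
      have := phiDefect_eq_zero h.spec h.bound h.spanned₂ h.spanned₃ h.spanned₄ h.lowerTrunc₄ a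
        w₂ w₃ l m n
      unfold phiDefect jacobiForm at this
      rw [← sub_eq_zero, ← this]
      simp only [Submodule.subtype_apply, ι]
      rw [← sub_add]
      rfl
    unfold assocSum commSum at key
    simp only [Int.cast_id] at key
    simp only [LinearMap.mk₂_apply]
    rw [key, smul_finsum]
    simp only [smul_smul, mul_assoc]
    rfl

end Phi

end DLM

/-! ### Iterates with the action of `a` expanded at infinity -/

namespace DLM

section Sums

variable {X : Type*} [AddCommGroup X] [Module ℂ X] {R : Type*} [CommRing R]

theorem assocSum_natCast (g : R → ℤ → X) (l : ℤ) (m : ℕ) (n : R) :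
    assocSum g l m n = ∑ i ∈ Finset.range (m + 1),
      ((Ring.choose (m : ℤ) i : ℤ) : ℂ) • g ((m : ℤ) + n - i) (l + i) :=
  finsum_eq_sum_range fun i hi => by
    rw [Ring.choose_natCast, Nat.choose_eq_zero_of_lt (by omega)]
    simp

theorem assocSum_natCast_add (g g' : R → ℤ → X) (l : ℤ) (m : ℕ) (n : R) :
    assocSum (fun x k => g x k + g' x k) l m n = assocSum g l m n + assocSum g' l m n := by
  simp only [assocSum_natCast, smul_add, Finset.sum_add_distrib]

theorem assocSum_natCast_sub (g g' : R → ℤ → X) (l : ℤ) (m : ℕ) (n : R) :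
    assocSum (fun x k => g x k - g' x k) l m n = assocSum g l m n - assocSum g' l m n := by
  simp only [assocSum_natCast, smul_sub, Finset.sum_sub_distrib]

/-- Pascal's rule with no truncation hypothesis: for natural upper index the binomial sums are
finite by themselves. -/
theorem assocSum_natCast_succ (g : R → ℤ → X) (l : ℤ) (m : ℕ) (n : R) :
    assocSum g l (m + 1 : ℕ) n =
      assocSum g l m (n + 1) + assocSum (fun x k => g x (k + 1)) l m n := by
  -- Cutting `g` off beyond the indices that occur makes the truncated form of Pascal's rule
  -- applicable.
  let g' : R → ℤ → X := fun x k => if k < l + m + 2 then g x k else 0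
  have hg' : UpperTrunc g' := ⟨l + m + 2, fun k hk x => if_neg (by omega)⟩
  have e1 : ∀ (j : ℕ), j ≤ m + 1 → ∀ n, assocSum g l j n = assocSum g' l j n := by
    intro j hj n
    rw [assocSum_natCast, assocSum_natCast]
    refine Finset.sum_congr rfl fun i hi => ?_
    rw [Finset.mem_range] at hi
    simp only [g']
    rw [if_pos (by omega)]
  have e2 : assocSum (fun x k => g x (k + 1)) l m n = assocSum (fun x k => g' x (k + 1)) l m n := by
    rw [assocSum_natCast, assocSum_natCast]
    refine Finset.sum_congr rfl fun i hi => ?_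
    rw [Finset.mem_range] at hi
    simp only [g']
    rw [if_pos (by omega)]
  rw [e2, e1 _ le_rfl, e1 m (by omega), ← assocSum_shift, assocSum_succ hg', Nat.cast_succ]
  abel

end Sums

section NatSteps

variable {X Z : Type*} [AddCommGroup X] [AddCommGroup Z] {R : Type*} [CommRing R]

theorem iterate_natStep_add (f g : ℕ → R → X) (N : ℕ) :
    natStep^[N] (fun m r => f m r + g m r) =
      fun m r => natStep^[N] f m r + natStep^[N] g m r := by
  induction N with
  | zero => rfl
  | succ N ih =>
    rw [Function.iterate_succ_apply', Function.iterate_succ_apply', Function.iterate_succ_apply',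
      ih]
    funext m r
    simp only [natStep]
    abel

theorem map_iterate_natStep (e : X →+ Z) (f : ℕ → R → X) (N m : ℕ) (r : R) :
    e (natStep^[N] f m r) = natStep^[N] (fun m r => e (f m r)) m r := by
  induction N generalizing m r with
  | zero => rfl
  | succ N ih =>
    rw [Function.iterate_succ_apply', Function.iterate_succ_apply', natStep, map_sub, ih, ih]
    rfl

theorem iterate_natStep_zero_index {F : ℕ → ℕ → R → X}
    (h : ∀ N m r, F (N + 1) m r = F N (m + 1) r - F N m (r + 1)) (N : ℕ) :
    natStep^[N] (F 0) = F N := by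
  induction N with
  | zero => rfl
  | succ N ih =>
    rw [Function.iterate_succ_apply', ih]
    funext m r
    exact (h N m r).symm

end NatSteps

theorem modeE12_iterate_natStep {β : ℕ → ℂ → ℂ → ℂ} {γ : ℕ → ℕ → ℂ → ℂ → ℂ}
    (h : ∀ m, ModeE12 (γ 0 m) (β m))
    (hs : ∀ N m p q, γ (N + 1) m p q = γ N (m + 1) p q - γ N m p (q + 1)) (N m : ℕ) :
    ModeE12 (γ N m) (fun r k => natStep^[N] (fun m k => β m r k) m k) := by
  induction N generalizing m with
  | zero => exact h m
  | succ N ih =>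
    refine ((ih (m + 1)).sub ((ih m).shift_z₂ 1)).congr (fun p q => (hs N m p q).symm) fun r k => ?_
    rw [Function.iterate_succ_apply']
    rfl

section Phi

variable {V : Type v} [AddCommGroup V] [Module ℂ V] {A : VOA V}
variable {W₁ : Type u} [AddCommGroup W₁] [Module ℂ W₁] {Y₁ : WeakModule A W₁}
variable {W₂ : Type u} [AddCommGroup W₂] [Module ℂ W₂] {Y₂ : WeakModule A W₂}
variable {W₃ : Type u} [AddCommGroup W₃] [Module ℂ W₃] {Y₃ : WeakModule A W₃}
variable {W₄ : Type u} [AddCommGroup W₄] [Module ℂ W₄] {Y₄ : WeakModule A W₄}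
variable {W₅ : Type u} [AddCommGroup W₅] [Module ℂ W₅] {Y₅ : WeakModule A W₅}
variable {F : IntertwiningOperator Y₁ Y₂ Y₅} {G : IntertwiningOperator Y₅ Y₃ Y₄}
variable {φ : ℂ → W₂ →ₗ[ℂ] W₃ →ₗ[ℂ] (ℂ → W₁ →ₗ[ℂ] W₄)}

theorem cosetTrunc_act_mode (G : IntertwiningOperator Y₅ Y₃ Y₄) (a : V) (u : W₅) (w₃ : W₃) :
    CosetTrunc fun (x : ℤ) (z : ℂ) => Y₄.act x a (G.mode z u w₃) := by
  intro z
  obtain ⟨B, hB⟩ := G.truncation z u w₃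
  refine ⟨B.toNat, fun i hi x => ?_⟩
  have := hB i (by omega)
  rw [Int.cast_natCast] at this
  simp only [this, map_zero]

theorem iterLeft_natCast_succ (a : V) (w₁ : W₁) (w₂ : W₂) (w₃ : W₃) (l : ℤ) (m : ℕ) (p q : ℂ) :
    iterLeft F G a w₁ w₂ w₃ l 0 (m + 1 : ℕ) p q = iterLeft F G a w₁ w₂ w₃ l 0 m p (q + 1) +
      (iterLeft F G a w₁ w₂ w₃ (l + 1) 0 m p q + iterLeft F G a w₁ w₂ w₃ l 0 m (p + 1) q) := by
  unfold iterLeft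
  rw [assocSum_natCast_succ, ← assocSum_natCast_add (fun x k => G.mode x
    (leftSum F a w₁ w₂ (l + 1) k p) w₃)]
  simp only [leftSum_succ, map_sub, LinearMap.sub_apply, sub_add_cancel]

/-- Both sides carry the factor `x^m (x - z₁)^l`. For `m = 0` this is the definition of `φ` at `a_l
w₁`, and `x = z₁ + (x - z₁)` raises `m`. -/
theorem modeE12_iterLeft (hφ : PhiSpec F G φ) (a : V) (w₁ : W₁) (w₂ : W₂) (w₃ : W₃)
    {w' : Dual ℂ W₄} (hw' : Y₄.MemDual w') (m : ℕ) (l : ℤ) :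
    ModeE12 (fun p q => w' (iterLeft F G a w₁ w₂ w₃ l 0 m p q))
      (fun r k => w' (assocSum (fun x j => φ k w₂ w₃ x (Y₁.act j a w₁)) l m r)) := by
  induction m generalizing l with
  | zero =>
    refine (hφ (Y₁.act l a w₁) w₂ w₃ w' hw').congr (fun p q => ?_) fun r k => ?_
    · rw [iterLeft, Nat.cast_zero, assocSum_zero, leftSum, assocSum_zero]
      rfl
    · rw [Nat.cast_zero, assocSum_zero]
  | succ m ih =>
    have h1 := (((ih l).shift_z₁).add (ih (l + 1)))
    refine h1.congr (fun p q => ?_) fun r k => ?_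
    · rw [iterLeft_natCast_succ, map_add, map_add]
      ring
    · rw [assocSum_succ (upperTrunc_apply_act _ a w₁), map_sub, Nat.cast_succ]
      ring

/-- The action of `a` on an iterate, expanded at infinity. -/
noncomputable def outerSum (F : IntertwiningOperator Y₁ Y₂ Y₅) (G : IntertwiningOperator Y₅ Y₃ Y₄)
    (a : V) (w₁ : W₁) (w₂ : W₂) (w₃ : W₃) (l m : ℤ) (p q : ℂ) : W₄ :=
  commSum (fun k y => commSum (fun x z => Y₄.act x a (G.mode z (F.mode y w₁ w₂) w₃)) k m q) l
    (0 : ℤ) p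

theorem cosetTrunc_outerSum (F : IntertwiningOperator Y₁ Y₂ Y₅) (G : IntertwiningOperator Y₅ Y₃ Y₄)
    (a : V) (w₁ : W₁) (w₂ : W₂) (w₃ : W₃) (m : ℤ) (q : ℂ) :
    CosetTrunc fun (k : ℤ) (y : ℂ) =>
      commSum (fun x z => Y₄.act x a (G.mode z (F.mode y w₁ w₂) w₃)) k m q := by
  intro p
  obtain ⟨B, hB⟩ := F.truncation p w₁ w₂
  refine ⟨B.toNat, fun i hi x => commSum_eq_zero fun j => ?_⟩
  have := hB i (by omega)
  rw [Int.cast_natCast] at this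
  simp only [this, map_zero, LinearMap.zero_apply]

/-- The two nested sums expand `((x - z₂) - z₀)^l` for `x` large, so raising `l` is multiplication
by `x - z₁`. -/
theorem outerSum_succ (a : V) (w₁ : W₁) (w₂ : W₂) (w₃ : W₃) (l m : ℤ) (p q : ℂ) :
    outerSum F G a w₁ w₂ w₃ (l + 1) m p q = outerSum F G a w₁ w₂ w₃ l (m + 1) p q -
      (outerSum F G a w₁ w₂ w₃ l m (p + 1) q + outerSum F G a w₁ w₂ w₃ l m p (q + 1)) := by
  unfold outerSum
  rw [commSum_succ (cosetTrunc_outerSum F G a w₁ w₂ w₃ m q), commSum_shift_left]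
  have h1 : ∀ (k : ℤ) (y : ℂ),
      commSum (fun x z => Y₄.act x a (G.mode z (F.mode y w₁ w₂) w₃)) (k + 1) m q =
      commSum (fun x z => Y₄.act x a (G.mode z (F.mode y w₁ w₂) w₃)) k (m + 1) q -
      commSum (fun x z => Y₄.act x a (G.mode z (F.mode y w₁ w₂) w₃)) k m (q + 1) := fun k y =>
    commSum_succ (cosetTrunc_act_mode G a _ w₃) k m q
  simp only [h1]
  rw [commSum_sub (cosetTrunc_outerSum F G a w₁ w₂ w₃ (m + 1) q)
    (cosetTrunc_outerSum F G a w₁ w₂ w₃ m (q + 1))]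
  abel

theorem PhiData.cosetTrunc_act (h : PhiData F G φ) (a : V) (w₁ : W₁) (w₂ : W₂) (w₃ : W₃) (k : ℂ) :
    CosetTrunc fun (x : ℤ) (y : ℂ) => Y₄.act x a (φ k w₂ w₃ y w₁) := by
  intro r
  obtain ⟨B, hB⟩ := h.spec.trunc_z₁ h.spanned₁ h.spanned₂ h.spanned₃ h.spanned₄ h.lowerTrunc₄ k r
    w₂ w₃ w₁
  refine ⟨B.toNat, fun i hi x => ?_⟩
  have := hB i (by omega)
  rw [Int.cast_natCast] at this
  simp only [this, map_zero]

/-- The recursion in `l` starts from `l = 0`, where the modes of `a` are absorbed into `w'`. For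
negative `l` it is run backwards and needs an initial value in `m`, supplied by the vanishing of `w'
∘ a_k` for small `k`. -/
theorem PhiData.modeE12_outerSum (h : PhiData F G φ) (a : V) (w₁ : W₁) (w₂ : W₂) (w₃ : W₃)
    {w' : Dual ℂ W₄} (hw' : Y₄.MemDual w') (l m : ℤ) :
    ModeE12 (fun p q => w' (outerSum F G a w₁ w₂ w₃ l m p q))
      (fun r k => w' (commSum (fun x y => Y₄.act x a (φ k w₂ w₃ y w₁)) l m r)) := by
  have base : ∀ m, ModeE12 (fun p q => w' (outerSum F G a w₁ w₂ w₃ 0 m p q))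
      (fun r k => w' (commSum (fun x y => Y₄.act x a (φ k w₂ w₃ y w₁)) 0 m r)) := by
    intro m
    refine (h.spec w₁ w₂ w₃ _ (hw'.comp_act m a)).congr (fun p q => ?_) fun r k => ?_
    · rw [outerSum, commSum_zero, commSum_zero]
      rfl
    · rw [commSum_zero]
      rfl
  have hβ : ∀ (l m : ℤ) (r k : ℂ),
      w' (commSum (fun x y => Y₄.act x a (φ k w₂ w₃ y w₁)) (l + 1) m r) =
      w' (commSum (fun x y => Y₄.act x a (φ k w₂ w₃ y w₁)) l (m + 1) r) -
      w' (commSum (fun x y => Y₄.act x a (φ k w₂ w₃ y w₁)) l m (r + 1)) := by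
    intro l m r k
    rw [commSum_succ (h.cosetTrunc_act a w₁ w₂ w₃ k), map_sub]
  have hα : ∀ (l m : ℤ) (p q : ℂ), w' (outerSum F G a w₁ w₂ w₃ (l + 1) m p q) =
      w' (outerSum F G a w₁ w₂ w₃ l (m + 1) p q) -
      (w' (outerSum F G a w₁ w₂ w₃ l m (p + 1) q) +
        w' (outerSum F G a w₁ w₂ w₃ l m p (q + 1))) := by
    intro l m p q
    rw [outerSum_succ, map_sub, map_add]
  obtain ⟨K, hK⟩ := hw'.exists_lower_bound h.spanned₄ h.lowerTrunc₄ a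
  induction l using Int.induction_on generalizing m with
  | zero => exact base m
  | succ l ih =>
    exact ((ih (m + 1)).sub (ih m).shift_z₁).congr (fun p q => (hα _ _ _ _).symm)
      fun r k => (hβ _ _ _ _).symm
  | pred l ih =>
    have hsmall : ∀ m : ℤ, -(l : ℤ) - 1 + m ≤ K →
        ModeE12 (fun p q => w' (outerSum F G a w₁ w₂ w₃ (-(l : ℤ) - 1) m p q))
        (fun r k => w' (commSum (fun x y => Y₄.act x a (φ k w₂ w₃ y w₁)) (-(l : ℤ) - 1) m r)) := by
      intro m hm
      refine ModeE12.zero.congr (fun p q => ?_) fun r k => ?_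
      · rw [outerSum, map_commSum _ (cosetTrunc_outerSum F G a w₁ w₂ w₃ m q), commSum_eq_zero]
        intro i
        rw [map_commSum _ (cosetTrunc_act_mode G a _ w₃), commSum_eq_zero]
        intro j
        exact hK _ (by simp only [Int.cast_id]; omega) _
      · rw [map_commSum _ (h.cosetTrunc_act a w₁ w₂ w₃ k), commSum_eq_zero]
        intro i
        exact hK _ (by simp only [Int.cast_id]; omega) _
    -- The recursion solved for the larger `m`: the sum at `(l - 1, m)` is the one at `(l, m - 1)`
    -- plus `z₁` times the one at `(l - 1, m - 1)`.
    have hind : ∀ (j : ℕ) (m : ℤ), -(l : ℤ) - 1 + m ≤ K + j →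
        ModeE12 (fun p q => w' (outerSum F G a w₁ w₂ w₃ (-(l : ℤ) - 1) m p q))
        (fun r k => w' (commSum (fun x y => Y₄.act x a (φ k w₂ w₃ y w₁)) (-(l : ℤ) - 1) m r)) := by
      intro j
      induction j with
      | zero => exact fun m hm => hsmall m (by simpa using hm)
      | succ j ihj =>
        intro m hm
        have h1 := ihj (m - 1) (by push_cast at hm; omega)
        refine ((ih (m - 1)).add h1.shift_z₁).congr (fun p q => ?_) fun r k => ?_
        · have := hα (-(l : ℤ) - 1) (m - 1) p q
          rw [sub_add_cancel, sub_add_cancel] at this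
          rw [this]
          ring
        · have := hβ (-(l : ℤ) - 1) (m - 1) r k
          rw [sub_add_cancel, sub_add_cancel] at this
          rw [this]
          ring
    exact hind (-(l : ℤ) - 1 + m - K).toNat m (by omega)

/-- For such `m` the term of the Jacobi identity of `G` in which `a` acts on `w₃` drops out, which
turns the inner sum into an action on `F(w₁,z₀)w₂`. -/
theorem outerSum_eq_assocSum {a : V} {w₃ : W₃} {m : ℕ}
    (h : ∀ k : ℤ, m ≤ k → Y₃.act k a w₃ = 0) (w₁ : W₁) (w₂ : W₂) (l : ℤ) (p q : ℂ) :
    outerSum F G a w₁ w₂ w₃ l m p q = assocSum (fun x i => G.mode x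
      (commSum (fun x y => Y₅.act x a (F.mode y w₁ w₂)) l i p) w₃) 0 m q := by
  obtain ⟨B, hB⟩ := F.truncation p w₁ w₂
  have hB' : ∀ j : ℕ, B.toNat ≤ j → F.mode (p + j) w₁ w₂ = 0 := fun j hj => by
    have := hB j (by omega)
    rwa [Int.cast_natCast] at this
  have h1 : ∀ (u : W₅) (k : ℤ), commSum (fun x z => Y₄.act x a (G.mode z u w₃)) k (m : ℤ) q =
      ∑ i ∈ Finset.range (m + 1), ((Ring.choose (m : ℤ) i : ℤ) : ℂ) •
        G.mode ((m : ℤ) + q - i) (Y₅.act (k + i) a u) w₃ := by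
    intro u k
    have h2 := G.jacobi_sum a u w₃ k m q
    rw [commSum_eq_zero (g := fun x y => G.mode x u (Y₃.act y a w₃)) fun i => by
      rw [h _ (by omega), map_zero], smul_zero, sub_zero] at h2
    rw [← h2, assocSum_natCast]
  rw [outerSum, commSum_eq_sum (g := fun k y => commSum (fun x z => Y₄.act x a
    (G.mode z (F.mode y w₁ w₂) w₃)) k (m : ℤ) q) (B := B.toNat) fun j hj =>
      commSum_eq_zero fun i => by simp only [hB' j hj, map_zero, LinearMap.zero_apply],
    assocSum_natCast]
  simp only [h1, Finset.smul_sum]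
  rw [Finset.sum_comm]
  refine Finset.sum_congr rfl fun i _ => ?_
  rw [commSum_eq_sum (B := B.toNat) fun j hj => by
    simp only [hB' j hj, map_zero], map_sum, LinearMap.sum_apply, Finset.smul_sum]
  refine Finset.sum_congr rfl fun j _ => ?_
  rw [map_smul, LinearMap.smul_apply, smul_comm]
  simp only [Int.cast_id]
  rw [show (0 : ℤ) + l - j + i = 0 + i + l - j by ring]

/-- The contribution of `w₂` to the action of `a` on `F(w₁, z₀)w₂`. -/
noncomputable def rightSum (F : IntertwiningOperator Y₁ Y₂ Y₅) (a : V) (w₁ : W₁) (w₂ : W₂)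
    (l i : ℤ) (p : ℂ) : W₅ :=
  commSum (fun x y => F.mode x w₁ (Y₂.act y a w₂)) l p i

theorem rightSum_eq_zero {a : V} {w₂ : W₂} {N : ℤ} (h : ∀ k : ℤ, N ≤ k → Y₂.act k a w₂ = 0)
    (w₁ : W₁) (l : ℤ) {i : ℤ} (hi : N ≤ i) (p : ℂ) : rightSum F a w₁ w₂ l i p = 0 :=
  commSum_eq_zero fun j => by rw [h _ (by omega), map_zero]

/-- Once `a` acts only inside `F(w₁,z₀)w₂`, the Jacobi identity of `F` leaves just the action on
`w₂`. -/
theorem iterLeft_sub_outerSum {a : V} {w₃ : W₃} {m : ℕ}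
    (h : ∀ k : ℤ, m ≤ k → Y₃.act k a w₃ = 0) (w₁ : W₁) (w₂ : W₂) (l : ℤ) (p q : ℂ) :
    iterLeft F G a w₁ w₂ w₃ l 0 m p q - outerSum F G a w₁ w₂ w₃ l m p q =
      -(-1 : ℂ) ^ l • assocSum (fun x i => G.mode x (rightSum F a w₁ w₂ l i p) w₃) 0 m q := by
  rw [outerSum_eq_assocSum h, iterLeft, ← assocSum_natCast_sub, assocSum_natCast, assocSum_natCast,
    Finset.smul_sum]
  refine Finset.sum_congr rfl fun i _ => ?_
  rw [leftSum, F.jacobi_sum, smul_comm, ← LinearMap.sub_apply, ← map_sub, sub_sub_cancel_left,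
    ← neg_smul, map_smul, LinearMap.smul_apply]
  rfl

end Phi

end DLM

/-! ### Evaluation as an intertwining operator, and the main theorem -/

namespace DLM

section Phi

variable {V : Type v} [AddCommGroup V] [Module ℂ V] {A : VOA V}
variable {W₁ : Type u} [AddCommGroup W₁] [Module ℂ W₁] {Y₁ : WeakModule A W₁}
variable {W₂ : Type u} [AddCommGroup W₂] [Module ℂ W₂] {Y₂ : WeakModule A W₂}
variable {W₃ : Type u} [AddCommGroup W₃] [Module ℂ W₃] {Y₃ : WeakModule A W₃}
variable {W₄ : Type u} [AddCommGroup W₄] [Module ℂ W₄] {Y₄ : WeakModule A W₄}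
variable {W₅ : Type u} [AddCommGroup W₅] [Module ℂ W₅] {Y₅ : WeakModule A W₅}
variable {F : IntertwiningOperator Y₁ Y₂ Y₅} {G : IntertwiningOperator Y₅ Y₃ Y₄}
variable {φ : ℂ → W₂ →ₗ[ℂ] W₃ →ₗ[ℂ] (ℂ → W₁ →ₗ[ℂ] W₄)}

/-- The defect of the Jacobi identity for the evaluation of `Φ` at `w₁`. -/
noncomputable def evalDefect (Y₁ : WeakModule A W₁) (Y₄ : WeakModule A W₄)
    (Φ : ℂ → W₁ →ₗ[ℂ] W₄) (a : V) (w₁ : W₁) (l m : ℤ) (r : ℂ) : W₄ :=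
  assocSum (fun x j => Φ x (Y₁.act j a w₁)) l m r -
    commSum (fun x y => Y₄.act x a (Φ y w₁)) l m r +
    (-1 : ℂ) ^ l • commSum (fun x y => rightAction Y₁ Y₄ a y Φ x w₁) l r m

/-- The contribution of `w₂` to the action `∘_r`, evaluated at `w₁`. -/
noncomputable def midSum (Y₂ : WeakModule A W₂) (φ : ℂ → W₂ →ₗ[ℂ] W₃ →ₗ[ℂ] (ℂ → W₁ →ₗ[ℂ] W₄))
    (a : V) (w₁ : W₁) (w₂ : W₂) (w₃ : W₃) (l : ℤ) (N : ℕ) (m : ℤ) (r k : ℂ) : W₄ :=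
  commSum (fun x y => phiMid Y₂ φ a w₂ w₃ N y k x w₁) l r m

theorem midSum_succ (hb : PhiBound Y₂ Y₃ φ) (h₂ : Y₂.Spanned) (h₃ : Y₃.Spanned) (a : V) (w₁ : W₁)
    (w₂ : W₂) (w₃ : W₃) (l : ℤ) (N : ℕ) (m : ℤ) (r k : ℂ) :
    midSum Y₂ φ a w₁ w₂ w₃ l (N + 1) m r k = midSum Y₂ φ a w₁ w₂ w₃ l N (m + 1) r k -
      midSum Y₂ φ a w₁ w₂ w₃ l N m r (k + 1) := by
  have T : ∀ (k : ℂ) (c : ℤ), CosetTrunc fun (x : ℂ) (y : ℤ) =>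
      phiMid Y₂ φ a w₂ w₃ N (y + c) k x w₁ := by
    intro k c n
    obtain ⟨B, hB⟩ := phiMid_trunc hb h₂ h₃ a w₂ w₃ N k
    refine ⟨(B - n - c).toNat, fun i hi x => ?_⟩
    have := hB (n + i + c) 0 (by omega)
    rw [Int.cast_zero, add_zero] at this
    simp only [this, Pi.zero_apply, LinearMap.zero_apply]
  have T0 := T (k + 1) 0
  simp only [add_zero] at T0
  unfold midSum
  rw [commSum_shift_right, ← commSum_sub (T k 1) T0]
  simp only [Nat.cast_succ, phiMid_succ, Pi.sub_apply, LinearMap.sub_apply]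

/-- In the third sum the roles of the two variables are exchanged; the resulting sign is compensated
by that of `(-1)^(l + 1)`, so all three sums obey one recursion. -/
theorem evalDefect_succ {a : V} {Φ : ℂ → W₁ →ₗ[ℂ] W₄} {w₁ : W₁}
    (h1 : CosetTrunc fun (x : ℤ) (y : ℂ) => Y₄.act x a (Φ y w₁))
    (h2 : ∃ N : ℤ, ∀ n : ℤ, N ≤ n → rightAction Y₁ Y₄ a n Φ = 0) (l m : ℤ) (r : ℂ) :
    evalDefect Y₁ Y₄ Φ a w₁ (l + 1) m r =
      evalDefect Y₁ Y₄ Φ a w₁ l (m + 1) r - evalDefect Y₁ Y₄ Φ a w₁ l m (r + 1) := by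
  have T3 : CosetTrunc fun (x : ℂ) (y : ℤ) => rightAction Y₁ Y₄ a y Φ x w₁ := by
    obtain ⟨N, hN⟩ := h2
    exact UpperTrunc.cosetTrunc ⟨N, fun k hk x => by
      simp only [hN k hk, Pi.zero_apply, LinearMap.zero_apply]⟩
  unfold evalDefect
  rw [assocSum_succ (upperTrunc_apply_act _ a w₁), commSum_succ h1, commSum_succ T3,
    zpow_add_one₀ (by norm_num), mul_neg_one, neg_smul, smul_sub]
  abel

theorem evalDefect_zero (Φ : ℂ → W₁ →ₗ[ℂ] W₄) (a : V) (w₁ : W₁) (m : ℤ) (r : ℂ) :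
    evalDefect Y₁ Y₄ Φ a w₁ 0 m r = 0 := by
  rw [evalDefect, commSum_zero, commSum_zero, rightAction_apply, zpow_zero, one_smul]
  abel

/-- Going up in `l` is immediate. Going down, the recursion says that `q` is constant along
antidiagonals, and these reach the region of large `m`; the bound must therefore be uniform in `r`.
-/
theorem eq_zero_of_succ {X : Type*} [AddCommGroup X] {q : ℤ → ℤ → ℂ → X}
    (hs : ∀ l m r, q (l + 1) m r = q l (m + 1) r - q l m (r + 1)) (h0 : ∀ m r, q 0 m r = 0)
    (hlarge : ∀ l, ∃ m₁ : ℤ, ∀ m, m₁ ≤ m → ∀ r, q l m r = 0) (l m : ℤ) (r : ℂ) : q l m r = 0 := by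
  induction l using Int.induction_on generalizing m r with
  | zero => exact h0 m r
  | succ l ih => rw [hs, ih, ih, sub_zero]
  | pred l ih =>
    have h1 : ∀ m r, q (-l - 1) m (r + 1) = q (-l - 1) (m + 1) r := fun m r => by
      have := hs (-l - 1) m r
      rw [sub_add_cancel, ih] at this
      exact (sub_eq_zero.mp this.symm).symm
    have h2 : ∀ (j : ℕ) m r, q (-l - 1) m (r + j) = q (-l - 1) (m + j) r := by
      intro j
      induction j with
      | zero => simp
      | succ j ihj =>
        intro m r
        rw [Nat.cast_succ, Nat.cast_succ, ← add_assoc, h1, ihj]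
        congr 1
        ring
    obtain ⟨m₁, hm₁⟩ := hlarge (-l - 1)
    have := h2 (m₁ - m).toNat m (r - (m₁ - m).toNat)
    rw [sub_add_cancel] at this
    rw [this, hm₁ _ (by omega)]

namespace PhiData

/-- For `m ≥ m₀` the element `a` does not see `w₃`. What remains of the defect is its action on
`w₂`, through `rightSum` on the iterate side and through `midSum` in `∘_r`. Both are killed by `(x -
z₂)^N`. -/
theorem iterate_natStep_evalDefect (h : PhiData F G φ) {a : V} {w₂ : W₂} {w₃ : W₃} {m₀ N : ℕ}
    (h₃ : ∀ k : ℤ, m₀ ≤ k → Y₃.act k a w₃ = 0) (h₂ : ∀ k : ℤ, N ≤ k → Y₂.act k a w₂ = 0) (w₁ : W₁)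
    (l : ℤ) (m : ℕ) (k : ℂ) :
    natStep^[N] (fun (m : ℕ) (k : ℂ) (r : ℂ) =>
      evalDefect Y₁ Y₄ (φ k w₂ w₃) a w₁ l (m₀ + m : ℕ) r) m k = 0 := by
  funext r
  refine h.spanned₄.eq_of_memDual fun w' hw' => ?_
  let e : (ℂ → W₄) →+ ℂ := w'.toAddMonoidHom.comp (Pi.evalAddMonoidHom (fun _ => W₄) r)
  refine Eq.trans (map_iterate_natStep e _ N m k) ?_
  rw [Pi.zero_apply, map_zero]
  let β : ℕ → ℂ → ℂ → ℂ := fun m r k =>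
    w' (assocSum (fun x j => φ k w₂ w₃ x (Y₁.act j a w₁)) l (m₀ + m : ℕ) r) -
      w' (commSum (fun x y => Y₄.act x a (φ k w₂ w₃ y w₁)) l ((m₀ + m : ℕ) : ℤ) r)
  let γ : ℕ → ℕ → ℂ → ℂ → ℂ := fun M m p q => -(-1 : ℂ) ^ l *
    w' (assocSum (fun x i => G.mode x (rightSum F a w₁ w₂ l i p) w₃) M (m₀ + m : ℕ) q)
  let δ : ℕ → ℕ → ℂ → ℂ := fun M m k => (-1 : ℂ) ^ l *
    w' (midSum Y₂ φ a w₁ w₂ w₃ l M (m₀ + m : ℕ) r k)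
  have hdec : (fun (m : ℕ) (k : ℂ) => e fun r =>
      evalDefect Y₁ Y₄ (φ k w₂ w₃) a w₁ l (m₀ + m : ℕ) r) =
      fun m k => (fun m k => β m r k) m k + δ 0 m k := by
    funext m k
    -- By the commutator formula; its `w₃`-term has mode index at least `m₀` and vanishes.
    have hmid : commSum (fun x y => rightAction Y₁ Y₄ a y (φ k w₂ w₃) x w₁) l r
        ((m₀ + m : ℕ) : ℤ) = midSum Y₂ φ a w₁ w₂ w₃ l 0 (m₀ + m : ℕ) r k :=
      commSum_congr fun i => by
        rw [h.commutator, h₃ _ (by omega), map_zero, zero_add]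
        rfl
    change w' (evalDefect Y₁ Y₄ (φ k w₂ w₃) a w₁ l (m₀ + m : ℕ) r) = _
    rw [evalDefect, hmid, map_add, map_sub, map_smul, smul_eq_mul]
  have hγ : ∀ m, ModeE12 (γ 0 m) (β m) := fun m =>
    ((modeE12_iterLeft h.spec a w₁ w₂ w₃ hw' (m₀ + m) l).sub
      (h.modeE12_outerSum a w₁ w₂ w₃ hw' l (m₀ + m : ℕ))).congr (fun p q => by
        rw [← map_sub, iterLeft_sub_outerSum fun k hk => h₃ k (by omega), map_smul]
        rfl) fun _ _ => rfl
  have hγs : ∀ M m p q, γ (M + 1) m p q = γ M (m + 1) p q - γ M m p (q + 1) := by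
    intro M m p q
    have T : UpperTrunc fun x i => G.mode x (rightSum F a w₁ w₂ l i p) w₃ :=
      ⟨N, fun i hi x => by
        simp only [rightSum_eq_zero h₂ w₁ l hi p, map_zero, LinearMap.zero_apply]⟩
    have := assocSum_succ T M (m₀ + m : ℕ) q
    simp only [γ]
    rw [Nat.cast_succ, this, map_sub, ← Nat.cast_succ, mul_sub]
    rfl
  have hδs : ∀ M m k, δ (M + 1) m k = δ M (m + 1) k - δ M m (k + 1) := by
    intro M m k
    simp only [δ]
    rw [midSum_succ h.bound h.spanned₂ h.spanned₃, map_sub, mul_sub, ← add_assoc, Nat.cast_succ]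
  rw [hdec, iterate_natStep_add, iterate_natStep_zero_index hδs]
  have e1 : natStep^[N] (fun m k => β m r k) m k = 0 := by
    refine (modeE12_iterate_natStep hγ hγs N m).eq_zero (fun p q => ?_) r k
    simp only [γ]
    rw [assocSum_eq_zero, map_zero, mul_zero]
    intro i hi x
    rw [rightSum_eq_zero h₂ w₁ l hi p, map_zero, LinearMap.zero_apply]
  have e2 : δ N m k = 0 := by
    simp only [δ, midSum]
    rw [commSum_eq_zero, map_zero, mul_zero]
    intro i
    rw [phiMid_eq_zero h₂, Pi.zero_apply, LinearMap.zero_apply]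
  simp only [e1, e2, add_zero]

/-- At `l = 0` the identity is the definition of `∘_r`. Treating the family over all `r` as one
function-valued series makes the bound on `m` independent of `r`, as the recursion in `l` demands.
-/
theorem evalDefect_phi (h : PhiData F G φ) (a : V) (w₁ : W₁) (w₂ : W₂) (w₃ : W₃) (k : ℂ) (l m : ℤ)
    (r : ℂ) : evalDefect Y₁ Y₄ (φ k w₂ w₃) a w₁ l m r = 0 := by
  refine eq_zero_of_succ (q := evalDefect Y₁ Y₄ (φ k w₂ w₃) a w₁)
    (evalDefect_succ (h.cosetTrunc_act a w₁ w₂ w₃ k)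
      (h.truncation a (h.spec.mem_spaceM h.spanned₄ k w₂ w₃)))
    (evalDefect_zero _ a w₁) (fun l => ?_) l m r
  obtain ⟨m₀, h₃⟩ := exists_act_eq_zero Y₃ a w₃
  obtain ⟨N, h₂⟩ := exists_act_eq_zero Y₂ a w₂
  obtain ⟨m₁, hm₁⟩ := eventually_eq_zero_of_iterate_natStep
    (f := fun (m : ℕ) (k : ℂ) (r : ℂ) => evalDefect Y₁ Y₄ (φ k w₂ w₃) a w₁ l (m₀ + m : ℕ) r)
    (fun k => by
      obtain ⟨M, hM⟩ := h.bound.trunc h.spanned₂ h.spanned₃ k w₂ w₃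
      refine ⟨M.toNat, fun j hj m => ?_⟩
      have := hM j (by omega)
      rw [Int.cast_natCast] at this
      funext r
      simp only [this, evalDefect, map_zero]
      rw [assocSum_eq_zero_of_forall fun i => rfl, commSum_eq_zero fun i => by simp,
        commSum_eq_zero fun i => rfl]
      simp) N (h.iterate_natStep_evalDefect h₃ h₂ w₁ l) k
  refine ⟨(m₀ + m₁ : ℕ), fun m hm r => ?_⟩
  have := congrFun (hm₁ (m - m₀).toNat (by omega)) r
  rw [Pi.zero_apply] at this
  rw [← this, show ((m₀ + (m - m₀).toNat : ℕ) : ℤ) = m by omega]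

theorem trunc_z₁ (h : PhiData F G φ) {Φ : ℂ → W₁ →ₗ[ℂ] W₄} (hΦ : Φ ∈ spaceM F G) (α : ℂ)
    (w₁ : W₁) : ∃ N : ℤ, ∀ k : ℤ, N ≤ k → Φ (α + k) w₁ = 0 := by
  refine h.spec.spaceM_induction h.spanned₄
    (p := fun Φ => ∃ N : ℤ, ∀ k : ℤ, N ≤ k → Φ (α + k) w₁ = 0)
    (fun n w₂ w₃ => ?_) (fun x _ y _ hx hy => ?_) hΦ
  · exact h.spec.trunc_z₁ h.spanned₁ h.spanned₂ h.spanned₃ h.spanned₄ h.lowerTrunc₄ n α w₂ w₃ w₁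
  · obtain ⟨N, hN⟩ := hx
    obtain ⟨N', hN'⟩ := hy
    exact ⟨max N N', fun k hk => by
      rw [Pi.add_apply, LinearMap.add_apply, hN k (by omega), hN' k (by omega), add_zero]⟩

theorem derivative_z₁ (h : PhiData F G φ) {Φ : ℂ → W₁ →ₗ[ℂ] W₄} (hΦ : Φ ∈ spaceM F G) (r : ℂ)
    (w₁ : W₁) : Φ r (Y₁.L (-1) w₁) = -r • Φ (r - 1) w₁ := by
  refine h.spec.spaceM_induction h.spanned₄
    (p := fun Φ => Φ r (Y₁.L (-1) w₁) = -r • Φ (r - 1) w₁)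
    (fun n w₂ w₃ => h.spec.derivative_z₁ h.spanned₄ n r w₂ w₃ w₁) (fun x _ y _ hx hy => ?_) hΦ
  simp only [Pi.add_apply, LinearMap.add_apply, hx, hy, smul_add]

theorem cosetTrunc_act_apply (h : PhiData F G φ) {Φ : ℂ → W₁ →ₗ[ℂ] W₄} (hΦ : Φ ∈ spaceM F G)
    (a : V) (w₁ : W₁) : CosetTrunc fun (x : ℤ) (y : ℂ) => Y₄.act x a (Φ y w₁) := by
  intro r
  obtain ⟨B, hB⟩ := h.trunc_z₁ hΦ r w₁
  refine ⟨B.toNat, fun i hi x => ?_⟩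
  have := hB i (by omega)
  rw [Int.cast_natCast] at this
  simp only [this, map_zero]

theorem upperTrunc_rightAction (h : PhiData F G φ) {Φ : ℂ → W₁ →ₗ[ℂ] W₄} (hΦ : Φ ∈ spaceM F G)
    (a : V) (w₁ : W₁) : UpperTrunc fun (x : ℂ) (y : ℤ) => rightAction Y₁ Y₄ a y Φ x w₁ := by
  obtain ⟨N, hN⟩ := h.truncation a hΦ
  exact ⟨N, fun k hk x => by simp only [hN k hk, Pi.zero_apply, LinearMap.zero_apply]⟩

theorem evalDefect_eq_zero (h : PhiData F G φ) {Φ : ℂ → W₁ →ₗ[ℂ] W₄} (hΦ : Φ ∈ spaceM F G)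
    (a : V) (w₁ : W₁) (l m : ℤ) (r : ℂ) : evalDefect Y₁ Y₄ Φ a w₁ l m r = 0 := by
  refine h.spec.spaceM_induction h.spanned₄ (p := fun Φ => evalDefect Y₁ Y₄ Φ a w₁ l m r = 0)
    (fun k w₂ w₃ => h.evalDefect_phi a w₁ w₂ w₃ k l m r) (fun x hx y hy hx' hy' => ?_) hΦ
  have e1 := assocSum_add (upperTrunc_apply_act (Y₁ := Y₁) x a w₁)
    (upperTrunc_apply_act (Y₁ := Y₁) y a w₁) l m r
  have e2 := commSum_add (h.cosetTrunc_act_apply hx a w₁) (h.cosetTrunc_act_apply hy a w₁) l m r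
  have e3 := commSum_add (h.upperTrunc_rightAction hx a w₁).cosetTrunc
    (h.upperTrunc_rightAction hy a w₁).cosetTrunc l r m
  have e4 : evalDefect Y₁ Y₄ (x + y) a w₁ l m r =
      evalDefect Y₁ Y₄ x a w₁ l m r + evalDefect Y₁ Y₄ y a w₁ l m r := by
    unfold evalDefect
    simp only [Pi.add_apply, LinearMap.add_apply, map_add]
    rw [e1, e2, e3, smul_add]
    abel
  rw [e4, hx', hy', add_zero]

/-- The evaluation of the operators in `M`, as an intertwining operator. -/
noncomputable def evaluation (h : PhiData F G φ) : IntertwiningOperator Y₁ h.weakModule Y₄ where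
  mode n := LinearMap.mk₂ ℂ (fun w₁ Φ => (Φ : ℂ → W₁ →ₗ[ℂ] W₄) n w₁)
    (fun x y z => by simp) (fun c x y => by simp) (fun x y z => by simp) (fun c x y => by simp)
  truncation α w₁ Φ := h.trunc_z₁ Φ.2 α w₁
  derivative w₁ n := LinearMap.ext fun Φ => h.derivative_z₁ Φ.2 n w₁
  jacobi a w₁ Φ l m n := by
    have key := h.evalDefect_eq_zero Φ.2 a w₁ l m n
    rw [evalDefect, sub_add, sub_eq_zero] at key
    unfold assocSum commSum at key
    simp only [Int.cast_id] at key
    simp only [LinearMap.mk₂_apply]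
    rw [key, smul_finsum]
    simp only [smul_smul, mul_assoc]
    rfl

end PhiData

/-- The composition of an intertwining operator with a homomorphism into the second module. -/
def IntertwiningOperator.compHom (I : IntertwiningOperator Y₁ Y₂ Y₃) {f : W₄ →ₗ[ℂ] W₂}
    (hf : IsHom Y₄ Y₂ f) : IntertwiningOperator Y₁ Y₄ Y₃ where
  mode n := (I.mode n).compl₂ f
  truncation α w u := I.truncation α w (f u)
  derivative w n := by
    ext u
    simp [I.derivative]
  jacobi a w u l m n := by
    have := I.jacobi a w (f u) l m n
    simpa only [LinearMap.compl₂_apply, hf _ _ _] using this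

theorem IntertwiningOperator.compHom_mode (I : IntertwiningOperator Y₁ Y₂ Y₃) {f : W₄ →ₗ[ℂ] W₂}
    (hf : IsHom Y₄ Y₂ f) (n : ℂ) (w : W₁) (u : W₄) :
    (I.compHom hf).mode n w u = I.mode n w (f u) := rfl

end Phi

end DLM

theorem proposition3p14 {V : Type v} [AddCommGroup V] [Module ℂ V] (A : VOA V) (D : VCat)
    {W₁ W₂ W₃ W₁₂ W₂₃ W₁₂_₃ W₁_₂₃ : Type u}
    [AddCommGroup W₁] [Module ℂ W₁] [AddCommGroup W₂] [Module ℂ W₂]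
    [AddCommGroup W₃] [Module ℂ W₃] [AddCommGroup W₁₂] [Module ℂ W₁₂]
    [AddCommGroup W₂₃] [Module ℂ W₂₃] [AddCommGroup W₁₂_₃] [Module ℂ W₁₂_₃]
    [AddCommGroup W₁_₂₃] [Module ℂ W₁_₂₃]
    (Y₁ : WeakModule A W₁) (Y₂ : WeakModule A W₂) (Y₃ : WeakModule A W₃)
    (Y₁₂ : WeakModule A W₁₂) (Y₂₃ : WeakModule A W₂₃)
    (Y₁₂_₃ : WeakModule A W₁₂_₃) (Y₁_₂₃ : WeakModule A W₁_₂₃)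
    (hW₁ : D.Mem Y₁) (hW₂ : D.Mem Y₂) (hW₃ : D.Mem Y₃)
    (F₁₂ : IntertwiningOperator Y₁ Y₂ Y₁₂) (hF₁₂ : IsVTensorProduct D F₁₂)
    (F₁₂_₃ : IntertwiningOperator Y₁₂ Y₃ Y₁₂_₃) (hF₁₂_₃ : IsVTensorProduct D F₁₂_₃)
    (F₂₃ : IntertwiningOperator Y₂ Y₃ Y₂₃) (hF₂₃ : IsVTensorProduct D F₂₃)
    (F₁_₂₃ : IntertwiningOperator Y₁ Y₂₃ Y₁_₂₃) (hF₁_₂₃ : IsVTensorProduct D F₁_₂₃)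
    (hconv : ConvergenceExtensionIterates F₁₂ F₁₂_₃)
    (hM : SpaceMInCategory D F₁₂ F₁₂_₃) :
    ∃ g : W₁_₂₃ →ₗ[ℂ] W₁₂_₃, IsHom Y₁_₂₃ Y₁₂_₃ g ∧
      ∀ (w₁ : W₁) (w₂ : W₂) (w₃ : W₃) (w' : Dual ℂ W₁₂_₃), Y₁₂_₃.MemDual w' →
        IsE12 (iterateSeries F₁₂ F₁₂_₃ w' w₁ w₂ w₃)
          (productSeries F₁_₂₃ F₂₃ (w' ∘ₗ g) w₁ w₂ w₃) := by
  obtain ⟨φ, hφ⟩ := exists_phi hconv hW₁.spanned hW₂.spanned hW₃.spanned hF₁₂_₃.1.spanned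
  have h : PhiData F₁₂ F₁₂_₃ φ :=
    ⟨hφ, PhiSpec.phiBound hφ hconv hW₁.spanned hF₁₂_₃.1.spanned, hW₁.spanned, hW₂.spanned,
      hW₃.spanned, hF₁₂_₃.1.spanned, hF₁₂_₃.1.lowerTrunc⟩
  -- `ψ` sends `F₂₃(w₂,z₂)w₃` to the operators `φ(w₂,w₃;z₁,z₂)`; this is where `M` must lie in the
  -- category.
  obtain ⟨ψ, ⟨hψ, hψF⟩, -⟩ := hF₂₃.2 _ h.weakModule (h.mem_category hM) h.intertwiner
  -- The evaluation composed with `ψ` is an intertwining operator on `W₁` and `W₂₃`, so it factors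
  -- through `F₁_₂₃`.
  obtain ⟨g, ⟨hg, hgF⟩, -⟩ := hF₁_₂₃.2 _ Y₁₂_₃ hF₁₂_₃.1 (h.evaluation.compHom hψ)
  refine ⟨g, hg, fun w₁ w₂ w₃ w' hw' => ?_⟩
  have key : ∀ n r : ℂ, g (F₁_₂₃.mode r w₁ (F₂₃.mode n w₂ w₃)) = φ n w₂ w₃ r w₁ := by
    intro n r
    rw [← hgF, IntertwiningOperator.compHom_mode, ← hψF]
    rfl
  have h1 : productSeries F₁_₂₃ F₂₃ (w' ∘ₗ g) w₁ w₂ w₃ =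
      fun p q => w' (φ (-q - 1) w₂ w₃ (-p - 1) w₁) := by
    funext p q
    simp only [productSeries, LinearMap.comp_apply, key]
  rw [h1]
  exact hφ w₁ w₂ w₃ w' hw'
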